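/- A \emph{set augmented finite automaton} (SAFA) is a tuple $M=(Q,\Sigma\times D,q_0,F,H,\delta)$, where $Q$ is a finite set of states, $\Sigma$ a finite alphabet, $D$ a countably infinite set of data values, $q_0\in Q$, $F\subseteq Q$, $H$ is a finite set of variables, each of which holds a finite subset of $D$, and $\delta\subseteq Q\times\Sigma\times C\times OP\times Q$ with $C=\{p(h),\,!p(h) : h\in H\}$ and $OP=\{-\}\cup\{\mathsf{ins}(h) : h\in H\}$. A configuration consists of a state and the contents of the sets in $H$. A run starts in $q_0$ with all sets empty. Reading a pair $(a,d)\in\Sigma\times D$ in state $q$, the automaton may execute a transition $(q,a,\alpha,op,q')\in\delta$ if $\alpha=p(h)$ and $d$ is in the current content of $h$, or $\alpha={!p(h)}$ and $d$ is not in the current content of $h$; it then goes to the state $q'$, and inserts $d$ into $h'$ if $op=\mathsf{ins}(h')$, and leaves the sets unchanged if $op=-$. A data word $w\in(\Sigma\times D)^*$ is in $L(M)$ if some run on $w$ consumes all of $w$ and ends in a state of $F$. The SAFA $M$ is a \emph{singleton} if $|H|=1$. The \emph{nonemptiness problem for singleton SAFA} is: given a singleton SAFA $M$ (by a listing, over a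 fixed finite alphabet, of $Q$, $\Sigma$, $q_0$, $F$, $H$ and $\delta$, where states, letters and sets are named by binary words), decide whether $L(M)\neq\emptyset$. \textbf{Theorem.} The nonemptiness problem for singleton SAFA is $\mathsf{NL}$-complete: it is accepted by a nondeterministic Turing machine working in space $O(\log n)$, and every language in $\mathsf{NL}$ reduces to it by a many-one reduction computable by a deterministic Turing machine in logarithmic space. -/

import Mathlib

/-! ### Set augmented finite automata -/

/-- The conditions `p(h)` (the current data value is in `h`) and `!p(h)` (it is not in `h`). -/
inductive SAFACond (N : Type) : Type where
  | mem (h : N)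
  | notMem (h : N)

/-- The operations `-` (no insertion) and `ins(h)` (insert the current data value into `h`). -/
inductive SAFAOp (N : Type) : Type where
  | skip
  | ins (h : N)

/-- The set named by a condition. -/
def SAFACond.target {N : Type} : SAFACond N → N
  | .mem h => h
  | .notMem h => h

/-- The set (if any) named by an operation. -/
def SAFAOp.target? {N : Type} : SAFAOp N → Option N
  | .skip => none
  | .ins h => some h

/-- A transition `(q, a, α, op, q')`. -/
structure SAFATransition (N : Type) : Type where
  src : N
  letter : N
  cond : SAFACond N
  op : SAFAOp N
  tgt : N

/-- A set augmented finite automaton `(Q, Σ × D, q₀, F, H, δ)`.  The states, the letters and the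
sets in `H` are named by elements of `N`; the set `D` of data values enters with the semantics. -/
structure SAFA (N : Type) : Type where
  states : Finset N
  alphabet : Finset N
  start : N
  final : Finset N
  sets : Finset N
  trans : Finset (SAFATransition N)
  start_mem : start ∈ states
  final_subset : final ⊆ states
  src_mem : ∀ t ∈ trans, t.src ∈ states
  letter_mem : ∀ t ∈ trans, t.letter ∈ alphabet
  cond_mem : ∀ t ∈ trans, t.cond.target ∈ sets
  op_mem : ∀ t ∈ trans, ∀ h ∈ t.op.target?, h ∈ sets
  tgt_mem : ∀ t ∈ trans, t.tgt ∈ states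

/-- Truth of a condition for the data value `d` when the sets have contents `h`. -/
def SAFACond.Holds {N : Type} {D : Type*} (h : N → Set D) (d : D) : SAFACond N → Prop
  | .mem i => d ∈ h i
  | .notMem i => d ∉ h i

open Classical in
/-- Effect of an operation on the contents of the sets when the data value `d` is read. -/
noncomputable def SAFAOp.apply {N : Type} {D : Type*} (h : N → Set D) (d : D) :
    SAFAOp N → (N → Set D)
  | .skip => h
  | .ins i => Function.update h i (insert d (h i))

/-- `M.Run q h w q' h'`: reading the data word `w`, the automaton can go from the configuration
`(q, h)` to the configuration `(q', h')`. -/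
inductive SAFA.Run {N : Type} {D : Type*} (M : SAFA N) :
    N → (N → Set D) → List (N × D) → N → (N → Set D) → Prop where
  | nil (q : N) (h : N → Set D) : SAFA.Run M q h [] q h
  | cons (t : SAFATransition N) (ht : t ∈ M.trans) (h : N → Set D) (d : D)
      (hc : t.cond.Holds h d) (w : List (N × D)) (q' : N) (h' : N → Set D)
      (hr : SAFA.Run M t.tgt (t.op.apply h d) w q' h') :
      SAFA.Run M t.src h ((t.letter, d) :: w) q' h'

/-- The data language `L(M)`; all sets are empty at the beginning of a run.
(The letters of an accepted word are in `M.alphabet`, since those of the transitions are.) -/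
def SAFA.language {N : Type} (M : SAFA N) (D : Type*) : Language (N × D) :=
  {w | ∃ q ∈ M.final, ∃ h, M.Run M.start (fun _ => ∅) w q h}

/-- A SAFA is a singleton if it has exactly one set. -/
def SAFA.IsSingleton {N : Type} (M : SAFA N) : Prop := M.sets.card = 1

/-! ### Instances as words -/

/-- The symbols in which automata are written down. -/
inductive SAFASymbol : Type where
  | bit (b : Bool)
  | comma
  | semicolon
  | isIn
  | notIn
  | noIns
  | ins
  deriving DecidableEq, Fintype

/-- A name is a binary word; it is written followed by a comma. -/
def encodeName (s : List Bool) : List SAFASymbol := s.map .bit ++ [.comma]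

/-- A list of names, terminated by a semicolon. -/
def encodeNames (l : List (List Bool)) : List SAFASymbol := l.flatMap encodeName ++ [.semicolon]

def encodeCond : SAFACond (List Bool) → List SAFASymbol
  | .mem h => .isIn :: encodeName h
  | .notMem h => .notIn :: encodeName h

def encodeOp : SAFAOp (List Bool) → List SAFASymbol
  | .skip => [.noIns]
  | .ins h => .ins :: encodeName h

def encodeTransition (t : SAFATransition (List Bool)) : List SAFASymbol :=
  encodeName t.src ++ encodeName t.letter ++ encodeCond t.cond ++ encodeOp t.op ++ encodeName t.tgt

/-- The word `w` describes the automaton `M`, whose states, letters and sets have binary names: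
it lists `Q`, `Σ`, `q₀`, `F`, `H` and `δ`.  A finite set may be listed in any order and with
repetitions. -/
def SAFA.EncodedBy (M : SAFA (List Bool)) (w : List SAFASymbol) : Prop :=
  ∃ (Q A F H : List (List Bool)) (T : List (SAFATransition (List Bool))),
    (∀ q, q ∈ Q ↔ q ∈ M.states) ∧ (∀ a, a ∈ A ↔ a ∈ M.alphabet) ∧
    (∀ q, q ∈ F ↔ q ∈ M.final) ∧ (∀ h, h ∈ H ↔ h ∈ M.sets) ∧ (∀ t, t ∈ T ↔ t ∈ M.trans) ∧
    w = encodeNames Q ++ encodeNames A ++ encodeName M.start ++ encodeNames F ++ encodeNames H ++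
      T.flatMap encodeTransition

/-- The nonemptiness problem for singleton SAFA over the data values `D`, as a formal language. -/
def SingletonSAFANonemptiness (D : Type*) : Language SAFASymbol :=
  {w | ∃ M : SAFA (List Bool), M.EncodedBy w ∧ M.IsSingleton ∧ ∃ v, v ∈ M.language D}

/-! ### Turing machines with a read-only input tape, work tapes and a write-only output tape -/

inductive HeadMove : Type where
  | left
  | stay
  | right

/-- New head position on a one-way infinite tape; a left move from cell `0` has no effect. -/
def HeadMove.move : HeadMove → ℕ → ℕ
  | .left, p => p - 1
  | .stay, p => p
  | .right, p => p + 1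

/-- Content of an input cell: a letter or one of the two end markers. -/
inductive InputSymbol (α : Type) : Type where
  | leftEnd
  | letter (a : α)
  | rightEnd

/-- The input tape for `x`: the left end marker in cell `0`, the word `x` in the cells `1, …, |x|`,
and the right end marker in cell `|x| + 1`. -/
def readInput {α : Type} (x : List α) : ℕ → InputSymbol α
  | 0 => .leftEnd
  | p + 1 => match x[p]? with
    | some a => .letter a
    | none => .rightEnd

/-- One possible action of a machine: new control state, move of the input head, symbols written
on the work tapes, moves of the work heads, and the symbol (if any) appended to the output. -/
structure TMAction (β State Γ : Type) (k : ℕ) : Type where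
  state : State
  inMove : HeadMove
  write : Fin k → Γ
  workMove : Fin k → HeadMove
  out : Option β

/-- A (nondeterministic) Turing machine with input alphabet `α` and output alphabet `β`. -/
structure OfflineTM (α β : Type) : Type 1 where
  State : Type
  Γ : Type
  finite_state : Finite State
  finite_Γ : Finite Γ
  /-- number of work tapes -/
  k : ℕ
  blank : Γ
  start : State
  accept : Set State
  next : State → InputSymbol α → (Fin k → Γ) → Set (TMAction β State Γ k)

namespace OfflineTM

variable {α β : Type}

structure Config (M : OfflineTM α β) : Type where
  state : M.State
  inPos : ℕ
  tape : Fin M.k → ℕ → M.Γ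
  pos : Fin M.k → ℕ
  out : List β

/-- The initial configuration. -/
def startConfig (M : OfflineTM α β) : M.Config where
  state := M.start
  inPos := 0
  tape := fun _ _ => M.blank
  pos := fun _ => 0
  out := []

/-- The actions available in a configuration on input `x`. -/
def actions (M : OfflineTM α β) (x : List α) (c : M.Config) : Set (TMAction β M.State M.Γ M.k) :=
  M.next c.state (readInput x c.inPos) (fun i => c.tape i (c.pos i))

/-- The result of an action.  The input head does not leave the cells `0, …, |x| + 1`. -/
def perform (M : OfflineTM α β) (x : List α) (c : M.Config) (a : TMAction β M.State M.Γ M.k) :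
    M.Config where
  state := a.state
  inPos := min (a.inMove.move c.inPos) (x.length + 1)
  tape := fun i => Function.update (c.tape i) (c.pos i) (a.write i)
  pos := fun i => (a.workMove i).move (c.pos i)
  out := c.out ++ a.out.toList

def Step (M : OfflineTM α β) (x : List α) (c c' : M.Config) : Prop :=
  ∃ a ∈ M.actions x c, c' = M.perform x c a

/-- `c` occurs in some computation on input `x`. -/
def Reachable (M : OfflineTM α β) (x : List α) (c : M.Config) : Prop :=
  Relation.ReflTransGen (M.Step x) M.startConfig c

/-- Some computation on `x` reaches an accepting state. -/
def Accepts (M : OfflineTM α β) (x : List α) : Prop :=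
  ∃ c, M.Reachable x c ∧ c.state ∈ M.accept

def IsDeterministic (M : OfflineTM α β) : Prop :=
  ∀ q a w, (M.next q a w).Subsingleton

/-- The machine works in space `O(log n)`: in every computation on an input of length `n`, the
heads of the work tapes visit only the first `C (log₂ n + 1)` cells, for a constant `C`. -/
def IsLogSpace (M : OfflineTM α β) : Prop :=
  ∃ C : ℕ, ∀ (x : List α) (c : M.Config), M.Reachable x c →
    ∀ i, c.pos i < C * (Nat.log 2 x.length + 1)

/-- On input `x`, the machine has a computation that halts with output `y`. -/
def Outputs (M : OfflineTM α β) (x : List α) (y : List β) : Prop :=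
  ∃ c, M.Reachable x c ∧ M.actions x c = ∅ ∧ c.out = y

end OfflineTM

/-! ### The class NL -/

/-- `L` is in NL: a nondeterministic machine (without output) accepts it in logarithmic space. -/
def InNL {α : Type} [Finite α] (L : Language α) : Prop :=
  ∃ M : OfflineTM α Empty, M.IsLogSpace ∧ ∀ x, x ∈ L ↔ M.Accepts x

/-- `f` is computed by a deterministic logarithmic-space machine. -/
def IsLogSpaceComputable {α β : Type} [Finite α] [Finite β] (f : List α → List β) : Prop :=
  ∃ M : OfflineTM α β, M.IsDeterministic ∧ M.IsLogSpace ∧ ∀ x, M.Outputs x (f x)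

/-- Logarithmic-space many-one reducibility. -/
def LogSpaceReduces {α β : Type} [Finite α] [Finite β] (A : Language α) (B : Language β) : Prop :=
  ∃ f : List α → List β, IsLogSpaceComputable f ∧ ∀ x, x ∈ A ↔ f x ∈ B

/-- `L` is NL-hard: every language in NL, over any finite alphabet, reduces to it. -/
def IsNLHard {β : Type} [Finite β] (L : Language β) : Prop :=
  ∀ (α : Type) [Finite α] (A : Language α), InNL A → LogSpaceReduces A L

def IsNLComplete {β : Type} [Finite β] (L : Language β) : Prop :=
  InNL L ∧ IsNLHard L

/-! With a single set, whose content is finite at all times, only the emptiness of this set matters.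
A transition guarded by `!p(h)` can always be executed, because the infinite `D` has a value outside
the set; one guarded by `p(h)` can be executed as soon as the set is nonempty; and nothing is ever
deleted. So nonemptiness is reachability in a graph on pairs of a state and a flag:
`SAFA.nonempty_iff`.

Membership in NL. A two-way automaton with several heads (`HeadProgram`) keeps boundedly many
pointers into the input, and a Turing machine can store each pointer in a binary counter of
logarithmic length: `HeadProgram.inNL` and `HeadProgram.isLogSpaceComputable`. Programs are composed
by combinators and described by the relation between the head positions before and after. Since the
encoding is uniquely readable, five heads suffice to check that the input describes a singleton
automaton (`checkValid_sound`, `checkValid_complete`) and to guess a path in the graph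
(`moves_checkProductive`); the flag is the position 0 or 1 of one head.

Hardness. A directed graph becomes an automaton whose transitions are guarded by `!p(h)` and insert
nothing, so that nonemptiness is reachability in the graph (`SAFAData.word_ofGraph_mem_iff`). This
is applied to the configuration graph of a logarithmic-space machine. A node consists of the state
with the scanned work symbols, the input position, and two numbers per work tape, which code the
parts left and right of the head in a fixed base. These numbers are polynomially bounded, and both
ends of an edge are affine in common parameters. Hence finitely many schemas describe all edges, and
a deterministic multi-head automaton prints them by running through all parameter values and writing
the numbers in unary. Accepting configurations get an edge to the empty name, which is the target.
The printed graph also has edges at nodes that represent no reachable configuration. They do no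
harm: a path from the initial node runs through reachable configurations until it uses an edge from
an accepting one (`accepts_of_reflTransGen`; conversely `reflTransGen_of_reachable`). -/

/-! ### Multi-head automata -/

/-- Head position after a move on the cells `0, …, n + 1`. -/
def HeadMove.moveWithin (n : ℕ) : HeadMove → ℕ → ℕ
  | .left, p => p - 1
  | .stay, p => p
  | .right, p => if p ≤ n then p + 1 else p

/-- Reconciles the blocked right move with the clamping by `min` in `OfflineTM.perform`. -/
theorem HeadMove.moveWithin_eq_min {n p : ℕ} (m : HeadMove) (hp : p ≤ n + 1) :
    m.moveWithin n p = min (m.move p) (n + 1) := by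
  cases m <;> simp only [moveWithin, move]
  · omega
  · omega
  · split_ifs <;> omega

theorem HeadMove.moveWithin_le {n p : ℕ} (m : HeadMove) (hp : p ≤ n + 1) :
    m.moveWithin n p ≤ n + 1 := by
  rw [m.moveWithin_eq_min hp]; exact min_le_right _ _

/-- A finite automaton with several two-way heads on the input tape and an output tape.  At each
node one of the heads is active: its symbol is read and it is moved.  The target `none` is the
exit. -/
structure HeadProgram (α β ι : Type) : Type 1 where
  Node : Type
  finite_node : Finite Node
  start : Node
  head : Node → ι
  next : Node → InputSymbol α → Set (Option Node × HeadMove × Option β)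

namespace HeadProgram

variable {α β ι : Type} [DecidableEq ι]

/-- Head positions after a move of the head `j`. -/
def moveHead (x : List α) (ρ : ι → ℕ) (j : ι) (m : HeadMove) : ι → ℕ :=
  Function.update ρ j (m.moveWithin x.length (ρ j))

@[simp] theorem moveHead_stay (x : List α) (ρ : ι → ℕ) (j : ι) :
    moveHead x ρ j .stay = ρ := by
  simp [moveHead, HeadMove.moveWithin]

/-- `F.Run x t ρ o ρ'`: from the node `t` with head positions `ρ`, the automaton can reach the exit
with head positions `ρ'`, writing `o`. -/
inductive Run (F : HeadProgram α β ι) (x : List α) :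
    Option F.Node → (ι → ℕ) → List β → (ι → ℕ) → Prop
  | exit (ρ : ι → ℕ) : Run F x none ρ [] ρ
  | step {n : F.Node} {ρ : ι → ℕ} {t : Option F.Node} {m : HeadMove} {o : Option β}
      {out : List β} {ρ' : ι → ℕ}
      (h : (t, m, o) ∈ F.next n (readInput x (ρ (F.head n))))
      (hr : Run F x t (moveHead x ρ (F.head n) m) out ρ') :
      Run F x (some n) ρ (o.toList ++ out) ρ'

/-- The relation between initial and final head positions, with the output. -/
def Rel (F : HeadProgram α β ι) (x : List α) (ρ : ι → ℕ) (o : List β) (ρ' : ι → ℕ) : Prop :=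
  F.Run x (some F.start) ρ o ρ'

omit [DecidableEq ι] in
/-- At most one action is possible at any time. -/
def Det (F : HeadProgram α β ι) : Prop := ∀ n a, (F.next n a).Subsingleton

theorem Run.none_iff {F : HeadProgram α β ι} {x : List α} {ρ ρ' : ι → ℕ} {o : List β} :
    F.Run x none ρ o ρ' ↔ o = [] ∧ ρ' = ρ := by
  constructor
  · rintro ⟨⟩; exact ⟨rfl, rfl⟩
  · rintro ⟨rfl, rfl⟩; exact .exit _

theorem Run.some_iff {F : HeadProgram α β ι} {x : List α} {n : F.Node} {ρ ρ' : ι → ℕ} {o : List β} :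
    F.Run x (some n) ρ o ρ' ↔ ∃ t m o₁ o₂, (t, m, o₁) ∈ F.next n (readInput x (ρ (F.head n))) ∧
      F.Run x t (moveHead x ρ (F.head n) m) o₂ ρ' ∧ o = o₁.toList ++ o₂ := by
  constructor
  · rintro ⟨⟩
    exact ⟨_, _, _, _, ‹_›, ‹_›, rfl⟩
  · rintro ⟨t, m, o₁, o₂, h, hr, rfl⟩
    exact .step h hr

theorem Det.run_unique {F : HeadProgram α β ι} (hF : F.Det) {x : List α} {t : Option F.Node}
    {ρ ρ₁ ρ₂ : ι → ℕ} {o₁ o₂ : List β} (h₁ : F.Run x t ρ o₁ ρ₁) (h₂ : F.Run x t ρ o₂ ρ₂) :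
    o₁ = o₂ ∧ ρ₁ = ρ₂ := by
  induction h₁ generalizing o₂ ρ₂ with
  | exit ρ => obtain ⟨rfl, rfl⟩ := Run.none_iff.1 h₂; exact ⟨rfl, rfl⟩
  | step h hr ih =>
    obtain ⟨t', m', o', o'', h', hr', rfl⟩ := Run.some_iff.1 h₂
    have := hF _ _ h h'
    simp only [Prod.mk.injEq] at this
    obtain ⟨rfl, rfl, rfl⟩ := this
    obtain ⟨rfl, rfl⟩ := ih hr'
    exact ⟨rfl, rfl⟩

/-- For a deterministic program one exhibited run settles the whole relation; all deterministic
building blocks are analysed in this way. -/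
theorem Det.rel_iff {F : HeadProgram α β ι} (hF : F.Det) {x : List α} {ρ ρ₁ ρ₂ : ι → ℕ}
    {o₁ o₂ : List β}
    (h₁ : F.Rel x ρ o₁ ρ₁) : F.Rel x ρ o₂ ρ₂ ↔ o₂ = o₁ ∧ ρ₂ = ρ₁ := by
  constructor
  · intro h₂
    obtain ⟨rfl, rfl⟩ := hF.run_unique h₁ h₂
    exact ⟨rfl, rfl⟩
  · rintro ⟨rfl, rfl⟩; exact h₁

/-- Runs inside a part `F` of an automaton `G`, when leaving `F` means going to `z`. -/
theorem run_embed {F G : HeadProgram α β ι} (e : F.Node → G.Node) (z : Option G.Node)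
    (hhead : ∀ n, G.head (e n) = F.head n)
    (hnext : ∀ n a, G.next (e n) a =
      (fun t => (t.1.elim z (fun m => some (e m)), t.2)) '' F.next n a)
    (x : List α) (t : Option F.Node) (ρ ρ'' : ι → ℕ) (o : List β) :
    G.Run x (t.elim z (fun m => some (e m))) ρ o ρ'' ↔
      ∃ o₁ ρ' o₂, F.Run x t ρ o₁ ρ' ∧ G.Run x z ρ' o₂ ρ'' ∧ o = o₁ ++ o₂ := by
  constructor
  · intro h
    generalize hs : t.elim z (fun m => some (e m)) = s at h
    induction h generalizing t with
    | exit ρ =>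
      cases t with
      | none => exact ⟨[], _, [], .exit _, by subst hs; exact .exit _, rfl⟩
      | some n => simp at hs
    | @step n ρ s' m o out ρ' h hr ih =>
      cases t with
      | none =>
        simp only [Option.elim] at hs
        exact ⟨[], _, _, .exit _, by subst hs; exact .step h hr, rfl⟩
      | some n' =>
        simp only [Option.elim, Option.some.injEq] at hs
        subst hs
        rw [hnext, hhead] at h
        obtain ⟨⟨t', m', o'⟩, ht, heq⟩ := h
        simp only [Prod.mk.injEq] at heq
        obtain ⟨heq, rfl, rfl⟩ := heq
        obtain ⟨o₁, ρ₁, o₂, h₁, h₂, rfl⟩ := ih t' heq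
        rw [hhead] at h₁
        exact ⟨_, _, _, .step ht h₁, h₂, by simp⟩
  · rintro ⟨o₁, ρ', o₂, h₁, h₂, rfl⟩
    induction h₁ with
    | exit ρ => simpa using h₂
    | @step n ρ t' m o out ρ' h hr ih =>
      simp only [Option.elim, List.append_assoc]
      refine .step (t := t'.elim z (fun m => some (e m))) (m := m) ?_ ?_
      · rw [hnext, hhead]
        exact ⟨_, h, rfl⟩
      · rw [hhead]; exact ih h₂

/-- Read the symbol under the head `j`, move this head and write. -/
def atom (j : ι) (f : InputSymbol α → Set (HeadMove × Option β)) : HeadProgram α β ι where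
  Node := Unit
  finite_node := inferInstance
  start := ()
  head _ := j
  next _ a := (fun t => (none, t)) '' f a

theorem rel_atom {j : ι} {f : InputSymbol α → Set (HeadMove × Option β)} {x : List α}
    {ρ ρ' : ι → ℕ} {o : List β} : (atom j f).Rel x ρ o ρ' ↔
      ∃ m o', (m, o') ∈ f (readInput x (ρ j)) ∧ o = o'.toList ∧ ρ' = moveHead x ρ j m := by
  rw [Rel, Run.some_iff]
  constructor
  · rintro ⟨t, m, o₁, o₂, ⟨⟨m', o'⟩, h, heq⟩, hr, rfl⟩
    obtain ⟨rfl, rfl, rfl⟩ := heq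
    obtain ⟨rfl, rfl⟩ := Run.none_iff.1 hr
    exact ⟨_, _, h, by simp, rfl⟩
  · rintro ⟨m, o', h, rfl, rfl⟩
    exact ⟨none, m, o', [], ⟨_, h, rfl⟩, .exit _, by simp⟩

omit [DecidableEq ι] in
theorem det_atom {j : ι} {f : InputSymbol α → Set (HeadMove × Option β)}
    (hf : ∀ a, (f a).Subsingleton) : (atom j f).Det := fun _ _ => (hf _).image _

/-- Sequential composition. -/
def seq (F G : HeadProgram α β ι) : HeadProgram α β ι where
  Node := F.Node ⊕ G.Node
  finite_node := by have := F.finite_node; have := G.finite_node; infer_instance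
  start := .inl F.start
  head := Sum.elim F.head G.head
  next
    | .inl n, a => (fun t => (t.1.elim (some (.inr G.start)) (fun m => some (.inl m)), t.2)) ''
        F.next n a
    | .inr n, a => (fun t => (t.1.elim none (fun m => some (.inr m)), t.2)) '' G.next n a

/-- `run_embed` applies twice: leaving `F` means going to the start of `G`, and leaving `G` means
going to the exit. -/
theorem rel_seq {F G : HeadProgram α β ι} {x : List α} {ρ ρ'' : ι → ℕ} {o : List β} :
    (F.seq G).Rel x ρ o ρ'' ↔
      ∃ o₁ ρ' o₂, F.Rel x ρ o₁ ρ' ∧ G.Rel x ρ' o₂ ρ'' ∧ o = o₁ ++ o₂ := by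
  have h₁ := run_embed (F := F) (G := F.seq G) .inl (some (.inr G.start)) (fun _ => rfl)
    (fun _ _ => rfl) x (some F.start) ρ ρ'' o
  have h₂ := fun ρ' o₂ => run_embed (F := G) (G := F.seq G) .inr none (fun _ => rfl)
    (fun _ _ => rfl) x (some G.start) ρ' ρ'' o₂
  refine h₁.trans ?_
  simp only [Option.elim] at h₂
  simp only [h₂, Run.none_iff]
  constructor
  · rintro ⟨o₁, ρ', o₂, hF, ⟨o₃, ρ₃, o₄, hG, ⟨rfl, rfl⟩, rfl⟩, rfl⟩
    exact ⟨o₁, ρ', o₃, hF, hG, by simp⟩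
  · rintro ⟨o₁, ρ', o₂, hF, hG, rfl⟩
    exact ⟨o₁, ρ', o₂, hF, ⟨o₂, ρ'', [], hG, ⟨rfl, rfl⟩, by simp⟩, rfl⟩

omit [DecidableEq ι] in
theorem Det.seq {F G : HeadProgram α β ι} (hF : F.Det) (hG : G.Det) : (F.seq G).Det := by
  rintro (n | n) a
  · exact (hF n a).image _
  · exact (hG n a).image _

/-- Guarded choice: read the symbol `a` under the head `j` and run one of the `P i` for
`i ∈ sel a`. -/
def alt {I : Type} [Finite I] (j : ι) (sel : InputSymbol α → Set I) (P : I → HeadProgram α β ι) :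
    HeadProgram α β ι where
  Node := Option (Σ i, (P i).Node)
  finite_node := by have := fun i => (P i).finite_node; infer_instance
  start := none
  head n := n.elim j (fun n => (P n.1).head n.2)
  next
    | none, a => (fun i => (some (some ⟨i, (P i).start⟩), .stay, none)) '' sel a
    | some n, a => (fun t => (t.1.elim none (fun m => some (some ⟨n.1, m⟩)), t.2)) ''
        (P n.1).next n.2 a

theorem rel_alt {I : Type} [Finite I] {j : ι} {sel : InputSymbol α → Set I}
    {P : I → HeadProgram α β ι} {x : List α} {ρ ρ' : ι → ℕ} {o : List β} :
    (alt j sel P).Rel x ρ o ρ' ↔ ∃ i ∈ sel (readInput x (ρ j)), (P i).Rel x ρ o ρ' := by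
  have h₁ := fun i => run_embed (F := P i) (G := alt j sel P) (fun n => some ⟨i, n⟩) none
    (fun _ => rfl) (fun _ _ => rfl) x (some (P i).start) ρ ρ' o
  simp only [Run.none_iff, Option.elim] at h₁
  have h₂ : ∀ i, (alt j sel P).Run x (some (some ⟨i, (P i).start⟩)) ρ o ρ' ↔
      (P i).Rel x ρ o ρ' := by
    intro i
    rw [h₁]
    constructor
    · rintro ⟨o₁, ρ₁, o₂, h, ⟨rfl, rfl⟩, rfl⟩; simpa [Rel] using h
    · intro h; exact ⟨o, ρ', [], h, ⟨rfl, rfl⟩, by simp⟩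
  rw [Rel, Run.some_iff]
  constructor
  · rintro ⟨t, m, o₁, o₂, ⟨i, h, heq⟩, hr, rfl⟩
    obtain ⟨rfl, rfl, rfl⟩ := heq
    rw [moveHead_stay] at hr
    exact ⟨i, h, (h₂ i).1 hr⟩
  · rintro ⟨i, hi, h⟩
    refine ⟨_, _, _, o, ⟨i, hi, rfl⟩, ?_, by simp⟩
    rw [moveHead_stay]; exact (h₂ i).2 h

omit [DecidableEq ι] in
theorem det_alt {I : Type} [Finite I] {j : ι} {sel : InputSymbol α → Set I}
    {P : I → HeadProgram α β ι} (hs : ∀ a, (sel a).Subsingleton) (hP : ∀ i, (P i).Det) :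
    (alt j sel P).Det := by
  rintro (_ | n) a
  · exact (hs a).image _
  · exact (hP n.1 n.2 a).image _

/-- Guarded iteration: read the symbol `a` under the head `j`; if `true ∈ sel a`, `P` may be run
(and then the loop again); if `false ∈ sel a`, the loop may be left. -/
def loop (j : ι) (sel : InputSymbol α → Set Bool) (P : HeadProgram α β ι) : HeadProgram α β ι where
  Node := Option P.Node
  finite_node := by have := P.finite_node; infer_instance
  start := none
  head n := n.elim j P.head
  next
    | none, a => (fun b => (if b then some (some P.start) else none, .stay, none)) '' sel a
    | some n, a => (fun t => (t.1.elim (some none) (fun m => some (some m)), t.2)) '' P.next n a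

/-- The relation realized by a loop. -/
inductive Iterate (x : List α) (j : ι) (sel : InputSymbol α → Set Bool)
    (R : (ι → ℕ) → List β → (ι → ℕ) → Prop) : (ι → ℕ) → List β → (ι → ℕ) → Prop
  | halt {ρ : ι → ℕ} (h : false ∈ sel (readInput x (ρ j))) : Iterate x j sel R ρ [] ρ
  | more {ρ ρ₁ ρ₂ : ι → ℕ} {o₁ o₂ : List β} (h : true ∈ sel (readInput x (ρ j)))
      (h₁ : R ρ o₁ ρ₁) (h₂ : Iterate x j sel R ρ₁ o₂ ρ₂) : Iterate x j sel R ρ (o₁ ++ o₂) ρ₂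

theorem rel_loop {j : ι} {sel : InputSymbol α → Set Bool} {P : HeadProgram α β ι} {x : List α}
    {ρ ρ' : ι → ℕ} {o : List β} :
    (loop j sel P).Rel x ρ o ρ' ↔ Iterate x j sel (P.Rel x) ρ o ρ' := by
  have hemb := fun t ρ ρ' o => run_embed (F := P) (G := loop j sel P) some (some none)
    (fun _ => rfl) (fun _ _ => rfl) x t ρ ρ' o
  constructor
  -- Induction on the run needs a claim for both kinds of nodes: the loop node, and nodes of the
  -- body, from where the current pass must first be completed.
  · have key : ∀ t ρ o ρ', (loop j sel P).Run x t ρ o ρ' →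
        (t = some none → Iterate x j sel (P.Rel x) ρ o ρ') ∧
        (∀ n, t = some (some n) → ∃ o₁ ρ₁ o₂, P.Run x (some n) ρ o₁ ρ₁ ∧
          Iterate x j sel (P.Rel x) ρ₁ o₂ ρ' ∧ o = o₁ ++ o₂) := by
      intro t ρ o ρ' h
      induction h with
      | exit ρ => simp
      | @step n ρ t m o out ρ' h hr ih =>
        constructor
        · intro hn
          obtain rfl := Option.some.inj hn
          obtain ⟨b, hb, heq⟩ := h
          obtain ⟨rfl, rfl, rfl⟩ := heq
          rw [moveHead_stay] at ih hr
          cases b with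
          | false =>
            simp only [Bool.false_eq_true, if_false] at hr
            obtain ⟨rfl, rfl⟩ := Run.none_iff.1 hr
            exact .halt hb
          | true =>
            obtain ⟨o₁, ρ₁, o₂, h₁, h₂, rfl⟩ := ih.2 P.start rfl
            exact Iterate.more (R := P.Rel x) (o₁ := o₁) hb h₁ h₂
        · intro n' hn
          obtain rfl := Option.some.inj hn
          obtain ⟨⟨t', m', o'⟩, ht, heq⟩ := h
          obtain ⟨rfl, rfl, rfl⟩ := heq
          cases t' with
          | none => exact ⟨_, _, out, .step ht (.exit _), ih.1 rfl, by simp⟩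
          | some n'' =>
            obtain ⟨o₁, ρ₁, o₂, h₁, h₂, rfl⟩ := ih.2 n'' rfl
            exact ⟨_, _, o₂, .step ht h₁, h₂, by simp⟩
    exact fun h => (key _ _ _ _ h).1 rfl
  · intro h
    induction h with
    | @halt ρ h =>
      refine Run.some_iff.2 ⟨none, .stay, none, [], ⟨false, h, rfl⟩, ?_, by simp⟩
      rw [moveHead_stay]; exact .exit _
    | @more ρ ρ₁ ρ₂ o₁ o₂ h h₁ h₂ ih =>
      refine Run.some_iff.2 ⟨some (some P.start), .stay, none, o₁ ++ o₂, ⟨true, h, rfl⟩, ?_,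
        by simp⟩
      rw [moveHead_stay]
      exact (hemb (some P.start) _ _ _).2 ⟨o₁, ρ₁, o₂, h₁, ih, rfl⟩

omit [DecidableEq ι] in
theorem Det.loop {j : ι} {sel : InputSymbol α → Set Bool} {P : HeadProgram α β ι}
    (hs : ∀ a, (sel a).Subsingleton) (hP : P.Det) : (loop j sel P).Det := by
  rintro (_ | n) a
  · exact (hs a).image _
  · exact (hP n a).image _

/-- Renaming of the heads. -/
def mapHeads {κ : Type} (e : ι → κ) (F : HeadProgram α β ι) : HeadProgram α β κ where
  Node := F.Node
  finite_node := F.finite_node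
  start := F.start
  head n := e (F.head n)
  next := F.next

/-- Injectivity of `e` makes the move of one head again the move of one head; surjectivity recovers
the final positions from their composition with `e`. -/
theorem rel_mapHeads {κ : Type} [DecidableEq κ] (e : ι ≃ κ) {F : HeadProgram α β ι} {x : List α}
    {ρ ρ' : κ → ℕ} {o : List β} :
    (F.mapHeads e).Rel x ρ o ρ' ↔ F.Rel x (ρ ∘ e) o (ρ' ∘ e) := by
  have hmove : ∀ (ρ : κ → ℕ) (j : ι) (m : HeadMove),
      moveHead x ρ (e j) m ∘ e = moveHead x (ρ ∘ e) j m := by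
    intro ρ j m
    funext i
    by_cases hij : i = j <;> simp [moveHead, hij]
  have back : ∀ (t : Option F.Node) (σ : ι → ℕ) (o : List β) (σ' : ι → ℕ), F.Run x t σ o σ' →
      ∀ ρ ρ' : κ → ℕ, ρ ∘ e = σ → ρ' ∘ e = σ' → (F.mapHeads e).Run x t ρ o ρ' := by
    intro t σ o σ' h
    induction h with
    | exit σ =>
      intro ρ ρ' hσ hσ'
      have : ρ' = ρ := by
        funext i
        have := congrFun (hσ'.trans hσ.symm) (e.symm i)
        simpa using this
      rw [this]; exact Run.exit (F := F.mapHeads e) _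
    | step h hr ih =>
      rintro ρ ρ' rfl hσ'
      exact Run.step (F := F.mapHeads e) h (ih _ _ (hmove _ _ _) hσ')
  have forth : ∀ (t : Option (F.mapHeads e).Node) (ρ : κ → ℕ) (o : List β) (ρ' : κ → ℕ),
      (F.mapHeads e).Run x t ρ o ρ' → F.Run x t (ρ ∘ e) o (ρ' ∘ e) := by
    intro t ρ o ρ' h
    induction h with
    | exit ρ => exact .exit _
    | step h hr ih => exact .step h (by rw [← hmove]; exact ih)
  exact ⟨fun h => forth _ _ _ _ h, fun h => back _ _ _ _ h _ _ rfl rfl⟩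

end HeadProgram

/-! ### Paths without branching -/

/-- From `a` the relation `r` leads to `c` along a path on which every point before `c` satisfies
`P` and has exactly one successor. -/
inductive Forced {A : Type*} (r : A → A → Prop) (P : A → Prop) : A → A → Prop
  | refl (a : A) : Forced r P a a
  | head {a b c : A} (hP : P a) (h : ∀ y, r a y ↔ y = b) (hbc : Forced r P b c) : Forced r P a c

theorem Forced.trans {A : Type*} {r : A → A → Prop} {P : A → Prop} {a b c : A}
    (h₁ : Forced r P a b) (h₂ : Forced r P b c) : Forced r P a c := by
  induction h₁ with
  | refl a => exact h₂
  | head hP h _ ih => exact .head hP h (ih h₂)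

theorem Forced.reflTransGen {A : Type*} {r : A → A → Prop} {P : A → Prop} {a b : A}
    (h : Forced r P a b) : Relation.ReflTransGen r a b := by
  induction h with
  | refl a => exact .refl
  | head hP h _ ih => exact .head ((h _).2 rfl) ih

theorem OfflineTM.step_iff_of_actions_eq {α β : Type} {M : OfflineTM α β} {x : List α}
    {c : M.Config} {a : TMAction β M.State M.Γ M.k} (h : M.actions x c = {a}) (y : M.Config) :
    M.Step x c y ↔ y = M.perform x c a := by
  simp [OfflineTM.Step, h]

/-! ### Counters in bijective base two -/

/-- The work tape symbols of a machine with binary counters. -/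
inductive CounterSymbol : Type where
  | blank
  | mark
  | one
  | two
  deriving DecidableEq

namespace CounterSymbol

instance : Finite CounterSymbol :=
  .of_surjective (fun i : Fin 4 => match i with
    | 0 => blank | 1 => mark | 2 => one | 3 => two)
    fun a => by
      cases a
      exacts [⟨0, rfl⟩, ⟨1, rfl⟩, ⟨2, rfl⟩, ⟨3, rfl⟩]

def IsDigit (a : CounterSymbol) : Prop := a = one ∨ a = two

/-- Adding one, least significant digit first. -/
def incr : List CounterSymbol → List CounterSymbol
  | [] => [one]
  | two :: l => one :: incr l
  | _ :: l => two :: l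

/-- Subtracting one, least significant digit first. -/
def decr : List CounterSymbol → List CounterSymbol
  | [] => []
  | two :: l => one :: l
  | _ :: [] => []
  | _ :: a :: l => two :: decr (a :: l)

theorem decr_one_cons (a : CounterSymbol) (l : List CounterSymbol) :
    decr (one :: a :: l) = two :: decr (a :: l) := rfl

theorem incr_ne_nil (l : List CounterSymbol) : incr l ≠ [] := by
  rcases l with _ | ⟨_ | _ | _ | _, l⟩ <;> simp [incr]

/-- In bijective base two a number has exactly one digit string, with zero the empty one. Hence
counting down undoes counting up literally, without leading zeros to normalise. -/
theorem decr_incr {l : List CounterSymbol} (hl : ∀ a ∈ l, a.IsDigit) : decr (incr l) = l := by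
  induction l with
  | nil => simp [incr, decr]
  | cons a l ih =>
    have ha := hl a (by simp)
    have ih := ih fun b hb => hl b (by simp [hb])
    rcases ha with rfl | rfl
    · simp [incr, decr]
    · obtain ⟨b, l', hb⟩ := List.exists_cons_of_ne_nil (incr_ne_nil l)
      rw [incr, hb, decr_one_cons, ← hb, ih]

theorem isDigit_incr {l : List CounterSymbol} (hl : ∀ a ∈ l, a.IsDigit) :
    ∀ a ∈ incr l, a.IsDigit := by
  induction l with
  | nil => simp [incr, IsDigit]
  | cons a l ih =>
    have ha := hl a (by simp)
    have hl' : ∀ b ∈ l, b.IsDigit := fun b hb => hl b (by simp [hb])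
    rcases ha with rfl | rfl
    · simp only [incr, List.mem_cons, forall_eq_or_imp]
      exact ⟨.inr rfl, hl'⟩
    · simp only [incr, List.mem_cons, forall_eq_or_imp]
      exact ⟨.inl rfl, ih hl'⟩

/-- The digits of a number, least significant first. -/
def digits : ℕ → List CounterSymbol
  | 0 => []
  | m + 1 => incr (digits m)

theorem isDigit_digits (m : ℕ) : ∀ a ∈ digits m, a.IsDigit := by
  induction m with
  | zero => simp [digits]
  | succ m ih => exact isDigit_incr ih

theorem decr_digits_succ (m : ℕ) : decr (digits (m + 1)) = digits m :=
  decr_incr (isDigit_digits m)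

/-- The number with given digits. -/
def value : List CounterSymbol → ℕ
  | [] => 0
  | two :: l => 2 + 2 * value l
  | _ :: l => 1 + 2 * value l

theorem value_incr {l : List CounterSymbol} (hl : ∀ a ∈ l, a.IsDigit) :
    value (incr l) = value l + 1 := by
  induction l with
  | nil => simp [incr, value]
  | cons a l ih =>
    have ha := hl a (by simp)
    have ih := ih fun b hb => hl b (by simp [hb])
    rcases ha with rfl | rfl
    · simp only [incr, value]; omega
    · simp only [incr, value, ih]; omega

theorem value_digits (m : ℕ) : value (digits m) = m := by
  induction m with
  | zero => simp [digits, value]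
  | succ m ih => rw [digits, value_incr (isDigit_digits m), ih]

/-- The smallest value of a given length has all digits one. No digit hypothesis is needed because
`value` counts every symbol other than `two` as one. -/
theorem two_pow_length_le (l : List CounterSymbol) : 2 ^ l.length ≤ value l + 1 := by
  induction l with
  | nil => simp [value]
  | cons a l ih =>
    rw [List.length_cons, pow_succ]
    cases a <;> simp only [value] <;> omega

/-- The extra cell is the blank behind the digits, which the head visits (cell 0 holds the mark).
The length is at most `Nat.log 2 n + 2`; the factor 5 is a generous constant. -/
theorem length_digits_le {m n : ℕ} (hm : m ≤ n + 1) :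
    (digits m).length + 1 < 5 * (Nat.log 2 n + 1) := by
  have h := two_pow_length_le (digits m)
  rw [value_digits] at h
  have h₁ : n < 2 ^ (Nat.log 2 n + 1) := Nat.lt_pow_succ_log_self (by norm_num) n
  have h₂ : 2 ^ (digits m).length < 2 ^ (Nat.log 2 n + 3) := by
    have : 2 ^ (Nat.log 2 n + 3) = 4 * 2 ^ (Nat.log 2 n + 1) := by ring
    omega
  have := (Nat.pow_lt_pow_iff_right (by norm_num : 1 < 2)).1 h₂
  omega

/-- The work tape that holds a list of digits. -/
def tape (l : List CounterSymbol) (i : ℕ) : CounterSymbol := (mark :: l)[i]?.getD blank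

theorem tape_zero (l : List CounterSymbol) : tape l 0 = mark := rfl

theorem tape_append (l l' : List CounterSymbol) :
    tape (l ++ l') (l.length + 1) = l'.head?.getD blank := by
  simp [tape, List.head?_eq_getElem?, List.getElem?_append]

theorem update_tape_append (l l' : List CounterSymbol) (a b : CounterSymbol) :
    Function.update (tape (l ++ a :: l')) (l.length + 1) b = tape (l ++ b :: l') := by
  funext i
  rcases i with _ | i
  · simp [tape]
  · by_cases h : i = l.length
    · subst h; simp [tape]
    · rw [Function.update_of_ne (by omega)]
      simp only [tape, List.getElem?_cons_succ]
      rcases lt_or_ge i l.length with h' | h'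
      · simp [List.getElem?_append_left h']
      · obtain ⟨d, hd⟩ : ∃ d, i - l.length = d + 1 := ⟨i - l.length - 1, by omega⟩
        simp [List.getElem?_append_right h', hd]

theorem update_tape_end (l : List CounterSymbol) (b : CounterSymbol) :
    Function.update (tape l) (l.length + 1) b = tape (l ++ [b]) := by
  funext i
  rcases i with _ | i
  · simp [tape]
  · by_cases h : i = l.length
    · subst h; simp [tape]
    · rw [Function.update_of_ne (by omega)]
      simp only [tape, List.getElem?_cons_succ]
      rcases lt_or_ge i l.length with h' | h'
      · simp [List.getElem?_append_left h']
      · rw [List.getElem?_eq_none (by omega),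
          List.getElem?_eq_none (by rw [List.length_append, List.length_singleton]; omega)]

theorem tape_append_blank (l : List CounterSymbol) : tape (l ++ [blank]) = tape l := by
  rw [← update_tape_end, Function.update_eq_self_iff]
  simp [tape]

/-- Guarantees that a sweep to the left stops at cell 0 and not earlier. -/
theorem tape_ne_mark {l : List CounterSymbol} (hl : ∀ a ∈ l, a.IsDigit) (i : ℕ) :
    tape l (i + 1) ≠ mark := by
  rw [tape, List.getElem?_cons_succ]
  rcases h : l[i]? with _ | a
  · simp
  · rcases hl a (List.mem_of_getElem? h) with rfl | rfl <;> simp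

end CounterSymbol

/-! ### Simulation of multi-head automata by Turing machines -/

/-- The phases in the simulation of a step of a multi-head automaton. -/
inductive SimPhase : Type where
  | init
  | rest
  | dec
  | erase
  | back
  | unload
  | inc
  | backInc

instance : Finite SimPhase :=
  .of_surjective (fun i : Fin 8 => match i with
    | 0 => .init | 1 => .rest | 2 => .dec | 3 => .erase | 4 => .back | 5 => .unload | 6 => .inc
    | 7 => .backInc)
    fun a => by
      cases a
      exacts [⟨0, rfl⟩, ⟨1, rfl⟩, ⟨2, rfl⟩, ⟨3, rfl⟩, ⟨4, rfl⟩, ⟨5, rfl⟩, ⟨6, rfl⟩, ⟨7, rfl⟩]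

namespace HeadProgram

variable {α β : Type} {k : ℕ}

/-- The states of the simulating machine. -/
abbrev SimState (F : HeadProgram α β (Fin k)) : Type := SimPhase × Option F.Node × Fin k

/-- The action that changes only the work tape `j`; `w` is what the heads read. -/
def simAct {F : HeadProgram α β (Fin k)} (w : Fin k → CounterSymbol) (j : Fin k)
    (s : F.SimState) (m : HeadMove) (g : CounterSymbol) (m' : HeadMove) (o : Option β) :
    TMAction β F.SimState CounterSymbol k where
  state := s
  inMove := m
  write := Function.update w j g
  workMove := Function.update (fun _ => .stay) j m'
  out := o

/-- The active head at a node (arbitrary at the exit). -/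
def active (F : HeadProgram α β (Fin k)) (t : Option F.Node) : Fin k := F.head (t.getD F.start)

/-- The transition function of the simulating machine.  The head positions are kept in counters.
To execute a step, the counter of the active head is counted down while the input head moves
from the left end to the position in question; after the step it is counted up again. -/
def simNext (F : HeadProgram α β (Fin k)) :
    F.SimState → InputSymbol α → (Fin k → CounterSymbol) →
      Set (TMAction β F.SimState CounterSymbol k)
  | (.init, t, j), _, _ => {⟨(.rest, t, j), .stay, fun _ => .mark, fun _ => .right, none⟩}
  | (.rest, none, _), _, _ => ∅
  | (.rest, some n, j), a, w =>
    -- A blank in the first digit cell means that the counter is empty and the input head has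
    -- arrived. The successor node is stored at once, while `j` remains the head whose counter must
    -- be rebuilt.
    if w j = .blank then
      (fun u => simAct w j (.unload, u.1, j) u.2.1 (w j) .stay u.2.2) '' F.next n a
    else {simAct w j (.dec, some n, j) .stay (w j) .stay none}
  | (.dec, t, j), _, w =>
    match w j with
    -- The borrow turns `one` into `two` and moves on. If a blank follows, the last `two` stands
    -- where the leading digit has to vanish, and `.erase` removes it.
    | .one => {simAct w j (.dec, t, j) .stay .two .right none}
    | .two => {simAct w j (.back, t, j) .stay .one .left none}
    | _ => {simAct w j (.erase, t, j) .stay .blank .left none}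
  | (.erase, t, j), _, w => {simAct w j (.back, t, j) .stay .blank .left none}
  | (.back, t, j), _, w =>
    if w j = .mark then {simAct w j (.rest, t, j) .right (w j) .right none}
    else {simAct w j (.back, t, j) .stay (w j) .left none}
  -- The input head walks back to the left end with one increment per cell, so the counter ends at
  -- the position after the move.
  | (.unload, t, j), a, w =>
    match a with
    | .leftEnd => {simAct w j (.rest, t, F.active t) .stay (w j) .stay none}
    | _ => {simAct w j (.inc, t, j) .left (w j) .stay none}
  | (.inc, t, j), _, w =>
    match w j with
    | .two => {simAct w j (.inc, t, j) .stay .one .right none}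
    | .one => {simAct w j (.backInc, t, j) .stay .two .left none}
    | _ => {simAct w j (.backInc, t, j) .stay .one .left none}
  | (.backInc, t, j), _, w =>
    if w j = .mark then {simAct w j (.unload, t, j) .stay (w j) .right none}
    else {simAct w j (.backInc, t, j) .stay (w j) .left none}

/-- The simulating machine. -/
def toTM (F : HeadProgram α β (Fin k)) : OfflineTM α β where
  State := F.SimState
  Γ := CounterSymbol
  finite_state := by have := F.finite_node; infer_instance
  finite_Γ := inferInstance
  k := k
  blank := .blank
  start := (.init, some F.start, F.head F.start)
  accept := {s | s.1 = .rest ∧ s.2.1 = none}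
  next := F.simNext

theorem Det.toTM {F : HeadProgram α β (Fin k)} (hF : F.Det) : F.toTM.IsDeterministic := by
  rintro ⟨ph, t, j⟩ a w
  change (F.simNext _ _ _).Subsingleton
  cases ph
  · exact Set.subsingleton_singleton
  · cases t with
    | none => exact Set.subsingleton_empty
    | some n =>
      simp only [simNext]
      split_ifs
      · exact (hF n a).image _
      · exact Set.subsingleton_singleton
  all_goals simp only [simNext]
  all_goals first
    | exact Set.subsingleton_singleton
    | (cases w j <;> exact Set.subsingleton_singleton)
    | (cases a <;> exact Set.subsingleton_singleton)

variable (F : HeadProgram α β (Fin k)) (x : List α)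

/-- A configuration of the simulating machine. -/
def mkConfig (s : F.SimState) (p : ℕ) (o : List β) (T : Fin k → ℕ → CounterSymbol)
    (P : Fin k → ℕ) : F.toTM.Config where
  state := s
  inPos := p
  tape := T
  pos := P
  out := o

/-- The configuration with state `s` and input head position `p`, where the work tapes hold the
numbers `ρ i`, except that tape `j` is `T` with its head at `P`. -/
def simConfig (j : Fin k) (ρ : Fin k → ℕ) (s : F.SimState) (p : ℕ) (T : ℕ → CounterSymbol)
    (P : ℕ) (o : List β) : F.toTM.Config :=
  F.mkConfig s p o
    (Function.update (fun i => CounterSymbol.tape (CounterSymbol.digits (ρ i))) j T)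
    (Function.update (fun _ => 1) j P)

/-- The configuration that represents the node `t` with head positions `ρ`. -/
def restConfig (t : Option F.Node) (ρ : Fin k → ℕ) (o : List β) : F.toTM.Config :=
  F.mkConfig (.rest, t, F.active t) 0 o
    (fun i => CounterSymbol.tape (CounterSymbol.digits (ρ i))) (fun _ => 1)

theorem simConfig_eq_restConfig (j : Fin k) (ρ : Fin k → ℕ) (t : Option F.Node) (m : ℕ)
    (o : List β) :
    F.simConfig j ρ (.rest, t, F.active t) 0 (CounterSymbol.tape (CounterSymbol.digits m)) 1 o =
      F.restConfig t (Function.update ρ j m) o := by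
  refine congrArg₂ (F.mkConfig _ _ _) ?_ ?_
  · funext i
    by_cases h : i = j
    · subst h; simp
    · simp [h]
  · funext i
    by_cases h : i = j
    · subst h; simp
    · simp [h]

/-- The work heads are within the first `B` cells. -/
def Within (F : HeadProgram α β (Fin k)) (B : ℕ) (c : F.toTM.Config) : Prop :=
  ∀ i : Fin k, c.pos i < B

variable {F x}

theorem within_simConfig {j : Fin k} {ρ : Fin k → ℕ} {s : F.SimState} {p : ℕ}
    {T : ℕ → CounterSymbol} {P : ℕ} {o : List β} {B : ℕ} (hB : 1 < B) (hP : P < B) :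
    F.Within B (F.simConfig j ρ s p T P o) := by
  intro i
  by_cases h : i = j
  · subst h; simpa [simConfig, mkConfig] using hP
  · simpa [simConfig, mkConfig, h] using hB

/-- Only the symbol on tape `j` is exposed. What the other heads read is hidden in `w`, since
`simAct` writes it back unchanged and leaves these heads in place. -/
theorem actions_simConfig {j : Fin k} {ρ : Fin k → ℕ} {s : F.SimState} {p : ℕ}
    {T : ℕ → CounterSymbol} {P : ℕ} {o : List β} :
    ∃ w : Fin k → CounterSymbol, w j = T P ∧
      F.toTM.actions x (F.simConfig j ρ s p T P o) = F.simNext s (readInput x p) w ∧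
      ∀ (s' : F.SimState) (m : HeadMove) (g : CounterSymbol) (m' : HeadMove) (o' : Option β),
        F.toTM.perform x (F.simConfig j ρ s p T P o) (simAct w j s' m g m' o') =
          F.simConfig j ρ s' (min (m.move p) (x.length + 1)) (Function.update T P g) (m'.move P)
            (o ++ o'.toList) := by
  let base : Fin k → ℕ → CounterSymbol := fun i => CounterSymbol.tape (CounterSymbol.digits (ρ i))
  let w : Fin k → CounterSymbol := fun i =>
    Function.update base j T i (Function.update (fun _ => 1) j P i)
  refine ⟨w, by simp [w], rfl, fun s' m g m' o' => ?_⟩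
  have h₁ : (fun i => Function.update (Function.update base j T i)
      (Function.update (fun _ => 1) j P i) (Function.update w j g i)) =
      Function.update base j (Function.update T P g) := by
    funext i
    by_cases h : i = j
    · subst h; simp
    · simp [h, w]
  have h₂ : (fun i => (Function.update (fun _ => HeadMove.stay) j m' i).move
      (Function.update (fun _ => 1) j P i)) = Function.update (fun _ => 1) j (m'.move P) := by
    funext i
    by_cases h : i = j
    · subst h; simp
    · simp [h, HeadMove.move]
  exact congrArg₂ (F.mkConfig _ _ _) h₁ h₂

/-- One forced step that changes only the work tape `j`. -/
theorem forced_simConfig {j : Fin k} {ρ : Fin k → ℕ} {s : F.SimState} {p : ℕ}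
    {T : ℕ → CounterSymbol} {P : ℕ} {o : List β} {B : ℕ} (hB : 1 < B) (hP : P < B)
    (s' : F.SimState) (m : HeadMove) (g : CounterSymbol) (m' : HeadMove)
    (h : ∀ w : Fin k → CounterSymbol, w j = T P →
      F.simNext s (readInput x p) w = {simAct w j s' m g m' none}) {d : F.toTM.Config}
    (hd : Forced (F.toTM.Step x) (F.Within B) (F.simConfig j ρ s'
      (min (m.move p) (x.length + 1)) (Function.update T P g) (m'.move P) o) d) :
    Forced (F.toTM.Step x) (F.Within B) (F.simConfig j ρ s p T P o) d := by
  obtain ⟨w, hw, hact, hperf⟩ := actions_simConfig (F := F) (x := x) (j := j) (ρ := ρ) (s := s)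
    (p := p) (T := T) (P := P) (o := o)
  rw [h w hw] at hact
  refine .head (within_simConfig hB hP) (OfflineTM.step_iff_of_actions_eq hact) ?_
  rw [hperf]
  simpa using hd

open CounterSymbol

/-- Here `pre` is the part of the counter that the borrow has passed. Of the final head position `P`
only a bound is recorded, because `forced_back` can start anywhere. A zero counter has no
predecessor, hence `hne`. -/
theorem forced_dec {j : Fin k} {ρ : Fin k → ℕ} {t : Option F.Node} {p : ℕ} {o : List β} {B : ℕ}
    (hp : p ≤ x.length + 1) (l pre : List CounterSymbol) (hl : ∀ a ∈ l, a.IsDigit) (hne : l ≠ [])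
    (hB : pre.length + l.length + 1 < B) :
    ∃ P ≤ (pre ++ decr l).length, Forced (F.toTM.Step x) (F.Within B)
      (F.simConfig j ρ (.dec, t, j) p (tape (pre ++ l)) (pre.length + 1) o)
      (F.simConfig j ρ (.back, t, j) p (tape (pre ++ decr l)) P o) := by
  induction l generalizing pre with
  | nil => exact absurd rfl hne
  | cons a l ih =>
    have hmin : min (HeadMove.stay.move p) (x.length + 1) = p := min_eq_left hp
    have hhead : tape (pre ++ a :: l) (pre.length + 1) = a := by rw [tape_append]; rfl
    rw [List.length_cons] at hB
    rcases hl a (by simp) with rfl | rfl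
    · rcases l with _ | ⟨b, l⟩
      -- The borrow reaches the leading digit, which becomes `two` before the following blank shows
      -- that it must disappear; this takes two further steps.
      · refine ⟨pre.length, by simp [decr], ?_⟩
        have h2 : tape (pre ++ [two]) (pre.length + 2) = blank := by simp [tape]
        have h3 : Function.update (tape (pre ++ [two])) (pre.length + 2) blank =
            tape (pre ++ [two]) := by
          rw [Function.update_eq_self_iff]; exact h2.symm
        refine forced_simConfig (by omega) (by omega) (.dec, t, j) .stay .two .right
          (fun w hw => by simp [simNext, hw, hhead]) ?_
        rw [hmin, update_tape_append, HeadMove.move]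
        refine forced_simConfig (by omega) (by simp at hB; omega) (.erase, t, j) .stay
          .blank .left (fun w hw => by simp [simNext, hw, h2]) ?_
        rw [hmin, h3, HeadMove.move]
        refine forced_simConfig (by omega) (by omega) (.back, t, j) .stay
          .blank .left (fun w hw => by simp [simNext]) ?_
        rw [hmin, HeadMove.move, Nat.add_sub_cancel, update_tape_append, tape_append_blank]
        simp only [decr, List.append_nil]
        exact .refl _
      · obtain ⟨P, hP, hf⟩ := ih (pre ++ [two]) (fun c hc => hl c (by simp [hc])) (by simp)
          (by simp at hB ⊢; omega)
        refine ⟨P, by simpa [decr] using hP, ?_⟩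
        refine forced_simConfig (by omega) (by omega) (.dec, t, j) .stay .two .right
          (fun w hw => by simp [simNext, hw, hhead]) ?_
        rw [hmin, update_tape_append]
        simpa [decr, HeadMove.move] using hf
    · refine ⟨pre.length, by simp, ?_⟩
      refine forced_simConfig (by omega) (by omega) (.back, t, j) .stay .one .left
        (fun w hw => by simp [simNext, hw, hhead]) ?_
      rw [hmin, update_tape_append]
      exact .refl _

end HeadProgram

namespace HeadProgram

variable {α β : Type} {k : ℕ} {F : HeadProgram α β (Fin k)} {x : List α}

open CounterSymbol

/-- The sweep back to the mark ends with a step of the input head to the right: one decrement pays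
for one input cell. -/
theorem forced_back {j : Fin k} {ρ : Fin k → ℕ} {t : Option F.Node} {p : ℕ} {o : List β} {B : ℕ}
    (hp : p ≤ x.length + 1) {l : List CounterSymbol} (hl : ∀ a ∈ l, a.IsDigit) (hB : 1 < B)
    (P : ℕ) (hP : P < B) :
    Forced (F.toTM.Step x) (F.Within B) (F.simConfig j ρ (.back, t, j) p (tape l) P o)
      (F.simConfig j ρ (.rest, t, j) (min (p + 1) (x.length + 1)) (tape l) 1 o) := by
  induction P with
  | zero =>
    refine forced_simConfig hB hP (.rest, t, j) .right (tape l 0) .right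
      (fun w hw => by simp [simNext, hw, tape_zero]) ?_
    rw [Function.update_eq_self]
    exact .refl _
  | succ P ih =>
    refine forced_simConfig hB hP (.back, t, j) .stay (tape l (P + 1)) .left
      (fun w hw => by simp [simNext, hw, tape_ne_mark hl]) ?_
    rw [Function.update_eq_self, HeadMove.move, HeadMove.move, min_eq_left hp]
    exact ih (by omega)

theorem forced_backInc {j : Fin k} {ρ : Fin k → ℕ} {t : Option F.Node} {p : ℕ} {o : List β}
    {B : ℕ} (hp : p ≤ x.length + 1) {l : List CounterSymbol} (hl : ∀ a ∈ l, a.IsDigit)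
    (hB : 1 < B) (P : ℕ) (hP : P < B) :
    Forced (F.toTM.Step x) (F.Within B) (F.simConfig j ρ (.backInc, t, j) p (tape l) P o)
      (F.simConfig j ρ (.unload, t, j) p (tape l) 1 o) := by
  induction P with
  | zero =>
    refine forced_simConfig hB hP (.unload, t, j) .stay (tape l 0) .right
      (fun w hw => by simp [simNext, hw, tape_zero]) ?_
    rw [Function.update_eq_self, HeadMove.move, min_eq_left hp]
    exact .refl _
  | succ P ih =>
    refine forced_simConfig hB hP (.backInc, t, j) .stay (tape l (P + 1)) .left
      (fun w hw => by simp [simNext, hw, tape_ne_mark hl]) ?_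
    rw [Function.update_eq_self, HeadMove.move, HeadMove.move, min_eq_left hp]
    exact ih (by omega)

theorem forced_inc {j : Fin k} {ρ : Fin k → ℕ} {t : Option F.Node} {p : ℕ} {o : List β} {B : ℕ}
    (hp : p ≤ x.length + 1) (l pre : List CounterSymbol) (hl : ∀ a ∈ l, a.IsDigit)
    (hB : pre.length + l.length + 1 < B) :
    ∃ P ≤ pre.length + l.length, Forced (F.toTM.Step x) (F.Within B)
      (F.simConfig j ρ (.inc, t, j) p (tape (pre ++ l)) (pre.length + 1) o)
      (F.simConfig j ρ (.backInc, t, j) p (tape (pre ++ incr l)) P o) := by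
  have hmin : min (HeadMove.stay.move p) (x.length + 1) = p := min_eq_left hp
  induction l generalizing pre with
  | nil =>
    refine ⟨pre.length, by simp, ?_⟩
    refine forced_simConfig (by omega) (by omega) (.backInc, t, j) .stay .one .left
      (fun w hw => by simp [simNext, hw, tape]) ?_
    rw [hmin, List.append_nil, update_tape_end]
    exact .refl _
  | cons a l ih =>
    have hhead : tape (pre ++ a :: l) (pre.length + 1) = a := by rw [tape_append]; rfl
    rw [List.length_cons] at hB
    rcases hl a (by simp) with rfl | rfl
    · refine ⟨pre.length, by simp, ?_⟩
      refine forced_simConfig (by omega) (by omega) (.backInc, t, j) .stay .two .left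
        (fun w hw => by simp [simNext, hw, hhead]) ?_
      rw [hmin, update_tape_append]
      exact .refl _
    · obtain ⟨P, hP, hf⟩ := ih (pre ++ [one]) (fun c hc => hl c (by simp [hc]))
        (by simp at hB ⊢; omega)
      refine ⟨P, by simp at hP ⊢; omega, ?_⟩
      refine forced_simConfig (by omega) (by omega) (.inc, t, j) .stay .one .right
        (fun w hw => by simp [simNext, hw, hhead]) ?_
      rw [hmin, update_tape_append]
      simpa [incr, HeadMove.move] using hf

/-- The sum of the input position and the counter is invariant, so an empty counter leaves the input
head at the stored position. -/
theorem forced_load {j : Fin k} {ρ : Fin k → ℕ} {n : F.Node} {o : List β} {B : ℕ}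
    (hB : ∀ m ≤ x.length + 1, (digits m).length + 1 < B) (m p : ℕ) (hp : p + m ≤ x.length + 1) :
    Forced (F.toTM.Step x) (F.Within B)
      (F.simConfig j ρ (.rest, some n, j) p (tape (digits m)) 1 o)
      (F.simConfig j ρ (.rest, some n, j) (p + m) (tape []) 1 o) := by
  induction m generalizing p with
  | zero => exact .refl _
  | succ m ih =>
    have hm := hB (m + 1) (by omega)
    have hne : digits (m + 1) ≠ [] := incr_ne_nil _
    have hhead : tape (digits (m + 1)) 1 ≠ blank := by
      obtain ⟨a, l, hal⟩ := List.exists_cons_of_ne_nil hne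
      have := isDigit_digits (m + 1) a (by simp [hal])
      rw [hal]
      rcases this with rfl | rfl <;> simp [tape]
    refine forced_simConfig (by omega) (by omega) (.dec, some n, j) .stay (tape (digits (m + 1)) 1)
      .stay (fun w hw => by simp [simNext, hw, hhead]) ?_
    rw [Function.update_eq_self, HeadMove.move, min_eq_left (by omega)]
    obtain ⟨P, hP, hf⟩ := forced_dec (F := F) (x := x) (j := j) (ρ := ρ) (t := some n) (p := p)
      (o := o) (B := B) (by omega) (digits (m + 1)) [] (isDigit_digits _) hne (by simpa using hm)
    simp only [List.nil_append, List.length_nil, zero_add, decr_digits_succ] at hf hP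
    have := hB m (by omega)
    refine hf.trans ((forced_back (by omega) (isDigit_digits m) (by omega) P (by omega)).trans ?_)
    rw [min_eq_left (by omega)]
    have := ih (p + 1) (by omega)
    rwa [show p + 1 + m = p + (m + 1) by omega] at this

/-- The reverse of `forced_load`, with the same invariant sum; it ends when the input head reads the
left end marker. -/
theorem forced_unload {j : Fin k} {ρ : Fin k → ℕ} {t : Option F.Node} {o : List β} {B : ℕ}
    (hB : ∀ m ≤ x.length + 1, (digits m).length + 1 < B) (m p : ℕ) (hp : m + p ≤ x.length + 1) :
    Forced (F.toTM.Step x) (F.Within B)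
      (F.simConfig j ρ (.unload, t, j) p (tape (digits m)) 1 o)
      (F.restConfig t (Function.update ρ j (m + p)) o) := by
  have hB1 : 1 < B := by have := hB 0 (by omega); omega
  induction p generalizing m with
  | zero =>
    refine forced_simConfig hB1 hB1 (.rest, t, F.active t) .stay (tape (digits m) 1)
      .stay (fun w hw => by simp [simNext, hw, readInput]) ?_
    rw [Function.update_eq_self, HeadMove.move, Nat.zero_min, HeadMove.move,
      simConfig_eq_restConfig]
    exact .refl _
  | succ p ih =>
    have hm := hB m (by omega)
    refine forced_simConfig hB1 hB1 (.inc, t, j) .left (tape (digits m) 1) .stay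
      (fun w hw => ?_) ?_
    · rw [readInput]
      split <;> simp [simNext, hw]
    rw [Function.update_eq_self, HeadMove.move, HeadMove.move, Nat.add_sub_cancel,
      min_eq_left (by omega)]
    obtain ⟨P, hP, hf⟩ := forced_inc (F := F) (x := x) (j := j) (ρ := ρ) (t := t) (p := p)
      (o := o) (B := B) (by omega) (digits m) [] (isDigit_digits _) (by simpa using hm)
    simp only [List.nil_append, List.length_nil, zero_add] at hf hP
    refine hf.trans ((forced_backInc (l := digits (m + 1)) (by omega) (isDigit_digits (m + 1))
      (by omega) P (by omega)).trans ?_)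
    have := ih (m + 1) (by omega)
    rwa [show m + 1 + p = m + (p + 1) by omega] at this

/-- The configuration in which the step at the node `t` is executed. -/
def hubConfig (F : HeadProgram α β (Fin k)) (t : Option F.Node) (ρ : Fin k → ℕ) (o : List β) :
    F.toTM.Config :=
  match t with
  | none => F.restConfig none ρ o
  | some n => F.simConfig (F.head n) ρ (.rest, some n, F.head n) (ρ (F.head n)) (tape []) 1 o

theorem forced_hubConfig {t : Option F.Node} {ρ : Fin k → ℕ} {o : List β} {B : ℕ}
    (hB : ∀ m ≤ x.length + 1, (digits m).length + 1 < B) (hρ : ∀ i, ρ i ≤ x.length + 1) :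
    Forced (F.toTM.Step x) (F.Within B) (F.restConfig t ρ o) (F.hubConfig t ρ o) := by
  cases t with
  | none => exact .refl _
  | some n =>
    have h := forced_load (F := F) (x := x) (j := F.head n) (ρ := ρ) (n := n) (o := o) hB
      (ρ (F.head n)) 0 (by simpa using hρ _)
    have h' := simConfig_eq_restConfig F (F.head n) ρ (some n) (ρ (F.head n)) o
    rw [Function.update_eq_self] at h'
    rw [← h']
    rw [zero_add] at h
    exact h

/-- A step from `hubConfig` is a step of the simulated automaton. -/
theorem step_hubConfig {n : F.Node} {ρ : Fin k → ℕ} {o : List β} {y : F.toTM.Config}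
    (hρ : ρ (F.head n) ≤ x.length + 1) :
    F.toTM.Step x (F.hubConfig (some n) ρ o) y ↔
      ∃ t m o', (t, m, o') ∈ F.next n (readInput x (ρ (F.head n))) ∧
        y = F.simConfig (F.head n) ρ (.unload, t, F.head n)
          (m.moveWithin x.length (ρ (F.head n))) (tape (digits 0)) 1 (o ++ o'.toList) := by
  obtain ⟨w, hw, hact, hperf⟩ := actions_simConfig (F := F) (x := x) (j := F.head n) (ρ := ρ)
    (s := (.rest, some n, F.head n)) (p := ρ (F.head n)) (T := tape []) (P := 1) (o := o)
  have hw' : w (F.head n) = blank := by rw [hw]; rfl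
  rw [simNext, if_pos hw'] at hact
  have hup : Function.update (tape []) 1 blank = tape [] := by
    rw [Function.update_eq_self_iff]; rfl
  rw [OfflineTM.Step, hubConfig, hact]
  constructor
  · rintro ⟨a, ⟨⟨t, m, o'⟩, h, rfl⟩, rfl⟩
    refine ⟨t, m, o', h, ?_⟩
    rw [hperf, hw', hup, HeadMove.moveWithin_eq_min _ hρ]
    rfl
  · rintro ⟨t, m, o', h, rfl⟩
    refine ⟨_, ⟨(t, m, o'), h, rfl⟩, ?_⟩
    rw [hperf, hw', hup, HeadMove.moveWithin_eq_min _ hρ]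
    rfl

theorem moveHead_le {ρ : Fin k → ℕ} (hρ : ∀ i, ρ i ≤ x.length + 1) (j : Fin k) (m : HeadMove)
    (i : Fin k) : moveHead x ρ j m i ≤ x.length + 1 := by
  by_cases h : i = j
  · subst h; simpa [moveHead] using m.moveWithin_le (hρ _)
  · simpa [moveHead, h] using hρ i

theorem digits_within (x : List α) :
    ∀ m ≤ x.length + 1, (digits m).length + 1 < 5 * (Nat.log 2 x.length + 1) :=
  fun _ hm => length_digits_le hm

/-- The space bound of the simulating machine. -/
abbrev spaceBound (x : List α) : ℕ := 5 * (Nat.log 2 x.length + 1)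

theorem forced_start : Forced (F.toTM.Step x) (F.Within (spaceBound x)) F.toTM.startConfig
    (F.restConfig (some F.start) (fun _ => 0) []) := by
  refine .head (fun _ => ?_) (fun y => ?_) (.refl _)
  · change 0 < 5 * (Nat.log 2 x.length + 1); omega
  · refine (OfflineTM.step_iff_of_actions_eq rfl y).trans ?_
    refine Eq.congr_right (congrArg₂ (F.mkConfig _ _ _) ?_ ?_)
    · funext i p
      change Function.update (fun _ => blank) 0 mark p = tape [] p
      cases p <;> rfl
    · rfl

/-- Each step of the simulated run is a forced loading of the active counter, one step that may
branch, and a forced unloading. -/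
theorem reachable_restConfig {t : Option F.Node} {ρ ρ' : Fin k → ℕ} {o o' : List β}
    (hρ : ∀ i, ρ i ≤ x.length + 1) (h : F.toTM.Reachable x (F.restConfig t ρ o))
    (hr : F.Run x t ρ o' ρ') : F.toTM.Reachable x (F.restConfig none ρ' (o ++ o')) := by
  induction hr generalizing o with
  | exit ρ => simpa using h
  | @step n ρ t m o₁ o₂ ρ' hn hr ih =>
    rw [← List.append_assoc]
    refine ih (moveHead_le hρ _ _) ?_
    have h₁ := (forced_hubConfig (F := F) (t := some n) (o := o) (digits_within x) hρ).reflTransGen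
    have h₂ := (step_hubConfig (F := F) (o := o) (hρ (F.head n))).2 ⟨t, m, o₁, hn, rfl⟩
    have h₃ := (forced_unload (F := F) (x := x) (j := F.head n) (ρ := ρ) (t := t)
      (o := o ++ o₁.toList) (digits_within x) 0 (m.moveWithin x.length (ρ (F.head n)))
      (by simpa using m.moveWithin_le (hρ _))).reflTransGen
    rw [zero_add] at h₃
    exact ((h.trans h₁).tail h₂).trans h₃

theorem reachable_of_rel {ρ : Fin k → ℕ} {o : List β} (h : F.Rel x (fun _ => 0) o ρ) :
    F.toTM.Reachable x (F.restConfig none ρ o) := by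
  have := reachable_restConfig (F := F) (x := x) (o := []) (fun _ => by simp)
    forced_start.reflTransGen h
  simpa using this

/-- Every reachable configuration is on the way to the execution of a step of a run. -/
theorem forced_of_reachable {c : F.toTM.Config} (h : F.toTM.Reachable x c) :
    ∃ t ρ o, (∀ i, ρ i ≤ x.length + 1) ∧
      (∀ o' ρ', F.Run x t ρ o' ρ' → F.Rel x (fun _ => 0) (o ++ o') ρ') ∧
      Forced (F.toTM.Step x) (F.Within (spaceBound x)) c (F.hubConfig t ρ o) := by
  induction h with
  | refl => exact ⟨some F.start, fun _ => 0, [], by simp, fun o' ρ' h => h,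
      forced_start.trans (forced_hubConfig (digits_within x) (by simp))⟩
  | @tail c d _ hstep ih =>
    obtain ⟨t, ρ, o, hρ, hrun, hf⟩ := ih
    cases hf with
    -- Before the end of the forced path there is only one successor, so the step taken leads to the
    -- next point of the path.
    | head hP hb hf => exact ⟨t, ρ, o, hρ, hrun, (hb d).1 hstep ▸ hf⟩
    | refl =>
      cases t with
      | none => obtain ⟨a, ha, -⟩ := hstep; exact ha.elim
      -- Only here can the computation branch. The step executes an action of `F`, and a new forced
      -- path leads to the next such point.
      | some n =>
        obtain ⟨t, m, o', hn, rfl⟩ := (step_hubConfig (hρ _)).1 hstep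
        refine ⟨t, moveHead x ρ (F.head n) m, o ++ o'.toList, moveHead_le hρ _ _, ?_, ?_⟩
        · intro o₂ ρ' hr
          rw [List.append_assoc]
          exact hrun _ _ (.step hn hr)
        · have h₃ := forced_unload (F := F) (x := x) (j := F.head n) (ρ := ρ) (t := t)
            (o := o ++ o'.toList) (digits_within x) 0 (m.moveWithin x.length (ρ (F.head n)))
            (by simpa using m.moveWithin_le (hρ _))
          rw [zero_add] at h₃
          exact h₃.trans (forced_hubConfig (digits_within x) (moveHead_le hρ _ _))

theorem within_hubConfig {t : Option F.Node} {ρ : Fin k → ℕ} {o : List β} :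
    F.Within (spaceBound x) (F.hubConfig t ρ o) := by
  have : 1 < spaceBound x := by rw [spaceBound]; omega
  cases t with
  | none => intro i; exact this
  | some n => exact within_simConfig this this

/-- Every reachable configuration lies on a forced path, and such paths carry the bound on the head
positions at all points before the last. -/
theorem isLogSpace_toTM (F : HeadProgram α β (Fin k)) : F.toTM.IsLogSpace := by
  refine ⟨5, fun x c hc => ?_⟩
  obtain ⟨t, ρ, o, -, -, hf⟩ := forced_of_reachable hc
  cases hf with
  | head hP => exact hP
  | refl => exact within_hubConfig

theorem accepts_toTM : F.toTM.Accepts x ↔ ∃ o ρ, F.Rel x (fun _ => 0) o ρ := by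
  constructor
  · rintro ⟨c, hc, hacc⟩
    obtain ⟨t, ρ, o, -, hrun, hf⟩ := forced_of_reachable hc
    cases hf with
    -- An accepting configuration has no successor, so it cannot lie strictly before the end of a
    -- forced path.
    | @head _ b _ hP hb hf =>
      obtain ⟨a, ha, -⟩ := (hb b).2 rfl
      obtain ⟨⟨ph, t', j⟩, p, T, P, o'⟩ := c
      obtain ⟨h₁, h₂⟩ := hacc
      change ph = _ at h₁
      change t' = _ at h₂
      subst h₁ h₂
      exact ha.elim
    | refl =>
      cases t with
      | none => exact ⟨_, _, hrun _ _ (.exit _)⟩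
      | some n => exact absurd hacc.2 (by simp [hubConfig, simConfig, mkConfig])
  · rintro ⟨o, ρ, h⟩
    exact ⟨_, reachable_of_rel h, rfl, rfl⟩

theorem outputs_toTM {o : List β} {ρ : Fin k → ℕ} (h : F.Rel x (fun _ => 0) o ρ) :
    F.toTM.Outputs x o :=
  ⟨_, reachable_of_rel h, rfl, rfl⟩

end HeadProgram

/-- A language accepted by a multi-head automaton is in NL. -/
theorem HeadProgram.inNL {α ι : Type} [Finite α] [Finite ι] [DecidableEq ι]
    (F : HeadProgram α Empty ι) {L : Language α}
    (h : ∀ x, x ∈ L ↔ ∃ o ρ, F.Rel x (fun _ => 0) o ρ) : InNL L := by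
  obtain ⟨k, ⟨e⟩⟩ := Finite.exists_equiv_fin ι
  refine ⟨(F.mapHeads e).toTM, isLogSpace_toTM _, fun x => ?_⟩
  rw [h, accepts_toTM]
  constructor
  · rintro ⟨o, ρ, hr⟩
    refine ⟨o, ρ ∘ e.symm, (rel_mapHeads e).2 ?_⟩
    rwa [Function.comp_assoc, Equiv.symm_comp_self, Function.comp_id]
  · rintro ⟨o, ρ, hr⟩
    exact ⟨o, ρ ∘ e, (rel_mapHeads e).1 hr⟩

/-- A function computed by a deterministic multi-head automaton is computable in logarithmic
space. -/
theorem HeadProgram.isLogSpaceComputable {α β ι : Type} [Finite α] [Finite β] [Finite ι]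
    [DecidableEq ι] (F : HeadProgram α β ι) (hF : F.Det) {f : List α → List β}
    (h : ∀ x, ∃ ρ, F.Rel x (fun _ => 0) (f x) ρ) : IsLogSpaceComputable f := by
  obtain ⟨k, ⟨e⟩⟩ := Finite.exists_equiv_fin ι
  have hdet : (F.mapHeads e).Det := hF
  refine ⟨(F.mapHeads e).toTM, hdet.toTM, isLogSpace_toTM _, fun x => ?_⟩
  obtain ⟨ρ, hr⟩ := h x
  refine outputs_toTM (ρ := ρ ∘ e.symm) ((rel_mapHeads e).2 ?_)
  rwa [Function.comp_assoc, Equiv.symm_comp_self, Function.comp_id]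

/-! ### Nonemptiness of singleton automata as reachability -/

/-- Whether a condition requires membership. -/
def SAFACond.isMem {N : Type} : SAFACond N → Bool
  | .mem _ => true
  | .notMem _ => false

/-- Whether an operation is an insertion. -/
def SAFAOp.isIns {N : Type} : SAFAOp N → Bool
  | .skip => false
  | .ins _ => true

/-- The steps of a list of transitions of a singleton automaton on pairs of a state and a bit that
tells whether the set is nonempty. -/
def FlagStep {N : Type} (T : List (SAFATransition N)) (c c' : N × Bool) : Prop :=
  ∃ t ∈ T, c.1 = t.src ∧ (t.cond.isMem = true → c.2 = true) ∧ c'.1 = t.tgt ∧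
    c'.2 = (c.2 || t.op.isIns)

theorem SAFAOp.apply_nonempty {N : Type} {D : Type*} {h : N → Set D} {d : D} {i : N} {op : SAFAOp N}
    (hop : ∀ j ∈ op.target?, j = i) :
    (op.apply h d i).Nonempty ↔ (h i).Nonempty ∨ op.isIns = true := by
  cases op with
  | skip => simp [SAFAOp.apply, SAFAOp.isIns]
  | ins j =>
    obtain rfl : j = i := hop j rfl
    simp [SAFAOp.apply, SAFAOp.isIns]

theorem SAFAOp.apply_finite {N : Type} {D : Type*} {h : N → Set D} {d : D} {i : N} {op : SAFAOp N}
    (hop : ∀ j ∈ op.target?, j = i) (hf : (h i).Finite) : (op.apply h d i).Finite := by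
  cases op with
  | skip => simpa [SAFAOp.apply] using hf
  | ins j =>
    obtain rfl : j = i := hop j rfl
    simpa [SAFAOp.apply] using hf

/-- The flag only has to be true whenever the set is nonempty; a flag that is true too early merely
permits more steps. -/
theorem SAFA.Run.flag_reachable {N : Type} {D : Type*} {M : SAFA N} {T : List (SAFATransition N)}
    (hT : ∀ t, t ∈ T ↔ t ∈ M.trans) {i : N} (hM : ∀ j ∈ M.sets, j = i) {q q' : N}
    {h h' : N → Set D} {w : List (N × D)} (hr : M.Run q h w q' h') {b : Bool}
    (hb : (h i).Nonempty → b = true) :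
    ∃ b', Relation.ReflTransGen (FlagStep T) (q, b) (q', b') := by
  induction hr generalizing b with
  | nil q h => exact ⟨b, .refl⟩
  | cons t ht h d hc w q' h' hr ih =>
    obtain ⟨b', hb'⟩ := ih (b := b || t.op.isIns) (by
      rw [SAFAOp.apply_nonempty fun j hj => hM j (M.op_mem t ht j hj)]
      rintro (h | h)
      · simp [hb h]
      · simp [h])
    refine ⟨b', .head ⟨t, (hT t).2 ht, rfl, fun hmem => hb ?_, rfl, rfl⟩ hb'⟩
    have := hM _ (M.cond_mem t ht)
    cases hcond : t.cond with
    | mem j =>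
      rw [hcond] at hc this
      obtain rfl : j = i := this
      exact ⟨d, hc⟩
    | notMem j => simp [hcond, SAFACond.isMem] at hmem

/-- The opposite implication for the flag suffices here: a true flag provides a member for `p(h)`.
For `!p(h)` a fresh value exists because the set is finite and `D` is not, so finiteness is carried
through the induction. -/
theorem SAFA.exists_run {N : Type} {D : Type*} [Infinite D] {M : SAFA N}
    {T : List (SAFATransition N)} (hT : ∀ t, t ∈ T ↔ t ∈ M.trans) {i : N}
    (hM : ∀ j ∈ M.sets, j = i) {c c' : N × Bool}
    (hr : Relation.ReflTransGen (FlagStep T) c c') (h : N → Set D) (hf : (h i).Finite)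
    (hb : c.2 = true → (h i).Nonempty) : ∃ w h', M.Run c.1 h w c'.1 h' := by
  induction hr using Relation.ReflTransGen.head_induction_on generalizing h with
  | refl => exact ⟨[], h, .nil _ _⟩
  | @head c₁ c₂ hstep _ ih =>
    obtain ⟨t, ht, h₁, h₂, h₃, h₄⟩ := hstep
    have ht := (hT t).1 ht
    obtain ⟨d, hd⟩ : ∃ d, t.cond.Holds h d := by
      have := hM _ (M.cond_mem t ht)
      cases hcond : t.cond with
      | mem j =>
        rw [hcond] at this h₂
        obtain rfl : j = i := this
        exact hb (h₂ rfl)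
      | notMem j =>
        rw [hcond] at this
        obtain rfl : j = i := this
        exact hf.exists_notMem
    have hop := fun j hj => hM j (M.op_mem t ht j hj)
    obtain ⟨w, h', hr⟩ := ih (t.op.apply h d) (SAFAOp.apply_finite hop hf) (by
      rw [SAFAOp.apply_nonempty hop, h₄, Bool.or_eq_true]
      exact Or.imp_left hb)
    rw [h₃] at hr
    rw [h₁]
    exact ⟨_, h', .cons t ht h d hd w _ _ hr⟩

theorem SAFA.nonempty_iff {N : Type} {D : Type*} [Infinite D] {M : SAFA N}
    {T : List (SAFATransition N)} (hT : ∀ t, t ∈ T ↔ t ∈ M.trans) {i : N}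
    (hM : ∀ j ∈ M.sets, j = i) :
    (∃ v, v ∈ M.language D) ↔
      ∃ q ∈ M.final, ∃ b, Relation.ReflTransGen (FlagStep T) (M.start, false) (q, b) := by
  constructor
  · rintro ⟨v, q, hq, h, hr⟩
    exact ⟨q, hq, hr.flag_reachable hT hM (by simp)⟩
  · rintro ⟨q, hq, b, hr⟩
    obtain ⟨w, h', hr⟩ := M.exists_run (D := D) hT hM hr (fun _ => ∅) (by simp) (by simp)
    exact ⟨w, q, hq, h', hr⟩

/-! ### Unique readability -/

/-- A code whose words can be read off from the left. -/
def UniquelyReadable {A S : Type} (e : A → List S) : Prop :=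
  ∀ a b r r', e a ++ r = e b ++ r' → a = b ∧ r = r'

theorem uniquelyReadable_encodeName : UniquelyReadable encodeName := by
  intro n
  induction n with
  | nil =>
    rintro (_ | ⟨b, m⟩) r r' h
    · simpa [encodeName] using h
    · simp [encodeName] at h
  | cons a n ih =>
    rintro (_ | ⟨b, m⟩) r r' h
    · simp [encodeName] at h
    · simp only [encodeName, List.map_cons, List.cons_append, List.cons.injEq,
        SAFASymbol.bit.injEq] at h
      obtain ⟨rfl, h⟩ := h
      obtain ⟨rfl, rfl⟩ := ih m r r' h
      exact ⟨rfl, rfl⟩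

/-- Shows where a list of names ends: its terminator cannot begin a name. -/
theorem encodeName_ne_cons {s : SAFASymbol} (hs : ∀ b, s ≠ .bit b) (hs' : s ≠ .comma)
    (n : List Bool) (r r' : List SAFASymbol) : encodeName n ++ r ≠ s :: r' := by
  cases n with
  | nil => simpa [encodeName] using fun h => absurd h.symm hs'
  | cons b n => simpa [encodeName] using fun h => absurd h.symm (hs b)

theorem uniquelyReadable_encodeNames : UniquelyReadable encodeNames := by
  intro l
  induction l with
  | nil =>
    rintro (_ | ⟨b, m⟩) r r' h
    · simpa [encodeNames] using h
    · simp only [encodeNames, List.flatMap_nil, List.nil_append, List.flatMap_cons,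
        List.append_assoc, List.cons_append] at h
      exact absurd h.symm (encodeName_ne_cons (by simp) (by simp) _ _ _)
  | cons a l ih =>
    rintro (_ | ⟨b, m⟩) r r' h
    · simp only [encodeNames, List.flatMap_nil, List.nil_append, List.flatMap_cons,
        List.append_assoc, List.cons_append] at h
      exact absurd h (encodeName_ne_cons (by simp) (by simp) _ _ _)
    · simp only [encodeNames, List.flatMap_cons, List.append_assoc] at h
      obtain ⟨rfl, h⟩ := uniquelyReadable_encodeName _ _ _ _ h
      obtain ⟨rfl, rfl⟩ := ih m r r' (by simpa [encodeNames] using h)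
      exact ⟨rfl, rfl⟩

theorem uniquelyReadable_encodeCond : UniquelyReadable encodeCond := by
  rintro (a | a) (b | b) r r' h <;> simp only [encodeCond, List.cons_append, List.cons.injEq,
    reduceCtorEq, true_and, false_and] at h <;>
  · obtain ⟨rfl, rfl⟩ := uniquelyReadable_encodeName _ _ _ _ h
    exact ⟨rfl, rfl⟩

theorem uniquelyReadable_encodeOp : UniquelyReadable encodeOp := by
  rintro (_ | a) (_ | b) r r' h <;> simp only [encodeOp, List.cons_append, List.cons.injEq,
    reduceCtorEq, true_and, false_and, List.nil_append] at h
  · exact ⟨rfl, h⟩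
  · obtain ⟨rfl, rfl⟩ := uniquelyReadable_encodeName _ _ _ _ h
    exact ⟨rfl, rfl⟩

theorem uniquelyReadable_encodeTransition : UniquelyReadable encodeTransition := by
  rintro ⟨a₁, a₂, a₃, a₄, a₅⟩ ⟨b₁, b₂, b₃, b₄, b₅⟩ r r' h
  simp only [encodeTransition, List.append_assoc] at h
  obtain ⟨h₁, h⟩ := uniquelyReadable_encodeName _ _ _ _ h
  obtain ⟨h₂, h⟩ := uniquelyReadable_encodeName _ _ _ _ h
  obtain ⟨h₃, h⟩ := uniquelyReadable_encodeCond _ _ _ _ h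
  obtain ⟨h₄, h⟩ := uniquelyReadable_encodeOp _ _ _ _ h
  obtain ⟨h₅, h⟩ := uniquelyReadable_encodeName _ _ _ _ h
  exact ⟨by rw [h₁, h₂, h₃, h₄, h₅], h⟩

theorem encodeTransition_ne_nil (t : SAFATransition (List Bool)) : encodeTransition t ≠ [] := by
  simp [encodeTransition, encodeName]

/-- No terminator follows the transitions; a proper initial part of the list is ruled out because
the codes are nonempty. -/
theorem flatMap_encodeTransition_injective :
    Function.Injective fun T : List (SAFATransition (List Bool)) => T.flatMap encodeTransition := by
  intro T
  induction T with
  | nil =>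
    rintro (_ | ⟨t, T'⟩) h
    · rfl
    · simp [encodeTransition_ne_nil] at h
  | cons t T ih =>
    rintro (_ | ⟨t', T'⟩) h
    · simp [encodeTransition_ne_nil] at h
    · simp only [List.flatMap_cons] at h
      obtain ⟨h₁, h₂⟩ := uniquelyReadable_encodeTransition _ _ _ _ h
      rw [h₁, ih h₂]

/-- The lists that describe an automaton. -/
structure SAFAData : Type where
  states : List (List Bool)
  alphabet : List (List Bool)
  start : List Bool
  final : List (List Bool)
  sets : List (List Bool)
  trans : List (SAFATransition (List Bool))

namespace SAFAData

/-- The word that consists of the given lists. -/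
def word (S : SAFAData) : List SAFASymbol :=
  encodeNames S.states ++ encodeNames S.alphabet ++ encodeName S.start ++ encodeNames S.final ++
    encodeNames S.sets ++ S.trans.flatMap encodeTransition

/-- Makes it legitimate to speak of the lists described by an input, and to identify the results of
two independent readings. -/
theorem word_injective : Function.Injective word := by
  rintro ⟨a₁, a₂, a₃, a₄, a₅, a₆⟩ ⟨b₁, b₂, b₃, b₄, b₅, b₆⟩ h
  simp only [word, List.append_assoc] at h
  obtain ⟨h₁, h⟩ := uniquelyReadable_encodeNames _ _ _ _ h
  obtain ⟨h₂, h⟩ := uniquelyReadable_encodeNames _ _ _ _ h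
  obtain ⟨h₃, h⟩ := uniquelyReadable_encodeName _ _ _ _ h
  obtain ⟨h₄, h⟩ := uniquelyReadable_encodeNames _ _ _ _ h
  obtain ⟨h₅, h⟩ := uniquelyReadable_encodeNames _ _ _ _ h
  rw [h₁, h₂, h₃, h₄, h₅, flatMap_encodeTransition_injective h]

/-- The components of a transition are listed. -/
def TransValid (S : SAFAData) (t : SAFATransition (List Bool)) : Prop :=
  t.src ∈ S.states ∧ t.letter ∈ S.alphabet ∧ t.cond.target ∈ S.sets ∧
    (∀ h ∈ t.op.target?, h ∈ S.sets) ∧ t.tgt ∈ S.states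

/-- The lists describe a singleton automaton. -/
def Valid (S : SAFAData) : Prop :=
  S.start ∈ S.states ∧ (∀ q ∈ S.final, q ∈ S.states) ∧
    (∃ h, h ∈ S.sets ∧ ∀ h' ∈ S.sets, h' = h) ∧ ∀ t ∈ S.trans, S.TransValid t

/-- A final state can be reached. -/
def Productive (S : SAFAData) : Prop :=
  ∃ q ∈ S.final, ∃ b, Relation.ReflTransGen (FlagStep S.trans) (S.start, false) (q, b)

open Classical in
/-- The automaton described by the lists. -/
noncomputable def toSAFA (S : SAFAData) (hS : S.Valid) : SAFA (List Bool) where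
  states := S.states.toFinset
  alphabet := S.alphabet.toFinset
  start := S.start
  final := S.final.toFinset
  sets := S.sets.toFinset
  trans := S.trans.toFinset
  start_mem := by simpa using hS.1
  final_subset := fun q hq => by simpa using hS.2.1 q (by simpa using hq)
  src_mem := fun t ht => by simpa using (hS.2.2.2 t (by simpa using ht)).1
  letter_mem := fun t ht => by simpa using (hS.2.2.2 t (by simpa using ht)).2.1
  cond_mem := fun t ht => by simpa using (hS.2.2.2 t (by simpa using ht)).2.2.1
  op_mem := fun t ht h hh => by simpa using (hS.2.2.2 t (by simpa using ht)).2.2.2.1 h hh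
  tgt_mem := fun t ht => by simpa using (hS.2.2.2 t (by simpa using ht)).2.2.2.2

/-- Replaces automata and data words by lists and reachability; the analysis of the programs is
based on this form. -/
theorem mem_singletonSAFANonemptiness_iff (D : Type*) [Infinite D] (w : List SAFASymbol) :
    w ∈ SingletonSAFANonemptiness D ↔ ∃ S : SAFAData, w = S.word ∧ S.Valid ∧ S.Productive := by
  constructor
  · rintro ⟨M, ⟨Q, A, F, H, T, hQ, hA, hF, hH, hT, rfl⟩, hs, hv⟩
    obtain ⟨i, hi⟩ := Finset.card_eq_one.1 hs
    have hM : ∀ j ∈ M.sets, j = i := by simp [hi]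
    refine ⟨⟨Q, A, M.start, F, H, T⟩, rfl, ⟨(hQ _).2 M.start_mem,
      fun q hq => (hQ q).2 (M.final_subset ((hF q).1 hq)),
      ⟨i, (hH i).2 (by simp [hi]), fun h hh => hM h ((hH h).1 hh)⟩, fun t ht => ?_⟩, ?_⟩
    · have ht := (hT t).1 ht
      exact ⟨(hQ _).2 (M.src_mem t ht), (hA _).2 (M.letter_mem t ht), (hH _).2 (M.cond_mem t ht),
        fun h hh => (hH h).2 (M.op_mem t ht h hh), (hQ _).2 (M.tgt_mem t ht)⟩
    · obtain ⟨q, hq, b, hr⟩ := (SAFA.nonempty_iff hT hM).1 hv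
      exact ⟨q, (hF q).2 hq, b, hr⟩
  · rintro ⟨S, rfl, hS, q, hq, b, hr⟩
    obtain ⟨i, hi, hi'⟩ := hS.2.2.1
    refine ⟨S.toSAFA hS, ⟨S.states, S.alphabet, S.final, S.sets, S.trans, ?_, ?_, ?_, ?_, ?_, rfl⟩,
      ?_, ?_⟩
    iterate 5 · simp [toSAFA]
    · refine Finset.card_eq_one.2 ⟨i, ?_⟩
      ext j
      simp only [toSAFA, List.mem_toFinset, Finset.mem_singleton]
      exact ⟨hi' j, fun h => h ▸ hi⟩
    · refine (SAFA.nonempty_iff (M := S.toSAFA hS) (T := S.trans) (i := i) (by simp [toSAFA])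
        (by simpa [toSAFA] using hi')).2 ⟨q, by simpa [toSAFA] using hq, b, hr⟩

theorem word_mem_iff (D : Type*) [Infinite D] (S : SAFAData) :
    S.word ∈ SingletonSAFANonemptiness D ↔ S.Valid ∧ S.Productive := by
  rw [mem_singletonSAFANonemptiness_iff]
  constructor
  · rintro ⟨S', h, h'⟩
    rwa [word_injective h]
  · exact fun h => ⟨S, rfl, h⟩

/-- The lists for a directed graph with edges `E`: every edge is a transition that is always
possible and does not change the set. -/
def ofGraph (E : List (List Bool × List Bool)) (s f : List Bool) : SAFAData where
  states := s :: f :: E.flatMap fun e => [e.1, e.2]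
  alphabet := [[]]
  start := s
  final := [f]
  sets := [[]]
  trans := E.map fun e => ⟨e.1, [], .notMem [], .skip, e.2⟩

theorem valid_ofGraph (E : List (List Bool × List Bool)) (s f : List Bool) :
    (ofGraph E s f).Valid := by
  refine ⟨by simp [ofGraph], by simp [ofGraph], ⟨[], by simp [ofGraph], by simp [ofGraph]⟩, ?_⟩
  intro t ht
  obtain ⟨⟨a, b⟩, he, rfl⟩ := List.mem_map.1 ht
  refine ⟨?_, by simp [ofGraph], by simp [ofGraph, SAFACond.target],
    by simp [SAFAOp.target?], ?_⟩
  · simp only [ofGraph, List.mem_cons, List.mem_flatMap]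
    exact .inr (.inr ⟨_, he, by simp⟩)
  · simp only [ofGraph, List.mem_cons, List.mem_flatMap]
    exact .inr (.inr ⟨_, he, by simp⟩)

theorem productive_ofGraph_iff (E : List (List Bool × List Bool)) (s f : List Bool) :
    (ofGraph E s f).Productive ↔ Relation.ReflTransGen (fun a b => (a, b) ∈ E) s f := by
  -- All guards are `!p(h)` and nothing is inserted, so the flag neither restricts a step nor
  -- changes.
  have hstep : ∀ c c', FlagStep (ofGraph E s f).trans c c' ↔ (c.1, c'.1) ∈ E ∧ c'.2 = c.2 := by
    rintro ⟨a, b⟩ ⟨a', b'⟩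
    constructor
    · rintro ⟨t, ht, h₁, -, h₂, h₃⟩
      obtain ⟨⟨u, v⟩, he, rfl⟩ := List.mem_map.1 ht
      obtain rfl : a = u := h₁
      obtain rfl : a' = v := h₂
      exact ⟨he, by simpa [SAFAOp.isIns] using h₃⟩
    · rintro ⟨he, h⟩
      exact ⟨_, List.mem_map.2 ⟨_, he, rfl⟩, rfl, by simp [SAFACond.isMem], rfl,
        by simpa [SAFAOp.isIns] using h⟩
  constructor
  · rintro ⟨q, hq, b, hr⟩
    obtain rfl : q = f := by simpa [ofGraph] using hq
    exact hr.lift Prod.fst fun c c' h => ((hstep c c').1 h).1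
  · intro hr
    exact ⟨f, by simp [ofGraph], false,
      hr.lift (fun a => (a, false)) fun a b h => (hstep _ _).2 ⟨h, rfl⟩⟩

theorem word_ofGraph_mem_iff (D : Type*) [Infinite D] (E : List (List Bool × List Bool))
    (s f : List Bool) : (ofGraph E s f).word ∈ SingletonSAFANonemptiness D ↔
      Relation.ReflTransGen (fun a b => (a, b) ∈ E) s f := by
  rw [word_mem_iff, productive_ofGraph_iff, and_iff_right (valid_ofGraph E s f)]

end SAFAData

/-! ### Tests on the symbols of the input tape. -/

theorem readInput_eq_leftEnd_iff {α : Type} {x : List α} {p : ℕ} :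
    readInput x p = .leftEnd ↔ p = 0 := by
  cases p with
  | zero => simp [readInput]
  | succ p => rw [readInput]; split <;> simp

theorem readInput_eq_letter_iff {α : Type} {x : List α} {p : ℕ} {a : α} :
    readInput x (p + 1) = .letter a ↔ x[p]? = some a := by
  rw [readInput]; split <;> simp_all

theorem readInput_eq_rightEnd_iff {α : Type} {x : List α} {p : ℕ} :
    readInput x p = .rightEnd ↔ x.length < p := by
  cases p with
  | zero => simp [readInput]
  | succ p =>
    rw [readInput]
    split
    · rename_i h
      have := (List.getElem?_eq_some_iff.1 h).1
      simp; omega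
    · rename_i h
      have := List.getElem?_eq_none_iff.1 h
      simp; omega

/-- Continue unless the left end is read. -/
def unlessLeftEnd {α : Type} : InputSymbol α → Set Bool
  | .leftEnd => {false}
  | _ => {true}

theorem subsingleton_unlessLeftEnd {α : Type} (a : InputSymbol α) :
    (unlessLeftEnd a).Subsingleton := by
  cases a <;> exact Set.subsingleton_singleton

theorem true_mem_unlessLeftEnd {α : Type} {x : List α} {p : ℕ} :
    true ∈ unlessLeftEnd (readInput x p) ↔ p ≠ 0 := by
  rw [Ne, ← readInput_eq_leftEnd_iff (x := x)]
  cases readInput x p <;> simp [unlessLeftEnd]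

theorem false_mem_unlessLeftEnd {α : Type} {x : List α} {p : ℕ} :
    false ∈ unlessLeftEnd (readInput x p) ↔ p = 0 := by
  rw [← readInput_eq_leftEnd_iff (x := x)]
  cases readInput x p <;> simp [unlessLeftEnd]

namespace HeadProgram

variable {α β ι : Type} [DecidableEq ι] {x : List α}

/-! ### Some deterministic programs -/

/-- Move the head `j`. -/
def move (j : ι) (m : HeadMove) : HeadProgram α β ι := atom j fun _ => {(m, none)}

omit [DecidableEq ι] in
theorem det_move (j : ι) (m : HeadMove) : (move j m : HeadProgram α β ι).Det :=
  det_atom fun _ => Set.subsingleton_singleton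

theorem rel_move (j : ι) (m : HeadMove) (ρ : ι → ℕ) :
    (move j m : HeadProgram α β ι).Rel x ρ [] (moveHead x ρ j m) :=
  rel_atom.2 ⟨m, none, rfl, rfl, rfl⟩

theorem rel_move_left (j : ι) (ρ : ι → ℕ) :
    (move j .left : HeadProgram α β ι).Rel x ρ [] (Function.update ρ j (ρ j - 1)) :=
  rel_move j _ ρ

theorem rel_move_right (j : ι) {ρ : ι → ℕ} (h : ρ j ≤ x.length) :
    (move j .right : HeadProgram α β ι).Rel x ρ [] (Function.update ρ j (ρ j + 1)) := by
  have := rel_move (x := x) (β := β) j .right ρ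
  rwa [moveHead, HeadMove.moveWithin, if_pos h] at this

theorem Rel.seq {F G : HeadProgram α β ι} {ρ ρ' ρ'' : ι → ℕ} {o o' : List β}
    (h : F.Rel x ρ o ρ') (h' : G.Rel x ρ' o' ρ'') : (F.seq G).Rel x ρ (o ++ o') ρ'' :=
  rel_seq.2 ⟨o, ρ', o', h, h', rfl⟩

/-- The function `σ` is the trajectory: `σ t` gives the head positions after `t` rounds, and head
`j` first reaches the left end at time `m`. -/
theorem rel_loop_unlessLeftEnd {j : ι} {P : HeadProgram α β ι} (l : List β) (m : ℕ)
    (σ : ℕ → ι → ℕ) (hP : ∀ t < m, P.Rel x (σ t) l (σ (t + 1))) (h : ∀ t < m, σ t j ≠ 0)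
    (hm : σ m j = 0) :
    (loop j unlessLeftEnd P).Rel x (σ 0) (List.replicate m l).flatten (σ m) := by
  rw [rel_loop]
  induction m generalizing σ with
  | zero => exact .halt (false_mem_unlessLeftEnd.2 hm)
  | succ m ih =>
    rw [List.replicate_succ, List.flatten_cons]
    exact .more (true_mem_unlessLeftEnd.2 (h 0 (by omega))) (hP 0 (by omega))
      (ih (fun t => σ (t + 1)) (fun t ht => hP _ (by omega)) (fun t ht => h _ (by omega)) hm)

/-- Move the head `j` to the left end. -/
def rewind (j : ι) : HeadProgram α β ι := loop j unlessLeftEnd (move j .left)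

omit [DecidableEq ι] in
theorem det_rewind (j : ι) : (rewind j : HeadProgram α β ι).Det :=
  .loop subsingleton_unlessLeftEnd (det_move _ _)

theorem rel_rewind (j : ι) (ρ : ι → ℕ) :
    (rewind j : HeadProgram α β ι).Rel x ρ [] (Function.update ρ j 0) := by
  have := rel_loop_unlessLeftEnd (x := x) (j := j) (P := move j .left) ([] : List β) (ρ j)
    (fun t => Function.update ρ j (ρ j - t))
    (fun t ht => by
      have := rel_move_left (x := x) (β := β) j (Function.update ρ j (ρ j - t))
      simpa [Nat.sub_sub] using this)
    (fun t ht => by simp; omega) (by simp)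
  simpa [rewind] using this

/-- Move the head `j` to the first letter. -/
def toFirst (j : ι) : HeadProgram α β ι := (rewind j).seq (move j .right)

omit [DecidableEq ι] in
theorem det_toFirst (j : ι) : (toFirst j : HeadProgram α β ι).Det :=
  (det_rewind j).seq (det_move _ _)

theorem rel_toFirst (j : ι) (ρ : ι → ℕ) :
    (toFirst j : HeadProgram α β ι).Rel x ρ [] (Function.update ρ j 1) := by
  have := (rel_rewind (x := x) (β := β) j ρ).seq (rel_move_right j (by simp))
  simpa [toFirst] using this

/-- Run `P` as often as the position of the head `u` says; the head `w`, which has to be at the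
left end, is used to restore this position. -/
def rep (u w : ι) (P : HeadProgram α β ι) : HeadProgram α β ι :=
  (loop u unlessLeftEnd ((move u .left).seq ((move w .right).seq P))).seq
    (loop w unlessLeftEnd ((move w .left).seq (move u .right)))

omit [DecidableEq ι] in
theorem Det.rep {P : HeadProgram α β ι} (hP : P.Det) (u w : ι) : (rep u w P).Det :=
  .seq (.loop subsingleton_unlessLeftEnd ((det_move _ _).seq ((det_move _ _).seq hP)))
    (.loop subsingleton_unlessLeftEnd ((det_move _ _).seq (det_move _ _)))

/-- Counting down with `u` would destroy its position, so `w` counts up: the two positions always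
sum to `m` between rounds, and the second loop pours `w` back into `u`. The positions `τ t` record
the effect of `t` rounds on the other heads. In `hP`, `b` rounds are complete and both counting
heads have already moved for the next one. -/
theorem rel_rep {u w : ι} (huw : u ≠ w) {P : HeadProgram α β ι} (l : List β) (m : ℕ)
    (hm : m ≤ x.length + 1) (τ : ℕ → ι → ℕ)
    (hP : ∀ a b, a + b + 1 = m →
      P.Rel x (Function.update (Function.update (τ b) u a) w (b + 1)) l
        (Function.update (Function.update (τ (b + 1)) u a) w (b + 1))) :
    (rep u w P).Rel x (Function.update (Function.update (τ 0) u m) w 0)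
      (List.replicate m l).flatten (Function.update (Function.update (τ m) u m) w 0) := by
  have h₁ := rel_loop_unlessLeftEnd (x := x) (j := u)
    (P := (move u .left).seq ((move w .right).seq P)) l m
    (fun t => Function.update (Function.update (τ t) u (m - t)) w t) (fun t ht => by
      have e₁ : Function.update (Function.update (Function.update (τ t) u (m - t)) w t) u
          (m - t - 1) = Function.update (Function.update (τ t) u (m - t - 1)) w t := by
        rw [Function.update_comm huw, Function.update_idem, Function.update_comm huw]
      have r₁ := rel_move_left (x := x) (β := β) u
        (Function.update (Function.update (τ t) u (m - t)) w t)
      rw [Function.update_of_ne huw, Function.update_self, e₁] at r₁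
      have r₂ := rel_move_right (x := x) (β := β) (ρ :=
        Function.update (Function.update (τ t) u (m - t - 1)) w t) w (by simp; omega)
      rw [Function.update_self, Function.update_idem] at r₂
      have r₃ := hP (m - t - 1) t (by omega)
      rw [show m - (t + 1) = m - t - 1 by omega]
      exact r₁.seq (r₂.seq r₃))
    (fun t ht => by simp [huw]; omega) (by simp [huw])
  have h₂ := rel_loop_unlessLeftEnd (x := x) (j := w)
    (P := (move w .left).seq (move u .right)) ([] : List β) m
    (fun t => Function.update (Function.update (τ m) u t) w (m - t)) (fun t ht => by
      have r₁ := rel_move_left (x := x) (β := β) w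
        (Function.update (Function.update (τ m) u t) w (m - t))
      rw [Function.update_self, Function.update_idem] at r₁
      have r₂ := rel_move_right (x := x) (β := β) (ρ :=
        Function.update (Function.update (τ m) u t) w (m - t - 1)) u
        (by simp [huw]; omega)
      have e : Function.update (Function.update (Function.update (τ m) u t) w (m - t - 1)) u
          (t + 1) = Function.update (Function.update (τ m) u (t + 1)) w (m - t - 1) := by
        rw [Function.update_comm huw, Function.update_idem, Function.update_comm huw]
      rw [Function.update_of_ne huw, Function.update_self, e] at r₂
      rw [show m - (t + 1) = m - t - 1 by omega]
      exact r₁.seq r₂)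
    (fun t ht => by simp; omega) (by simp)
  simp only [Nat.sub_self, Nat.sub_zero] at h₁ h₂
  have := h₁.seq h₂
  simpa [rep] using this

/-- Move the head `p` to the position of the head `u`, with the help of the head `w`. -/
def copyHead (u p w : ι) : HeadProgram α β ι :=
  (rewind p).seq ((rewind w).seq (rep u w (move p .right)))

omit [DecidableEq ι] in
theorem det_copyHead (u p w : ι) : (copyHead u p w : HeadProgram α β ι).Det :=
  (det_rewind p).seq ((det_rewind w).seq ((det_move _ _).rep u w))

theorem rel_copyHead {u p w : ι} (hup : u ≠ p) (huw : u ≠ w) (hpw : p ≠ w) {ρ : ι → ℕ}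
    (hu : ρ u ≤ x.length + 1) : (copyHead u p w : HeadProgram α β ι).Rel x ρ []
      (Function.update (Function.update ρ p (ρ u)) w 0) := by
  have r₁ := rel_rewind (x := x) (β := β) p ρ
  have r₂ := rel_rewind (x := x) (β := β) w (Function.update ρ p 0)
  have r₃ := rel_rep (x := x) (P := (move p .right : HeadProgram α β ι)) huw [] (ρ u) hu
    (fun t => Function.update ρ p t) (fun a b hab => by
      have := rel_move_right (x := x) (β := β) (ρ :=
        Function.update (Function.update (Function.update ρ p b) u a) w (b + 1)) p
        (by simp [hpw, hup.symm]; omega)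
      convert this using 1
      funext k
      by_cases h₁ : k = w
      · subst h₁; simp [hpw.symm]
      · by_cases h₂ : k = u
        · subst h₂; simp [huw, hup]
        · by_cases h₃ : k = p
          · subst h₃; simp [hpw, hup.symm]
          · simp [h₁, h₂, h₃])
  have e : ∀ t, Function.update (Function.update ρ p t) u (ρ u) = Function.update ρ p t := by
    intro t; rw [Function.update_eq_self_iff]; simp [hup]
  simp only [e] at r₃
  have := r₁.seq (r₂.seq r₃)
  simpa [copyHead] using this

/-! ### The input-output relation without the output -/

/-- The head positions `ρ'` can be reached from `ρ`. -/
def Moves (F : HeadProgram α β ι) (x : List α) (ρ ρ' : ι → ℕ) : Prop := ∃ o, F.Rel x ρ o ρ'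

theorem Rel.moves {F : HeadProgram α β ι} {ρ ρ' : ι → ℕ} {o : List β} (h : F.Rel x ρ o ρ') :
    F.Moves x ρ ρ' := ⟨o, h⟩

theorem Det.moves_iff {F : HeadProgram α β ι} (hF : F.Det) {ρ ρ₁ ρ₂ : ι → ℕ} {o : List β}
    (h : F.Rel x ρ o ρ₁) : F.Moves x ρ ρ₂ ↔ ρ₂ = ρ₁ := by
  constructor
  · rintro ⟨o', h'⟩; exact ((hF.rel_iff h).1 h').2
  · rintro rfl; exact h.moves

theorem moves_toFirst {j : ι} {ρ ρ' : ι → ℕ} :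
    (toFirst j : HeadProgram α β ι).Moves x ρ ρ' ↔ ρ' = Function.update ρ j 1 :=
  (det_toFirst j).moves_iff (rel_toFirst j ρ)

theorem moves_copyHead {u p w : ι} (hup : u ≠ p) (huw : u ≠ w) (hpw : p ≠ w) {ρ ρ' : ι → ℕ}
    (hu : ρ u ≤ x.length + 1) : (copyHead u p w : HeadProgram α β ι).Moves x ρ ρ' ↔
      ρ' = Function.update (Function.update ρ p (ρ u)) w 0 :=
  (det_copyHead u p w).moves_iff (rel_copyHead hup huw hpw hu)

theorem moves_seq {F G : HeadProgram α β ι} {ρ ρ'' : ι → ℕ} :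
    (F.seq G).Moves x ρ ρ'' ↔ ∃ ρ', F.Moves x ρ ρ' ∧ G.Moves x ρ' ρ'' := by
  constructor
  · rintro ⟨o, h⟩
    obtain ⟨o₁, ρ', o₂, h₁, h₂, -⟩ := rel_seq.1 h
    exact ⟨ρ', h₁.moves, h₂.moves⟩
  · rintro ⟨ρ', ⟨o₁, h₁⟩, o₂, h₂⟩
    exact (h₁.seq h₂).moves

/-- Nondeterministic choice (the head `j` is not moved). -/
def choice {I : Type} [Finite I] (j : ι) (P : I → HeadProgram α β ι) : HeadProgram α β ι :=
  alt j (fun _ => Set.univ) P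

theorem moves_choice {I : Type} [Finite I] {j : ι} {P : I → HeadProgram α β ι} {ρ ρ' : ι → ℕ} :
    (choice j P).Moves x ρ ρ' ↔ ∃ i, (P i).Moves x ρ ρ' := by
  simp only [Moves, choice, rel_alt, Set.mem_univ, true_and]
  exact exists_comm

/-- Nondeterministic iteration (the head `j` is not moved). -/
def star (j : ι) (P : HeadProgram α β ι) : HeadProgram α β ι := loop j (fun _ => Set.univ) P

theorem moves_star {j : ι} {P : HeadProgram α β ι} {ρ ρ' : ι → ℕ} :
    (star j P).Moves x ρ ρ' ↔ Relation.ReflTransGen (P.Moves x) ρ ρ' := by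
  constructor
  · rintro ⟨o, h⟩
    rw [star, rel_loop] at h
    induction h with
    | halt h => exact .refl
    | more h h₁ h₂ ih => exact .head ⟨_, h₁⟩ ih
  · intro h
    simp only [Moves, star, rel_loop]
    induction h using Relation.ReflTransGen.head_induction_on with
    | refl => exact ⟨_, .halt trivial⟩
    | head h _ ih =>
      obtain ⟨o₁, h₁⟩ := h
      obtain ⟨o₂, h₂⟩ := ih
      exact ⟨_, .more (R := P.Rel x) trivial h₁ h₂⟩

/-- Continue only if the symbol under the head `j` is in `C`. -/
def test (j : ι) (C : Set (InputSymbol α)) : HeadProgram α β ι :=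
  atom j fun a => {t | a ∈ C ∧ t = (.stay, none)}

theorem moves_test {j : ι} {C : Set (InputSymbol α)} {ρ ρ' : ι → ℕ} :
    (test j C : HeadProgram α β ι).Moves x ρ ρ' ↔ readInput x (ρ j) ∈ C ∧ ρ' = ρ := by
  simp only [Moves, test, rel_atom]
  constructor
  · rintro ⟨o, m, o', ⟨h, h'⟩, -, rfl⟩
    obtain ⟨rfl, rfl⟩ := Prod.mk.inj h'
    exact ⟨h, moveHead_stay _ _ _⟩
  · rintro ⟨h, rfl⟩
    exact ⟨[], .stay, none, ⟨h, rfl⟩, rfl, (moveHead_stay _ _ _).symm⟩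

/-- Read the letter `c` with the head `j`. -/
def expect (j : ι) (c : α) : HeadProgram α β ι :=
  atom j fun a => {t | a = .letter c ∧ t = (.right, none)}

theorem moves_expect {j : ι} {c : α} {ρ ρ' : ι → ℕ} :
    (expect j c : HeadProgram α β ι).Moves x ρ ρ' ↔
      readInput x (ρ j) = .letter c ∧ ρ' = Function.update ρ j (ρ j + 1) := by
  -- A letter under the head excludes the right end, so the right move is not blocked.
  have key : readInput x (ρ j) = .letter c →
      moveHead x ρ j .right = Function.update ρ j (ρ j + 1) := by
    intro h
    have : ¬ x.length < ρ j := fun h' => by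
      rw [readInput_eq_rightEnd_iff.2 h'] at h; simp at h
    rw [moveHead, HeadMove.moveWithin, if_pos (by omega)]
  simp only [Moves, expect, rel_atom]
  constructor
  · rintro ⟨o, m, o', ⟨h, h'⟩, -, rfl⟩
    obtain ⟨rfl, rfl⟩ := Prod.mk.inj h'
    exact ⟨h, key h⟩
  · rintro ⟨h, rfl⟩
    exact ⟨[], .right, none, ⟨h, rfl⟩, rfl, (key h).symm⟩

end HeadProgram

/-! ### Occurrences of words on the input tape, and programs that read them. -/

/-- The word `v` is written from the input cell `p` on. -/
def OccursAt {α : Type} (x : List α) (p : ℕ) : List α → Prop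
  | [] => True
  | c :: v => readInput x p = .letter c ∧ OccursAt x (p + 1) v

theorem occursAt_append {α : Type} {x : List α} {p : ℕ} {u v : List α} :
    OccursAt x p (u ++ v) ↔ OccursAt x p u ∧ OccursAt x (p + u.length) v := by
  induction u generalizing p with
  | nil => simp [OccursAt]
  | cons c u ih =>
    simp only [List.cons_append, OccursAt, ih, List.length_cons, and_assoc]
    rw [show p + 1 + u.length = p + (u.length + 1) by omega]

/-- The offset 1 is the cell of the left end marker. -/
theorem occursAt_iff_prefix {α : Type} {u y v : List α} :
    OccursAt (u ++ y) (u.length + 1) v ↔ v <+: y := by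
  induction v generalizing u y with
  | nil => simp [OccursAt]
  | cons c v ih =>
    rw [OccursAt, readInput_eq_letter_iff]
    cases y with
    | nil => simp
    | cons d y =>
      have := ih (u := u ++ [d]) (y := y)
      simp only [List.append_assoc, List.singleton_append, List.length_append,
        List.length_singleton] at this
      simp [this, List.cons_prefix_cons, eq_comm]

/-- The empty word occurs at every position, even outside the tape; only a nonempty word locates
`p`. -/
theorem OccursAt.exists_eq_append {α : Type} {x : List α} {p : ℕ} {v : List α}
    (h : OccursAt x p v) (hv : v ≠ []) : ∃ u y, x = u ++ y ∧ p = u.length + 1 := by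
  cases v with
  | nil => exact absurd rfl hv
  | cons c v =>
    cases p with
    | zero => exact absurd h.1 (by simp [readInput])
    | succ p =>
      have := (List.getElem?_eq_some_iff.1 (readInput_eq_letter_iff.1 h.1)).1
      exact ⟨x.take p, x.drop p, (List.take_append_drop p x).symm, by simp; omega⟩

theorem OccursAt.position_le {α : Type} {x : List α} {p : ℕ} {v : List α}
    (h : OccursAt x p v) (hv : v ≠ []) : p ≤ x.length + 1 := by
  obtain ⟨u, y, rfl, rfl⟩ := h.exists_eq_append hv
  simp

/-- Both code words are prefixes of the same rest of the input. This identifies objects that were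
read by different heads or at different times. -/
theorem UniquelyReadable.occursAt_unique {A S : Type} {e : A → List S} (he : UniquelyReadable e)
    (hne : ∀ a, e a ≠ []) {x : List S} {p : ℕ} {a b : A} (ha : OccursAt x p (e a))
    (hb : OccursAt x p (e b)) : a = b := by
  obtain ⟨u, y, rfl, rfl⟩ := ha.exists_eq_append (hne a)
  obtain ⟨r, hr⟩ := occursAt_iff_prefix.1 ha
  obtain ⟨r', hr'⟩ := occursAt_iff_prefix.1 hb
  exact (he a b r r' (hr.trans hr'.symm)).1

/-- Concatenations of words from two sets. -/
def concat {S : Type} (K L : Set (List S)) : Set (List S) := Set.image2 (· ++ ·) K L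

/-- Concatenations of words from a set. -/
def concats {S : Type} (L : Set (List S)) : Set (List S) :=
  {v | ∃ l : List (List S), (∀ u ∈ l, u ∈ L) ∧ v = l.flatten}

/-- Turns the language of an iterated program into codes of lists of objects. -/
theorem concats_image {A S : Type} (e : A → List S) (P : Set A) :
    concats (e '' P) = (fun l : List A => l.flatMap e) '' {l | ∀ a ∈ l, a ∈ P} := by
  ext v
  constructor
  · rintro ⟨l, hl, rfl⟩
    induction l with
    | nil => exact ⟨[], by simp, rfl⟩
    | cons u l ih =>
      obtain ⟨a, ha, rfl⟩ := hl u (by simp)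
      obtain ⟨l', hl', h⟩ := ih fun u hu => hl u (by simp [hu])
      refine ⟨a :: l', by simpa using ⟨ha, hl'⟩, ?_⟩
      simpa using h
  · rintro ⟨l, hl, rfl⟩
    refine ⟨l.map e, ?_, by simp [List.flatMap]⟩
    simp only [List.mem_map]
    rintro u ⟨a, ha, rfl⟩
    exact ⟨a, hl a ha, rfl⟩

namespace HeadProgram

variable {α β ι : Type} [DecidableEq ι] {x : List α}

/-- On the input `x`, the program reads with the heads in `J` the words from `L` (all heads the
same word); the other heads outside `V` are not moved. -/
structure Consumes (x : List α) (F : HeadProgram α β ι) (J V : Set ι) (L : Set (List α)) :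
    Prop where
  sound : ∀ {ρ ρ' : ι → ℕ}, F.Moves x ρ ρ' → ∃ v ∈ L,
    (∀ j ∈ J, OccursAt x (ρ j) v ∧ ρ' j = ρ j + v.length) ∧ ∀ k ∉ J, k ∉ V → ρ' k = ρ k
  complete : ∀ {ρ : ι → ℕ} {v : List α}, v ∈ L → (∀ j ∈ J, OccursAt x (ρ j) v) →
    ∃ ρ', F.Moves x ρ ρ' ∧ (∀ j ∈ J, ρ' j = ρ j + v.length) ∧ ∀ k ∉ J, k ∉ V → ρ' k = ρ k

namespace Consumes

variable {F G : HeadProgram α β ι} {J V W : Set ι} {K L : Set (List α)}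

theorem mono (h : F.Consumes x J V L) (hVW : V ⊆ W) : F.Consumes x J W L where
  sound hm := by
    obtain ⟨v, hv, h₁, h₂⟩ := h.sound hm
    exact ⟨v, hv, h₁, fun k hk hkW => h₂ k hk fun hkV => hkW (hVW hkV)⟩
  complete hv ho := by
    obtain ⟨ρ', hm, h₁, h₂⟩ := h.complete hv ho
    exact ⟨ρ', hm, h₁, fun k hk hkW => h₂ k hk fun hkV => hkW (hVW hkV)⟩

theorem congr (h : F.Consumes x J V L) (hKL : L = K) : F.Consumes x J V K := hKL ▸ h

theorem seq (hF : F.Consumes x J V K) (hG : G.Consumes x J V L) :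
    (F.seq G).Consumes x J V (concat K L) where
  sound hm := by
    obtain ⟨ρ₁, hm₁, hm₂⟩ := moves_seq.1 hm
    obtain ⟨u, hu, h₁, h₂⟩ := hF.sound hm₁
    obtain ⟨v, hv, h₃, h₄⟩ := hG.sound hm₂
    refine ⟨u ++ v, ⟨u, hu, v, hv, rfl⟩, fun j hj => ?_, fun k hk hkV => ?_⟩
    · obtain ⟨h₅, h₆⟩ := h₁ j hj
      obtain ⟨h₇, h₈⟩ := h₃ j hj
      rw [h₆] at h₇ h₈
      exact ⟨occursAt_append.2 ⟨h₅, h₇⟩, by rw [h₈, List.length_append, add_assoc]⟩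
    · rw [h₄ k hk hkV, h₂ k hk hkV]
  complete := by
    rintro ρ _ ⟨u, hu, v, hv, rfl⟩ ho
    obtain ⟨ρ₁, hm₁, h₁, h₂⟩ := hF.complete hu fun j hj => (occursAt_append.1 (ho j hj)).1
    obtain ⟨ρ₂, hm₂, h₃, h₄⟩ := hG.complete (ρ := ρ₁) hv fun j hj => by
      rw [h₁ j hj]; exact (occursAt_append.1 (ho j hj)).2
    refine ⟨ρ₂, moves_seq.2 ⟨ρ₁, hm₁, hm₂⟩, fun j hj => ?_, fun k hk hkV => ?_⟩
    · rw [h₃ j hj, h₁ j hj, List.length_append, add_assoc]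
    · rw [h₄ k hk hkV, h₂ k hk hkV]

theorem choice {I : Type} [Finite I] {P : I → HeadProgram α β ι} {L : I → Set (List α)} (j : ι)
    (h : ∀ i, (P i).Consumes x J V (L i)) : (choice j P).Consumes x J V (⋃ i, L i) where
  sound hm := by
    obtain ⟨i, hm⟩ := moves_choice.1 hm
    obtain ⟨v, hv, h'⟩ := (h i).sound hm
    exact ⟨v, Set.mem_iUnion.2 ⟨i, hv⟩, h'⟩
  complete hv ho := by
    obtain ⟨i, hv⟩ := Set.mem_iUnion.1 hv
    obtain ⟨ρ', hm, h'⟩ := (h i).complete hv ho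
    exact ⟨ρ', moves_choice.2 ⟨i, hm⟩, h'⟩

theorem star (hF : F.Consumes x J V L) (j : ι) : (star j F).Consumes x J V (concats L) where
  sound hm := by
    have hm := moves_star.1 hm
    induction hm using Relation.ReflTransGen.head_induction_on with
    | refl => exact ⟨[], ⟨[], by simp, rfl⟩, by simp [OccursAt], fun _ _ _ => rfl⟩
    | @head ρ₁ ρ₂ hm₁ _ ih =>
      obtain ⟨u, hu, h₁, h₂⟩ := hF.sound hm₁
      obtain ⟨_, ⟨l, hl, rfl⟩, h₃, h₄⟩ := ih (by rwa [moves_star])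
      refine ⟨u ++ l.flatten, ⟨u :: l, by simpa using ⟨hu, hl⟩, by simp⟩, fun j hj => ?_,
        fun k hk hkV => ?_⟩
      · obtain ⟨h₅, h₆⟩ := h₁ j hj
        obtain ⟨h₇, h₈⟩ := h₃ j hj
        rw [h₆] at h₇ h₈
        exact ⟨occursAt_append.2 ⟨h₅, h₇⟩, by rw [h₈, List.length_append, add_assoc]⟩
      · rw [h₄ k hk hkV, h₂ k hk hkV]
  complete := by
    rintro ρ _ ⟨l, hl, rfl⟩ ho
    simp only [moves_star]
    induction l generalizing ρ with
    | nil => exact ⟨ρ, .refl, by simp, fun _ _ _ => rfl⟩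
    | cons u l ih =>
      simp only [List.flatten_cons] at ho
      obtain ⟨ρ₁, hm₁, h₁, h₂⟩ := hF.complete (hl u (by simp))
        fun j hj => (occursAt_append.1 (ho j hj)).1
      obtain ⟨ρ₂, hm₂, h₃, h₄⟩ := ih (ρ := ρ₁) (fun v hv => hl v (by simp [hv])) fun j hj => by
        rw [h₁ j hj]; exact (occursAt_append.1 (ho j hj)).2
      refine ⟨ρ₂, .head hm₁ hm₂, fun j hj => ?_, fun k hk hkV => ?_⟩
      · rw [h₃ j hj, h₁ j hj, List.flatten_cons, List.length_append, add_assoc]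
      · rw [h₄ k hk hkV, h₂ k hk hkV]

end Consumes

theorem consumes_expect (j : ι) (c : α) :
    (expect j c : HeadProgram α β ι).Consumes x {j} ∅ {[c]} where
  sound hm := by
    obtain ⟨h, rfl⟩ := moves_expect.1 hm
    refine ⟨[c], rfl, ?_, fun k hk _ => Function.update_of_ne hk _ _⟩
    rintro _ rfl
    exact ⟨⟨h, trivial⟩, by simp⟩
  complete := by
    rintro ρ _ rfl ho
    refine ⟨_, moves_expect.2 ⟨(ho j rfl).1, rfl⟩, ?_, fun k hk _ => Function.update_of_ne hk _ _⟩
    rintro _ rfl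
    simp

/-- Read the letter `c` with the heads `i` and `j`. -/
def expectBoth (i j : ι) (c : α) : HeadProgram α β ι := (expect i c).seq (expect j c)

theorem consumes_expectBoth {i j : ι} (hij : i ≠ j) (c : α) :
    (expectBoth i j c : HeadProgram α β ι).Consumes x {i, j} ∅ {[c]} where
  sound hm := by
    obtain ⟨ρ₁, hm₁, hm₂⟩ := moves_seq.1 hm
    obtain ⟨h₁, rfl⟩ := moves_expect.1 hm₁
    obtain ⟨h₂, rfl⟩ := moves_expect.1 hm₂
    rw [Function.update_of_ne hij.symm] at h₂
    refine ⟨[c], rfl, ?_, fun k hk _ => ?_⟩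
    · rintro _ (rfl | rfl)
      · exact ⟨⟨h₁, trivial⟩, by simp [hij]⟩
      · exact ⟨⟨h₂, trivial⟩, by simp [hij.symm]⟩
    · simp only [Set.mem_insert_iff, Set.mem_singleton_iff, not_or] at hk
      simp [hk]
  complete := by
    rintro ρ _ rfl ho
    refine ⟨_, moves_seq.2 ⟨_, moves_expect.2 ⟨(ho i (by simp)).1, rfl⟩, moves_expect.2 ⟨?_, rfl⟩⟩,
      ?_, fun k hk _ => ?_⟩
    · rw [Function.update_of_ne hij.symm]; exact (ho j (by simp)).1
    · rintro _ (rfl | rfl)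
      · simp [hij]
      · simp [hij.symm]
    · simp only [Set.mem_insert_iff, Set.mem_singleton_iff, not_or] at hk
      simp [hk]

/-! ### Programs that read the parts of an instance -/

section Reading

variable {x : List SAFASymbol}

/-- Read a name, given the program that reads a symbol. -/
def readName (j : ι) (P : SAFASymbol → HeadProgram SAFASymbol β ι) : HeadProgram SAFASymbol β ι :=
  (star j (choice j fun b => P (.bit b))).seq (P .comma)

theorem consumes_readName (j : ι) {J V : Set ι} {P : SAFASymbol → HeadProgram SAFASymbol β ι}
    (hP : ∀ c, (P c).Consumes x J V {[c]}) :
    (readName j P).Consumes x J V (Set.range encodeName) := by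
  refine (((Consumes.choice j fun b => hP (.bit b)).star j).seq (hP .comma)).congr ?_
  have : (⋃ b : Bool, {[SAFASymbol.bit b]}) = (fun b => [SAFASymbol.bit b]) '' Set.univ := by
    ext v; simp [eq_comm]
  rw [this, concats_image]
  ext v
  constructor
  · rintro ⟨_, ⟨l, -, rfl⟩, _, rfl, rfl⟩
    exact ⟨l, by simp [encodeName, List.map_eq_flatMap]⟩
  · rintro ⟨l, rfl⟩
    exact ⟨_, ⟨l, by simp, rfl⟩, _, rfl, by simp [encodeName, List.map_eq_flatMap]⟩

/-- Read a list of names, given the program that reads a name. -/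
def readNames (j : ι) (P : HeadProgram SAFASymbol β ι) : HeadProgram SAFASymbol β ι :=
  (star j P).seq (expect j .semicolon)

theorem consumes_readNames {j : ι} {V : Set ι} {P : HeadProgram SAFASymbol β ι}
    {A : Set (List Bool)} (hP : P.Consumes x {j} V (encodeName '' A)) :
    (readNames j P).Consumes x {j} V (encodeNames '' {l | ∀ a ∈ l, a ∈ A}) := by
  refine ((hP.star j).seq ((consumes_expect j .semicolon).mono (by simp))).congr ?_
  rw [concats_image]
  ext v
  constructor
  · rintro ⟨_, ⟨l, hl, rfl⟩, _, rfl, rfl⟩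
    exact ⟨l, hl, rfl⟩
  · rintro ⟨l, hl, rfl⟩
    exact ⟨_, ⟨l, hl, rfl⟩, _, rfl, rfl⟩

/-- Read a condition, given the program that reads the name of a set. -/
def readCond (j : ι) (P : HeadProgram SAFASymbol β ι) : HeadProgram SAFASymbol β ι :=
  choice j fun b : Bool => (expect j (if b then .isIn else .notIn)).seq P

theorem consumes_readCond {j : ι} {V : Set ι} {P : HeadProgram SAFASymbol β ι}
    {A : Set (List Bool)} (hP : P.Consumes x {j} V (encodeName '' A)) :
    (readCond j P).Consumes x {j} V (encodeCond '' {c | c.target ∈ A}) := by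
  refine (Consumes.choice j fun b =>
    (((consumes_expect j _).mono (Set.empty_subset V)).seq hP)).congr ?_
  ext v
  simp only [Set.mem_iUnion, Bool.exists_bool]
  constructor
  · rintro (⟨_, rfl, _, ⟨a, ha, rfl⟩, rfl⟩ | ⟨_, rfl, _, ⟨a, ha, rfl⟩, rfl⟩)
    · exact ⟨.notMem a, ha, rfl⟩
    · exact ⟨.mem a, ha, rfl⟩
  · rintro ⟨a | a, ha, rfl⟩
    · exact .inr ⟨_, rfl, _, ⟨a, ha, rfl⟩, rfl⟩
    · exact .inl ⟨_, rfl, _, ⟨a, ha, rfl⟩, rfl⟩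

/-- Read an operation, given the program that reads the name of a set. -/
def readOp (j : ι) (P : HeadProgram SAFASymbol β ι) : HeadProgram SAFASymbol β ι :=
  choice j fun b : Bool => if b then (expect j .ins).seq P else expect j .noIns

theorem consumes_readOp {j : ι} {V : Set ι} {P : HeadProgram SAFASymbol β ι}
    {A : Set (List Bool)} (hP : P.Consumes x {j} V (encodeName '' A)) :
    (readOp j P).Consumes x {j} V (encodeOp '' {c | ∀ a ∈ c.target?, a ∈ A}) := by
  refine (Consumes.choice (L := fun b : Bool => if b then
    concat {[.ins]} (encodeName '' A) else {[.noIns]}) j fun b => ?_).congr ?_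
  · cases b
    · exact (consumes_expect j _).mono (Set.empty_subset V)
    · exact ((consumes_expect j _).mono (Set.empty_subset V)).seq hP
  ext v
  simp only [Set.mem_iUnion, Bool.exists_bool]
  constructor
  · rintro (h | ⟨_, rfl, _, ⟨a, ha, rfl⟩, rfl⟩)
    · obtain rfl : v = [.noIns] := h
      exact ⟨.skip, by simp [SAFAOp.target?], rfl⟩
    · exact ⟨.ins a, by simpa [SAFAOp.target?] using ha, rfl⟩
  · rintro ⟨_ | a, ha, rfl⟩
    · exact .inl rfl
    · exact .inr ⟨_, rfl, _, ⟨a, ha a rfl, rfl⟩, rfl⟩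

/-- Read a transition, given the programs that read the names of states, letters and sets. -/
def readTransition (j : ι) (Q A H : HeadProgram SAFASymbol β ι) : HeadProgram SAFASymbol β ι :=
  Q.seq (A.seq ((readCond j H).seq ((readOp j H).seq Q)))

theorem consumes_readTransition {j : ι} {V : Set ι} {PQ PA PH : HeadProgram SAFASymbol β ι}
    {Q A H : Set (List Bool)} (hQ : PQ.Consumes x {j} V (encodeName '' Q))
    (hA : PA.Consumes x {j} V (encodeName '' A)) (hH : PH.Consumes x {j} V (encodeName '' H)) :
    (readTransition j PQ PA PH).Consumes x {j} V (encodeTransition '' {t | t.src ∈ Q ∧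
      t.letter ∈ A ∧ t.cond.target ∈ H ∧ (∀ h ∈ t.op.target?, h ∈ H) ∧ t.tgt ∈ Q}) := by
  refine (hQ.seq (hA.seq ((consumes_readCond hH).seq ((consumes_readOp hH).seq hQ)))).congr ?_
  ext v
  constructor
  · rintro ⟨_, ⟨a, ha, rfl⟩, _, ⟨_, ⟨b, hb, rfl⟩, _, ⟨_, ⟨c, hc, rfl⟩, _, ⟨_, ⟨d, hd, rfl⟩, _,
      ⟨e, he, rfl⟩, rfl⟩, rfl⟩, rfl⟩, rfl⟩
    exact ⟨⟨a, b, c, d, e⟩, ⟨ha, hb, hc, hd, he⟩, by simp [encodeTransition]⟩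
  · rintro ⟨⟨a, b, c, d, e⟩, ⟨ha, hb, hc, hd, he⟩, rfl⟩
    exact ⟨_, ⟨a, ha, rfl⟩, _, ⟨_, ⟨b, hb, rfl⟩, _, ⟨_, ⟨c, hc, rfl⟩, _, ⟨_, ⟨d, hd, rfl⟩, _,
      ⟨e, he, rfl⟩, rfl⟩, rfl⟩, rfl⟩, by simp [encodeTransition]⟩

/-- Read the description of an automaton, given the programs that read the names of the states,
the letters, the initial state, the final states and the sets, and the transitions. -/
def readWord (j : ι) (Q A s F H T : HeadProgram SAFASymbol β ι) : HeadProgram SAFASymbol β ι :=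
  (readNames j Q).seq ((readNames j A).seq (s.seq ((readNames j F).seq
    ((readNames j H).seq (star j T)))))

theorem consumes_readWord {j : ι} {V : Set ι} {PQ PA Ps PF PH PT : HeadProgram SAFASymbol β ι}
    {Q A s F H : Set (List Bool)} {T : Set (SAFATransition (List Bool))}
    (hQ : PQ.Consumes x {j} V (encodeName '' Q)) (hA : PA.Consumes x {j} V (encodeName '' A))
    (hs : Ps.Consumes x {j} V (encodeName '' s)) (hF : PF.Consumes x {j} V (encodeName '' F))
    (hH : PH.Consumes x {j} V (encodeName '' H))
    (hT : PT.Consumes x {j} V (encodeTransition '' T)) :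
    (readWord j PQ PA Ps PF PH PT).Consumes x {j} V (SAFAData.word '' {S | (∀ a ∈ S.states, a ∈ Q) ∧
      (∀ a ∈ S.alphabet, a ∈ A) ∧ S.start ∈ s ∧ (∀ a ∈ S.final, a ∈ F) ∧ (∀ a ∈ S.sets, a ∈ H) ∧
      ∀ t ∈ S.trans, t ∈ T}) := by
  refine ((consumes_readNames hQ).seq ((consumes_readNames hA).seq (hs.seq
    ((consumes_readNames hF).seq ((consumes_readNames hH).seq (hT.star j)))))).congr ?_
  rw [concats_image]
  ext v
  constructor
  · rintro ⟨_, ⟨a, ha, rfl⟩, _, ⟨_, ⟨b, hb, rfl⟩, _, ⟨_, ⟨c, hc, rfl⟩, _, ⟨_, ⟨d, hd, rfl⟩, _,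
      ⟨_, ⟨e, he, rfl⟩, _, ⟨f, hf, rfl⟩, rfl⟩, rfl⟩, rfl⟩, rfl⟩, rfl⟩
    exact ⟨⟨a, b, c, d, e, f⟩, ⟨ha, hb, hc, hd, he, hf⟩, by simp [SAFAData.word]⟩
  · rintro ⟨⟨a, b, c, d, e, f⟩, ⟨ha, hb, hc, hd, he, hf⟩, rfl⟩
    exact ⟨_, ⟨a, ha, rfl⟩, _, ⟨_, ⟨b, hb, rfl⟩, _, ⟨_, ⟨c, hc, rfl⟩, _, ⟨_, ⟨d, hd, rfl⟩, _,
      ⟨_, ⟨e, he, rfl⟩, _, ⟨f, hf, rfl⟩, rfl⟩, rfl⟩, rfl⟩, rfl⟩, by simp [SAFAData.word]⟩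

end Reading

end HeadProgram

theorem encodeName_ne_nil (n : List Bool) : encodeName n ≠ [] := by simp [encodeName]

theorem encodeCond_ne_nil (c : SAFACond (List Bool)) : encodeCond c ≠ [] := by
  cases c <;> simp [encodeCond]

theorem encodeOp_ne_nil (c : SAFAOp (List Bool)) : encodeOp c ≠ [] := by
  cases c <;> simp [encodeOp]

/-- In a sequence of code words followed by something else, only code words can be read. -/
theorem UniquelyReadable.exists_eq_append {A S : Type} {e : A → List S} (he : UniquelyReadable e)
    {r : List S} (hr : ∀ a s, e a ++ s ≠ r) {l l' : List A} {s : List S}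
    (h : l'.flatMap e ++ s = l.flatMap e ++ r) : ∃ l₂, l = l' ++ l₂ := by
  induction l' generalizing l with
  | nil => exact ⟨l, rfl⟩
  | cons a l' ih =>
    cases l with
    | nil =>
      rw [List.flatMap_cons, List.append_assoc] at h
      exact absurd h (hr _ _)
    | cons b l =>
      rw [List.flatMap_cons, List.flatMap_cons, List.append_assoc, List.append_assoc] at h
      obtain ⟨h₁, h₂⟩ := he _ _ _ _ h
      obtain ⟨l₂, hl⟩ := ih h₂
      exact ⟨l₂, by rw [h₁, hl]; rfl⟩

namespace HeadProgram

variable {α β ι : Type} [DecidableEq ι]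

/-- When no auxiliary head is allowed to move, the word that was read determines all final
positions. -/
theorem Consumes.moves_iff {x : List α} {F : HeadProgram α β ι} {i : ι} {L : Set (List α)}
    (h : F.Consumes x {i} ∅ L) {ρ ρ' : ι → ℕ} : F.Moves x ρ ρ' ↔
      ∃ v ∈ L, OccursAt x (ρ i) v ∧ ρ' = Function.update ρ i (ρ i + v.length) := by
  constructor
  · intro hm
    obtain ⟨v, hv, h₁, h₂⟩ := h.sound hm
    refine ⟨v, hv, (h₁ i rfl).1, ?_⟩
    funext k
    by_cases hk : k = i
    · subst hk; simpa using (h₁ k rfl).2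
    · simpa [hk] using h₂ k hk
  · rintro ⟨v, hv, ho, rfl⟩
    obtain ⟨ρ', hm, h₁, h₂⟩ := h.complete hv (ρ := ρ) (by rintro _ rfl; exact ho)
    convert hm
    funext k
    by_cases hk : k = i
    · subst hk; simpa using (h₁ k rfl).symm
    · simpa [hk] using (h₂ k hk (by simp)).symm

theorem Consumes.moves_pair_iff {x : List α} {F : HeadProgram α β ι} {i j : ι} (hij : i ≠ j)
    {L : Set (List α)} (h : F.Consumes x {i, j} ∅ L) {ρ ρ' : ι → ℕ} : F.Moves x ρ ρ' ↔
      ∃ v ∈ L, OccursAt x (ρ i) v ∧ OccursAt x (ρ j) v ∧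
        ρ' = Function.update (Function.update ρ i (ρ i + v.length)) j (ρ j + v.length) := by
  constructor
  · intro hm
    obtain ⟨v, hv, h₁, h₂⟩ := h.sound hm
    refine ⟨v, hv, (h₁ i (by simp)).1, (h₁ j (by simp)).1, ?_⟩
    funext k
    by_cases hk : k = j
    · subst hk; simpa using (h₁ k (by simp)).2
    · by_cases hk' : k = i
      · subst hk'; simpa [hk] using (h₁ k (by simp)).2
      · simpa [hk, hk'] using h₂ k (by simp [hk, hk'])
  · rintro ⟨v, hv, ho, ho', rfl⟩
    obtain ⟨ρ', hm, h₁, h₂⟩ := h.complete hv (ρ := ρ) (by rintro _ (rfl | rfl) <;> assumption)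
    convert hm
    funext k
    by_cases hk : k = j
    · subst hk; simpa using (h₁ k (by simp)).symm
    · by_cases hk' : k = i
      · subst hk'; simpa [hk] using (h₁ k (by simp)).symm
      · simpa [hk, hk'] using (h₂ k (by simp [hk, hk']) (by simp)).symm

/-- On the input `x`, the program moves the head `i` to the cell after the prefix `u`. -/
def Seeks (x : List α) (F : HeadProgram α β ι) (i : ι) (u : List α) : Prop :=
  ∀ ρ ρ', F.Moves x ρ ρ' ↔ ρ' = Function.update ρ i (u.length + 1)

theorem seeks_toFirst (x : List α) (i : ι) : (toFirst i : HeadProgram α β ι).Seeks x i [] :=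
  fun _ _ => moves_toFirst

/-- The reading of a code word is nondeterministic, but unique readability leaves only one place
where it can end. -/
theorem Seeks.seq {x : List α} {F G : HeadProgram α β ι} {i : ι} {u : List α}
    (hF : F.Seeks x i u) {A : Type} {e : A → List α} (he : UniquelyReadable e)
    (hG : G.Consumes x {i} ∅ (Set.range e)) (a : A) (hx : u ++ e a <+: x) :
    (F.seq G).Seeks x i (u ++ e a) := by
  obtain ⟨r, hx⟩ := hx
  rw [List.append_assoc] at hx
  intro ρ ρ'
  rw [moves_seq]
  simp only [hF ρ, exists_eq_left, hG.moves_iff, Function.update_self, Function.update_idem]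
  constructor
  · rintro ⟨_, ⟨b, rfl⟩, h, rfl⟩
    rw [← hx, occursAt_iff_prefix] at h
    obtain ⟨s, hs⟩ := h
    rw [(he _ _ _ _ hs).1, List.length_append]
    congr 1; omega
  · rintro rfl
    refine ⟨_, ⟨a, rfl⟩, ?_, ?_⟩
    · rw [← hx, occursAt_iff_prefix]
      exact List.prefix_append _ _
    · rw [List.length_append]
      congr 1; omega

/-- Seek, and then read some elements of a list. -/
theorem Seeks.moves_star {x : List α} {F G : HeadProgram α β ι} {i : ι} {u : List α}
    (hF : F.Seeks x i u) {A : Type} {e : A → List α} (he : UniquelyReadable e)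
    (hG : G.Consumes x {i} ∅ (Set.range e)) {l : List A} {r : List α}
    (hr : ∀ a s, e a ++ s ≠ r) (hx : x = u ++ (l.flatMap e ++ r)) {ρ ρ' : ι → ℕ} :
    (F.seq (star i G)).Moves x ρ ρ' ↔ ∃ l₁ l₂, l = l₁ ++ l₂ ∧
      ρ' = Function.update ρ i ((u ++ l₁.flatMap e).length + 1) := by
  have hG' := hG.star i
  rw [← Set.image_univ, concats_image] at hG'
  rw [moves_seq]
  simp only [hF ρ, exists_eq_left, hG'.moves_iff, Function.update_self, Function.update_idem]
  constructor
  · rintro ⟨_, ⟨l₁, -, rfl⟩, h, rfl⟩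
    rw [hx, occursAt_iff_prefix] at h
    obtain ⟨s, hs⟩ := h
    obtain ⟨l₂, hl⟩ := he.exists_eq_append hr hs
    refine ⟨l₁, l₂, hl, ?_⟩
    rw [List.length_append]
    congr 1; dsimp only; omega
  · rintro ⟨l₁, l₂, rfl, rfl⟩
    refine ⟨_, ⟨l₁, by simp, rfl⟩, ?_, ?_⟩
    · rw [hx, occursAt_iff_prefix]
      simp
    · rw [List.length_append]
      congr 1; dsimp only; omega

/-- Go to the beginning, run `F`, and check that the end of the input has been reached. -/
def readAll (j : ι) (F : HeadProgram α β ι) : HeadProgram α β ι :=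
  (toFirst j).seq (F.seq (test j {.rightEnd}))

theorem eq_of_occursAt {x v : List α} (h : OccursAt x 1 v)
    (h' : readInput x (1 + v.length) = .rightEnd) : x = v := by
  obtain ⟨r, rfl⟩ := (occursAt_iff_prefix (u := []) (y := x)).1 h
  rw [readInput_eq_rightEnd_iff] at h'
  have : r = [] := List.eq_nil_of_length_eq_zero (by simp at h'; omega)
  simp [this]

theorem readAll_sound {x : List α} {F : HeadProgram α β ι} {j : ι} {V : Set ι} {L : Set (List α)}
    (h : F.Consumes x {j} V L) {ρ ρ' : ι → ℕ} (hm : (readAll j F).Moves x ρ ρ') :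
    x ∈ L ∧ ∀ k ≠ j, k ∉ V → ρ' k = ρ k := by
  obtain ⟨ρ₁, h₁, hm⟩ := moves_seq.1 hm
  obtain ⟨ρ₂, h₂, hm⟩ := moves_seq.1 hm
  obtain ⟨h₃, rfl⟩ := moves_test.1 hm
  obtain rfl := moves_toFirst.1 h₁
  obtain ⟨v, hv, h₄, h₅⟩ := h.sound h₂
  obtain ⟨h₆, h₇⟩ := h₄ j rfl
  rw [Function.update_self] at h₆ h₇
  rw [h₇] at h₃
  refine ⟨eq_of_occursAt h₆ h₃ ▸ hv, fun k hk hkV => ?_⟩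
  rw [h₅ k hk hkV, Function.update_of_ne hk]

theorem readAll_complete {x : List α} {F : HeadProgram α β ι} {j : ι} {V : Set ι}
    {L : Set (List α)} (h : F.Consumes x {j} V L) (ρ : ι → ℕ) (hx : x ∈ L) :
    ∃ ρ', (readAll j F).Moves x ρ ρ' := by
  obtain ⟨ρ', h₁, h₂, h₃⟩ := h.complete hx (ρ := Function.update ρ j 1) (by
    rintro _ rfl
    rw [Function.update_self]
    exact (occursAt_iff_prefix (u := []) (y := x)).2 (List.prefix_rfl))
  refine ⟨ρ', moves_seq.2 ⟨_, moves_toFirst.2 rfl, moves_seq.2 ⟨ρ', h₁, moves_test.2 ⟨?_, rfl⟩⟩⟩⟩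
  refine readInput_eq_rightEnd_iff.2 ?_
  rw [h₂ j rfl, Function.update_self]
  omega

/-! ### The programs for the nonemptiness problem -/

section Nonemptiness

variable (β) in
/-- Read a name with the head `i`. -/
def name (i : ι) : HeadProgram SAFASymbol β ι := readName i (expect i)

theorem consumes_name (x : List SAFASymbol) (i : ι) :
    (name β i).Consumes x {i} ∅ (Set.range encodeName) :=
  consumes_readName i fun _ => consumes_expect _ _

/-- Read the same name with the heads `i` and `j`. -/
def sameName (i j : ι) : HeadProgram SAFASymbol β ι := readName i (expectBoth i j)

theorem consumes_sameName (x : List SAFASymbol) {i j : ι} (hij : i ≠ j) :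
    (sameName i j : HeadProgram SAFASymbol β ι).Consumes x {i, j} ∅ (Set.range encodeName) :=
  consumes_readName i fun _ => consumes_expectBoth hij _

theorem consumes_names (x : List SAFASymbol) (i : ι) :
    (readNames i (name β i)).Consumes x {i} ∅ (Set.range encodeNames) := by
  have := consumes_name (β := β) x i
  rw [← Set.image_univ] at this
  refine (consumes_readNames this).congr ?_
  rw [← Set.image_univ]
  congr 1
  ext; simp

variable (β) in
/-- Read a transition with the head `i`. -/
def transition (i : ι) : HeadProgram SAFASymbol β ι :=
  readTransition i (name β i) (name β i) (name β i)

theorem consumes_transition (x : List SAFASymbol) (i : ι) :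
    (transition β i).Consumes x {i} ∅ (Set.range encodeTransition) := by
  have := consumes_name (β := β) x i
  rw [← Set.image_univ] at this
  refine (consumes_readTransition this this this).congr ?_
  rw [← Set.image_univ]
  congr 1
  ext; simp

/-- Read with the head `j` a name that occurs in the list after the position sought by `F`. -/
def member (i j : ι) (F : HeadProgram SAFASymbol β ι) : HeadProgram SAFASymbol β ι :=
  (F.seq (star i (name β i))).seq (sameName i j)

/-- Head `i` guesses an entry of the list and is then compared with `j` symbol by symbol. The
semicolon keeps the guess inside the list, and the code word that `i` reads next must be an entry.
-/
theorem consumes_member {x : List SAFASymbol} {i j : ι} (hij : i ≠ j)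
    {F : HeadProgram SAFASymbol β ι} {u r : List SAFASymbol} (hF : F.Seeks x i u)
    {l : List (List Bool)} (hx : x = u ++ (encodeNames l ++ r)) :
    (member i j F).Consumes x {j} {i} (encodeName '' {n | n ∈ l}) := by
  have hr : ∀ a s, encodeName a ++ s ≠ SAFASymbol.semicolon :: r := fun a s =>
    encodeName_ne_cons (by simp) (by simp) _ _ _
  have hx' : x = u ++ (l.flatMap encodeName ++ .semicolon :: r) := by simp [hx, encodeNames]
  have hstar : ∀ ρ ρ', _ := fun ρ ρ' => hF.moves_star (ρ := ρ) (ρ' := ρ')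
    uniquelyReadable_encodeName (consumes_name x i) hr hx'
  have hsame := fun ρ ρ' => (consumes_sameName (β := β) x hij).moves_pair_iff hij
    (ρ := ρ) (ρ' := ρ')
  constructor
  · intro ρ ρ' hm
    obtain ⟨ρ₁, h₁, h₂⟩ := moves_seq.1 hm
    obtain ⟨l₁, l₂, rfl, rfl⟩ := (hstar _ _).1 h₁
    obtain ⟨_, ⟨n, rfl⟩, h₃, h₄, rfl⟩ := (hsame _ _).1 h₂
    rw [Function.update_of_ne hij.symm] at h₄
    rw [Function.update_self, hx', List.flatMap_append, List.append_assoc, ← List.append_assoc u,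
      occursAt_iff_prefix] at h₃
    obtain ⟨s, hs⟩ := h₃
    obtain ⟨l₃, rfl⟩ := uniquelyReadable_encodeName.exists_eq_append hr (l' := [n]) (s := s)
      (by simpa using hs)
    refine ⟨_, ⟨n, by simp, rfl⟩, ?_, ?_⟩
    · rintro _ rfl
      exact ⟨h₄, by simp [hij.symm]⟩
    · intro k hk hk'
      rw [Set.mem_singleton_iff] at hk hk'
      simp [hk, hk']
  · rintro ρ _ ⟨n, hn, rfl⟩ ho
    obtain ⟨l₁, l₂, rfl⟩ := List.append_of_mem hn
    refine ⟨_, moves_seq.2 ⟨_, (hstar _ _).2 ⟨l₁, n :: l₂, rfl, rfl⟩, (hsame _ _).2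
      ⟨_, ⟨n, rfl⟩, ?_, ?_, rfl⟩⟩, ?_, ?_⟩
    · rw [Function.update_self, hx', List.flatMap_append, List.append_assoc,
        ← List.append_assoc u, occursAt_iff_prefix]
      simp
    · rw [Function.update_of_ne hij.symm]; exact ho j rfl
    · rintro _ rfl
      simp [hij.symm]
    · intro k hk hk'
      rw [Set.mem_singleton_iff] at hk hk'
      simp [hk, hk']

/-- Read with the head `j` the name at the position sought by `F`. -/
def first (i j : ι) (F : HeadProgram SAFASymbol β ι) : HeadProgram SAFASymbol β ι :=
  F.seq (sameName i j)

/-- Serves to check that all listed sets coincide with the first one, that is, that there is at most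
one set. -/
theorem consumes_first {x : List SAFASymbol} {i j : ι} (hij : i ≠ j)
    {F : HeadProgram SAFASymbol β ι} {u r : List SAFASymbol} (hF : F.Seeks x i u)
    {l : List (List Bool)} (hx : x = u ++ (encodeNames l ++ r)) :
    (first i j F).Consumes x {j} {i} (encodeName '' {n | l.head? = some n}) := by
  have hr : ∀ a s, encodeName a ++ s ≠ SAFASymbol.semicolon :: r := fun a s =>
    encodeName_ne_cons (by simp) (by simp) _ _ _
  have hx' : x = u ++ (l.flatMap encodeName ++ .semicolon :: r) := by simp [hx, encodeNames]
  have hsame := fun ρ ρ' => (consumes_sameName (β := β) x hij).moves_pair_iff hij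
    (ρ := ρ) (ρ' := ρ')
  constructor
  · intro ρ ρ' hm
    obtain ⟨ρ₁, h₁, h₂⟩ := moves_seq.1 hm
    obtain rfl := (hF _ _).1 h₁
    obtain ⟨_, ⟨n, rfl⟩, h₃, h₄, rfl⟩ := (hsame _ _).1 h₂
    rw [Function.update_of_ne hij.symm] at h₄
    rw [Function.update_self, hx', occursAt_iff_prefix] at h₃
    obtain ⟨s, hs⟩ := h₃
    obtain ⟨l₃, rfl⟩ := uniquelyReadable_encodeName.exists_eq_append hr (l' := [n]) (s := s)
      (by simpa using hs)
    refine ⟨_, ⟨n, by simp, rfl⟩, ?_, ?_⟩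
    · rintro _ rfl
      exact ⟨h₄, by simp [hij.symm]⟩
    · intro k hk hk'
      rw [Set.mem_singleton_iff] at hk hk'
      simp [hk, hk']
  · rintro ρ _ ⟨n, hn, rfl⟩ ho
    obtain ⟨l₂, rfl⟩ := List.head?_eq_some_iff.1 hn
    refine ⟨_, moves_seq.2 ⟨_, (hF _ _).2 rfl, (hsame _ _).2 ⟨_, ⟨n, rfl⟩, ?_, ?_, rfl⟩⟩, ?_, ?_⟩
    · rw [Function.update_self, hx', occursAt_iff_prefix]
      simp
    · rw [Function.update_of_ne hij.symm]; exact ho j rfl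
    · rintro _ rfl
      simp [hij.symm]
    · intro k hk hk'
      rw [Set.mem_singleton_iff] at hk hk'
      simp [hk, hk']

variable (β) in
/-- Move the head `i` to the list of the letters. -/
def seekAlphabet (i : ι) : HeadProgram SAFASymbol β ι := (toFirst i).seq (readNames i (name β i))

variable (β) in
/-- Move the head `i` to the initial state. -/
def seekStart (i : ι) : HeadProgram SAFASymbol β ι :=
  (seekAlphabet β i).seq (readNames i (name β i))

variable (β) in
/-- Move the head `i` to the list of the final states. -/
def seekFinal (i : ι) : HeadProgram SAFASymbol β ι := (seekStart β i).seq (name β i)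

variable (β) in
/-- Move the head `i` to the list of the sets. -/
def seekSets (i : ι) : HeadProgram SAFASymbol β ι := (seekFinal β i).seq (readNames i (name β i))

variable (β) in
/-- Move the head `i` to the list of the transitions. -/
def seekTrans (i : ι) : HeadProgram SAFASymbol β ι := (seekSets β i).seq (readNames i (name β i))

variable (S : SAFAData) (i : ι)

theorem seeks_seekAlphabet : (seekAlphabet β i).Seeks S.word i (encodeNames S.states) :=
  (seeks_toFirst S.word i).seq uniquelyReadable_encodeNames (consumes_names _ i) S.states
    (by simp [SAFAData.word])

theorem seeks_seekStart : (seekStart β i).Seeks S.word i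
    (encodeNames S.states ++ encodeNames S.alphabet) :=
  (seeks_seekAlphabet S i).seq uniquelyReadable_encodeNames (consumes_names _ i) S.alphabet
    (by simp [SAFAData.word])

theorem seeks_seekFinal : (seekFinal β i).Seeks S.word i
    (encodeNames S.states ++ encodeNames S.alphabet ++ encodeName S.start) :=
  (seeks_seekStart S i).seq uniquelyReadable_encodeName (consumes_name _ i) S.start
    (by simp [SAFAData.word])

theorem seeks_seekSets : (seekSets β i).Seeks S.word i
    (encodeNames S.states ++ encodeNames S.alphabet ++ encodeName S.start ++
      encodeNames S.final) :=
  (seeks_seekFinal S i).seq uniquelyReadable_encodeNames (consumes_names _ i) S.final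
    (by simp [SAFAData.word])

theorem seeks_seekTrans : (seekTrans β i).Seeks S.word i
    (encodeNames S.states ++ encodeNames S.alphabet ++ encodeName S.start ++
      encodeNames S.final ++ encodeNames S.sets) :=
  (seeks_seekSets S i).seq uniquelyReadable_encodeNames (consumes_names _ i) S.sets
    (by simp [SAFAData.word])

variable (β) in
/-- Check that the input describes lists. -/
def checkWord (j : ι) : HeadProgram SAFASymbol β ι :=
  readAll j (readWord j (name β j) (name β j) (name β j) (name β j) (name β j) (transition β j))

theorem consumes_checkWord (x : List SAFASymbol) (j : ι) :
    (readWord j (name β j) (name β j) (name β j) (name β j) (name β j)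
      (transition β j)).Consumes x {j} ∅ (Set.range SAFAData.word) := by
  have h := consumes_name (β := β) x j
  have h' := consumes_transition (β := β) x j
  rw [← Set.image_univ] at h h'
  refine (consumes_readWord h h h h h h').congr ?_
  rw [← Set.image_univ]
  congr 1
  ext; simp

variable (β) in
/-- Check that the lists describe a singleton automaton. -/
def checkValid (i j : ι) : HeadProgram SAFASymbol β ι :=
  (readAll j (readWord j (name β j) (name β j) (member i j (toFirst i)) (member i j (toFirst i))
    (first i j (seekSets β i)) (readTransition j (member i j (toFirst i))
      (member i j (seekAlphabet β i)) (member i j (seekSets β i))))).seq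
    ((seekSets β i).seq (name β i))

variable {i}

/-- Head `j` reads the word as lists `S'`, while head `i` looks names up in the lists `S` of the
same word. The two are identified afterwards by `SAFAData.word_injective`. -/
theorem consumes_checkValid {j : ι} (hij : i ≠ j) :
    (readWord j (name β j) (name β j) (member i j (toFirst i)) (member i j (toFirst i))
    (first i j (seekSets β i)) (readTransition j (member i j (toFirst i))
      (member i j (seekAlphabet β i)) (member i j (seekSets β i)))).Consumes S.word {j} {i}
      (SAFAData.word '' {S' | S'.start ∈ S.states ∧ (∀ q ∈ S'.final, q ∈ S.states) ∧
        (∀ h ∈ S'.sets, S.sets.head? = some h) ∧ ∀ t ∈ S'.trans, S.TransValid t}) := by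
  have h := (consumes_name (β := β) S.word j).mono (Set.empty_subset {i})
  rw [← Set.image_univ] at h
  have hQ := consumes_member hij (seeks_toFirst (β := β) S.word i) (l := S.states)
    (r := encodeNames S.alphabet ++ encodeName S.start ++ encodeNames S.final ++
      encodeNames S.sets ++ S.trans.flatMap encodeTransition) (by simp [SAFAData.word])
  have hA := consumes_member hij (seeks_seekAlphabet (β := β) S i) (l := S.alphabet)
    (r := encodeName S.start ++ encodeNames S.final ++
      encodeNames S.sets ++ S.trans.flatMap encodeTransition) (by simp [SAFAData.word])
  have hH := consumes_member hij (seeks_seekSets (β := β) S i) (l := S.sets)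
    (r := S.trans.flatMap encodeTransition) (by simp [SAFAData.word])
  have hH' := consumes_first hij (seeks_seekSets (β := β) S i) (l := S.sets)
    (r := S.trans.flatMap encodeTransition) (by simp [SAFAData.word])
  refine (consumes_readWord h h hQ hQ hH' (consumes_readTransition hQ hA hH)).congr ?_
  congr 1
  ext; simp [SAFAData.TransValid]

/-- Comparing all sets with the first one says nothing about an empty list; this last part of the
check excludes it. -/
theorem moves_name_seekSets {ρ ρ' : ι → ℕ} :
    ((seekSets β i).seq (name β i)).Moves S.word ρ ρ' ↔ ∃ n, S.sets.head? = some n ∧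
      ρ' = Function.update ρ i ((encodeNames S.states ++ encodeNames S.alphabet ++
        encodeName S.start ++ encodeNames S.final ++ encodeName n).length + 1) := by
  have hx : S.word = (encodeNames S.states ++ encodeNames S.alphabet ++ encodeName S.start ++
      encodeNames S.final) ++ (S.sets.flatMap encodeName ++ SAFASymbol.semicolon ::
        S.trans.flatMap encodeTransition) := by
    simp [SAFAData.word, encodeNames]
  rw [moves_seq]
  simp only [seeks_seekSets S i ρ, exists_eq_left, (consumes_name S.word i).moves_iff,
    Function.update_self, Function.update_idem]
  constructor
  · rintro ⟨_, ⟨n, rfl⟩, h, rfl⟩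
    rw [hx, occursAt_iff_prefix] at h
    obtain ⟨s, hs⟩ := h
    obtain ⟨l, hl⟩ := uniquelyReadable_encodeName.exists_eq_append
      (r := SAFASymbol.semicolon :: S.trans.flatMap encodeTransition)
      (fun a s => encodeName_ne_cons (by simp) (by simp) _ _ _) (l' := [n]) (s := s)
      (by simpa using hs)
    refine ⟨n, by simp [hl], ?_⟩
    rw [List.length_append (bs := encodeName n)]
    congr 1; omega
  · rintro ⟨n, hn, rfl⟩
    obtain ⟨l, hl⟩ := List.head?_eq_some_iff.1 hn
    refine ⟨_, ⟨n, rfl⟩, ?_, ?_⟩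
    · rw [hx, occursAt_iff_prefix, hl]
      simp
    · rw [List.length_append (bs := encodeName n)]
      congr 1; omega

theorem valid_iff_head : S.Valid ↔ (S.start ∈ S.states ∧ (∀ q ∈ S.final, q ∈ S.states) ∧
    (∀ h ∈ S.sets, S.sets.head? = some h) ∧ ∀ t ∈ S.trans, S.TransValid t) ∧
    ∃ n, S.sets.head? = some n := by
  constructor
  · rintro ⟨h₁, h₂, ⟨h, hh, h₃⟩, h₄⟩
    have hne : S.sets.head? = some h := by
      obtain ⟨a, l, hl⟩ := List.exists_cons_of_ne_nil (List.ne_nil_of_mem hh)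
      rw [hl, List.head?_cons, h₃ a (by simp [hl])]
    exact ⟨⟨h₁, h₂, fun h' hh' => by rw [hne, h₃ h' hh'], h₄⟩, h, hne⟩
  · rintro ⟨⟨h₁, h₂, h₃, h₄⟩, n, hn⟩
    refine ⟨h₁, h₂, ⟨n, List.mem_of_mem_head? hn, fun h hh => ?_⟩, h₄⟩
    have := h₃ h hh
    rw [hn] at this
    exact (Option.some.inj this).symm

theorem checkValid_sound {j : ι} (hij : i ≠ j) {ρ ρ' : ι → ℕ}
    (hm : (checkValid β i j).Moves S.word ρ ρ') : S.Valid ∧ ∀ k ≠ i, k ≠ j → ρ' k = ρ k := by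
  obtain ⟨ρ₁, h₁, h₂⟩ := moves_seq.1 hm
  obtain ⟨⟨S', hS', h⟩, h₃⟩ := readAll_sound (consumes_checkValid S hij) h₁
  obtain rfl := SAFAData.word_injective h
  obtain ⟨n, hn, rfl⟩ := (moves_name_seekSets S').1 h₂
  refine ⟨(valid_iff_head S').2 ⟨hS', n, hn⟩, fun k hki hkj => ?_⟩
  rw [Function.update_of_ne hki, h₃ k hkj hki]

theorem checkValid_complete {j : ι} (hij : i ≠ j) (ρ : ι → ℕ) (hS : S.Valid) :
    ∃ ρ', (checkValid β i j).Moves S.word ρ ρ' := by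
  obtain ⟨h, n, hn⟩ := (valid_iff_head S).1 hS
  obtain ⟨ρ₁, h₁⟩ := readAll_complete (consumes_checkValid (β := β) S hij) ρ ⟨S, h, rfl⟩
  exact ⟨_, moves_seq.2 ⟨ρ₁, h₁, (moves_name_seekSets S).2 ⟨n, hn, rfl⟩⟩⟩

end Nonemptiness

end HeadProgram

/-! ### Guessing an accepting run of a singleton automaton. -/

namespace HeadProgram

variable {β ι : Type} [DecidableEq ι]

variable (β) in
/-- With the head `i` at a condition, check this condition; the head `g` is away from the left end
if and only if the set is nonempty. -/
def checkCond (i g : ι) : HeadProgram SAFASymbol β ι :=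
  choice i fun b : Bool => (test g (if b then {a | a ≠ .leftEnd} else Set.univ)).seq
    ((expect i (if b then .isIn else .notIn)).seq (name β i))

theorem moves_checkCond {x : List SAFASymbol} {i g : ι} {ρ ρ' : ι → ℕ} :
    (checkCond β i g).Moves x ρ ρ' ↔ ∃ c : SAFACond (List Bool), (c.isMem = true → ρ g ≠ 0) ∧
      OccursAt x (ρ i) (encodeCond c) ∧
      ρ' = Function.update ρ i (ρ i + (encodeCond c).length) := by
  simp only [checkCond, moves_choice, Bool.exists_bool, moves_seq (F := test _ _), moves_test,
    and_assoc, exists_and_left, exists_eq_left, Bool.false_eq_true, if_false, Set.mem_univ,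
    true_and, if_true, Set.mem_ofPred_eq, Ne, readInput_eq_leftEnd_iff,
    ((consumes_expect _ _).seq (consumes_name x i)).moves_iff]
  constructor
  · rintro (⟨_, ⟨_, rfl, _, ⟨n, rfl⟩, rfl⟩, ho, rfl⟩ | ⟨h, _, ⟨_, rfl, _, ⟨n, rfl⟩, rfl⟩, ho, rfl⟩)
    · exact ⟨.notMem n, by simp [SAFACond.isMem], ho, rfl⟩
    · exact ⟨.mem n, fun _ => h, ho, rfl⟩
  · rintro ⟨n | n, hg, ho, rfl⟩
    · exact .inr ⟨hg rfl, _, ⟨_, rfl, _, ⟨n, rfl⟩, rfl⟩, ho, rfl⟩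
    · exact .inl ⟨_, ⟨_, rfl, _, ⟨n, rfl⟩, rfl⟩, ho, rfl⟩

variable (β) in
/-- With the head `i` at an operation, record with the head `g` whether it is an insertion. -/
def executeOp (i g : ι) : HeadProgram SAFASymbol β ι :=
  choice i fun b : Bool =>
    if b then ((expect i .ins).seq (name β i)).seq (toFirst g) else expect i .noIns

/-- The flag is stored in the position of `g`, 0 for an empty set and 1 for a nonempty one; `toFirst
g` raises it. -/
theorem moves_executeOp {x : List SAFASymbol} {i g : ι} (hig : i ≠ g) {ρ ρ' : ι → ℕ} :
    (executeOp β i g).Moves x ρ ρ' ↔ ∃ c : SAFAOp (List Bool), OccursAt x (ρ i) (encodeOp c) ∧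
      ρ' = Function.update (Function.update ρ i (ρ i + (encodeOp c).length)) g
        (if c.isIns then 1 else ρ g) := by
  have hskip : ∀ m, Function.update (Function.update ρ i m) g (ρ g) = Function.update ρ i m := by
    intro m; rw [Function.update_eq_self_iff]; simp [hig.symm]
  simp only [executeOp, moves_choice, Bool.exists_bool, Bool.false_eq_true, if_false, if_true,
    moves_seq (G := toFirst g), moves_toFirst, (consumes_expect _ _).moves_iff,
    ((consumes_expect _ _).seq (consumes_name x i)).moves_iff]
  constructor
  · rintro (⟨_, rfl, ho, rfl⟩ | ⟨_, ⟨_, ⟨_, rfl, _, ⟨n, rfl⟩, rfl⟩, ho, rfl⟩, rfl⟩)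
    · exact ⟨.skip, ho, by simp only [SAFAOp.isIns, Bool.false_eq_true, if_false, hskip]; rfl⟩
    · exact ⟨.ins n, ho, rfl⟩
  · rintro ⟨_ | n, ho, rfl⟩
    · exact .inl ⟨_, rfl, ho, by simp only [SAFAOp.isIns, Bool.false_eq_true, if_false, hskip]; rfl⟩
    · exact .inr ⟨_, ⟨_, ⟨_, rfl, _, ⟨n, rfl⟩, rfl⟩, ho, rfl⟩, rfl⟩

variable (β) in
/-- With the head `p` at the name of the current state, guess a transition and execute it; the
head `p` goes to the name of the new state. -/
def execute (i p g w : ι) : HeadProgram SAFASymbol β ι :=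
  ((seekTrans β i).seq (star i (transition β i))).seq ((sameName i p).seq ((name β i).seq
    ((checkCond β i g).seq ((executeOp β i g).seq (copyHead i p w)))))

variable (S : SAFAData) {i p g w : ι}

/-- Only the positions of `p` (at the name of the current state) and `g` (the flag) carry
information between steps; `i` and `w` are scratch heads, so nothing is said about where they end.
-/
theorem moves_execute (hip : i ≠ p) (hig : i ≠ g) (hiw : i ≠ w) (hpg : p ≠ g) (hpw : p ≠ w)
    (hgw : g ≠ w) {ρ : ι → ℕ} {q : List Bool} (hq : OccursAt S.word (ρ p) (encodeName q)) :
    (∀ ρ', (execute β i p g w).Moves S.word ρ ρ' → ∃ t ∈ S.trans, q = t.src ∧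
      (t.cond.isMem = true → ρ g ≠ 0) ∧ OccursAt S.word (ρ' p) (encodeName t.tgt) ∧
      ρ' g = if t.op.isIns then 1 else ρ g) ∧
    (∀ t ∈ S.trans, q = t.src → (t.cond.isMem = true → ρ g ≠ 0) →
      ∃ ρ', (execute β i p g w).Moves S.word ρ ρ' ∧ OccursAt S.word (ρ' p) (encodeName t.tgt) ∧
        ρ' g = if t.op.isIns then 1 else ρ g) := by
  obtain ⟨u, hseek, hx⟩ : ∃ u, (seekTrans β i).Seeks S.word i u ∧
      S.word = u ++ (S.trans.flatMap encodeTransition ++ []) :=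
    ⟨_, seeks_seekTrans S i, by simp [SAFAData.word]⟩
  have hstar := fun ρ' => hseek.moves_star
    uniquelyReadable_encodeTransition (consumes_transition S.word i)
    (fun a s h => encodeTransition_ne_nil a (List.append_eq_nil_iff.1 h).1) hx (ρ := ρ) (ρ' := ρ')
  have hocc : ∀ l₁ t l₂, S.trans = l₁ ++ t :: l₂ →
      OccursAt S.word ((u ++ l₁.flatMap encodeTransition).length + 1) (encodeTransition t) := by
    intro l₁ t l₂ hl
    rw [hx, hl, List.flatMap_append, List.append_assoc, ← List.append_assoc u,
      occursAt_iff_prefix]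
    simp
  constructor
  · intro ρ' hm
    obtain ⟨ρ₁, h₁, hm⟩ := moves_seq.1 hm
    obtain ⟨ρ₂, h₂, hm⟩ := moves_seq.1 hm
    obtain ⟨ρ₃, h₃, hm⟩ := moves_seq.1 hm
    obtain ⟨ρ₄, h₄, hm⟩ := moves_seq.1 hm
    obtain ⟨ρ₅, h₅, h₆⟩ := moves_seq.1 hm
    obtain ⟨l₁, l₂, hl, rfl⟩ := (hstar _).1 h₁
    obtain ⟨_, ⟨n, rfl⟩, hn, hn', rfl⟩ := ((consumes_sameName S.word hip).moves_pair_iff hip).1 h₂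
    obtain ⟨_, ⟨m, rfl⟩, hm', rfl⟩ := (consumes_name S.word i).moves_iff.1 h₃
    obtain ⟨c, hc, hc', rfl⟩ := moves_checkCond.1 h₄
    obtain ⟨o, ho, rfl⟩ := (moves_executeOp hig).1 h₅
    simp only [Function.update_self, Function.update_of_ne hip, Function.update_of_ne hip.symm,
      Function.update_of_ne hig.symm, Function.update_of_ne hpg.symm] at *
    obtain rfl := uniquelyReadable_encodeName.occursAt_unique encodeName_ne_nil hn' hq
    cases l₂ with
    -- The guess may have passed all transitions, but then no symbol is left for the nonempty code
    -- of a name.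
    | nil =>
      rw [hx, hl, List.append_nil, List.append_nil] at hn
      have := occursAt_iff_prefix (u := u ++ l₁.flatMap encodeTransition) (y := [])
        (v := encodeName n)
      rw [List.append_nil] at this
      exact absurd (List.prefix_nil.1 (this.1 hn)) (encodeName_ne_nil n)
    | cons t l₂ =>
      have ht := hocc l₁ t l₂ hl
      generalize (u ++ l₁.flatMap encodeTransition).length + 1 = P at *
      simp only [encodeTransition, occursAt_append, List.length_append, ← add_assoc] at ht
      obtain ⟨⟨⟨⟨e₁, e₂⟩, e₃⟩, e₄⟩, e₅⟩ := ht
      -- The parts were read one by one; as at most one code word occurs at a position, they are the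
      -- parts of `t`.
      obtain rfl := uniquelyReadable_encodeName.occursAt_unique encodeName_ne_nil e₁ hn
      obtain rfl := uniquelyReadable_encodeName.occursAt_unique encodeName_ne_nil e₂ hm'
      obtain rfl := uniquelyReadable_encodeCond.occursAt_unique encodeCond_ne_nil e₃ hc'
      obtain rfl := uniquelyReadable_encodeOp.occursAt_unique encodeOp_ne_nil e₄ ho
      have h₇ := (moves_copyHead hip hiw hpw (by
        simp only [Function.update_self, Function.update_of_ne hig]
        exact e₅.position_le (encodeName_ne_nil _))).1 h₆
      subst h₇
      refine ⟨t, by simp [hl], rfl, hc, ?_, ?_⟩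
      · simpa [hpw, hig] using e₅
      · simp [hgw, hpg.symm]
  · intro t ht hqt hg
    obtain ⟨l₁, l₂, hl⟩ := List.append_of_mem ht
    have ht := hocc l₁ t l₂ hl
    have h₁ := (hstar _).2 ⟨l₁, t :: l₂, hl, rfl⟩
    generalize (u ++ l₁.flatMap encodeTransition).length + 1 = P at *
    simp only [encodeTransition, occursAt_append, List.length_append, ← add_assoc] at ht
    obtain ⟨⟨⟨⟨e₁, e₂⟩, e₃⟩, e₄⟩, e₅⟩ := ht
    subst hqt
    refine ⟨_, moves_seq.2 ⟨_, h₁, moves_seq.2 ⟨_, ((consumes_sameName S.word hip).moves_pair_iff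
      hip).2 ⟨_, ⟨t.src, rfl⟩, ?_, ?_, rfl⟩, moves_seq.2 ⟨_, (consumes_name S.word i).moves_iff.2
      ⟨_, ⟨t.letter, rfl⟩, ?_, rfl⟩, moves_seq.2 ⟨_, moves_checkCond.2 ⟨t.cond, ?_, ?_, rfl⟩,
      moves_seq.2 ⟨_, (moves_executeOp hig).2 ⟨t.op, ?_, rfl⟩,
      (moves_copyHead hip hiw hpw ?_).2 rfl⟩⟩⟩⟩⟩, ?_, ?_⟩
    all_goals simp only [Function.update_self, Function.update_of_ne hip,
      Function.update_of_ne hip.symm, Function.update_of_ne hig.symm,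
      Function.update_of_ne hpg.symm,
      Function.update_of_ne hgw, Function.update_of_ne hpw, Function.update_of_ne hig]
    · exact e₁
    · exact hq
    · exact e₂
    · exact hg
    · exact e₃
    · exact e₄
    · exact e₅.position_le (encodeName_ne_nil _)
    · exact e₅

variable (β) in
/-- Guess an accepting run. -/
def checkProductive (i p g w : ι) : HeadProgram SAFASymbol β ι :=
  (seekStart β p).seq ((star i (execute β i p g w)).seq (member i p (seekFinal β i)))

/-- Executions of the loop body match `FlagStep` paths step by step; `Represents` is the simulation
relation. The hypothesis `hg` says that the set is empty at the beginning. -/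
theorem moves_checkProductive (hip : i ≠ p) (hig : i ≠ g) (hiw : i ≠ w) (hpg : p ≠ g) (hpw : p ≠ w)
    (hgw : g ≠ w) {ρ : ι → ℕ} (hg : ρ g = 0) :
    (∃ ρ', (checkProductive β i p g w).Moves S.word ρ ρ') ↔ S.Productive := by
  have hmem := consumes_member hip (seeks_seekFinal (β := β) S i) (l := S.final)
    (r := encodeNames S.sets ++ S.trans.flatMap encodeTransition) (by simp [SAFAData.word])
  have hstart : OccursAt S.word
      ((encodeNames S.states ++ encodeNames S.alphabet).length + 1) (encodeName S.start) := by
    rw [SAFAData.word, List.append_assoc, List.append_assoc, List.append_assoc,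
      occursAt_iff_prefix]
    exact List.prefix_append _ _
  let Represents (ρ : ι → ℕ) (c : List Bool × Bool) : Prop :=
    OccursAt S.word (ρ p) (encodeName c.1) ∧ ρ g = if c.2 then 1 else 0
  have hflag : ∀ b b' : Bool, (if b' then 1 else if b then 1 else 0) =
      if (b || b') then 1 else 0 := by decide
  have hexec := fun (ρ : ι → ℕ) (q : List Bool) => moves_execute (β := β) S hip hig hiw hpg hpw hgw
    (ρ := ρ) (q := q)
  have forth : ∀ ρ₁ ρ₂, Relation.ReflTransGen ((execute β i p g w).Moves S.word) ρ₁ ρ₂ →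
      Represents ρ₁ (S.start, false) →
      ∃ c, Relation.ReflTransGen (FlagStep S.trans) (S.start, false) c ∧ Represents ρ₂ c := by
    intro ρ₁ ρ₂ h hρ
    induction h with
    | refl => exact ⟨_, .refl, hρ⟩
    | tail _ hstep ih =>
      obtain ⟨⟨q, b⟩, hc, hq, hb⟩ := ih
      obtain ⟨t, ht, rfl, hmem, ho, hg'⟩ := (hexec _ _ hq).1 _ hstep
      refine ⟨(t.tgt, b || t.op.isIns), hc.tail ⟨t, ht, rfl, fun h => ?_, rfl, rfl⟩, ho, ?_⟩
      · have := hmem h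
        rw [hb] at this
        simpa using this
      · rw [hg', hb]; exact hflag _ _
  have back : ∀ c, Relation.ReflTransGen (FlagStep S.trans) (S.start, false) c →
      ∀ ρ₁, Represents ρ₁ (S.start, false) →
      ∃ ρ₂, Relation.ReflTransGen ((execute β i p g w).Moves S.word) ρ₁ ρ₂ ∧
        Represents ρ₂ c := by
    intro c h ρ₁ hρ
    induction h with
    | refl => exact ⟨_, .refl, hρ⟩
    | tail _ hstep ih =>
      obtain ⟨ρ₂, h₂, hq, hb⟩ := ih
      obtain ⟨t, ht, e₁, e₂, e₃, e₄⟩ := hstep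
      obtain ⟨ρ₃, h₃, ho, hg'⟩ := (hexec _ _ hq).2 t ht e₁ fun h => by rw [hb, e₂ h]; simp
      refine ⟨ρ₃, h₂.tail h₃, by rwa [e₃], ?_⟩
      rw [hg', hb, e₄]; exact hflag _ _
  simp only [checkProductive, moves_seq, seeks_seekStart S p ρ, exists_eq_left, moves_star]
  set ρ₁ := Function.update ρ p ((encodeNames S.states ++ encodeNames S.alphabet).length + 1)
    with hρ₁
  have hrep : Represents ρ₁ (S.start, false) :=
    ⟨by simpa [hρ₁] using hstart, by simp [hρ₁, hpg.symm, hg]⟩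
  constructor
  · rintro ⟨ρ', ρ₂, h₁, h₂⟩
    obtain ⟨⟨q, b⟩, hc, hq, -⟩ := forth _ _ h₁ hrep
    obtain ⟨_, ⟨n, hn, rfl⟩, h₃, -⟩ := hmem.sound h₂
    obtain rfl := uniquelyReadable_encodeName.occursAt_unique encodeName_ne_nil hq (h₃ p rfl).1
    exact ⟨q, hn, b, hc⟩
  · rintro ⟨q, hq, b, hc⟩
    obtain ⟨ρ₂, h₁, h₂, -⟩ := back _ hc _ hrep
    obtain ⟨ρ', h₃, -⟩ := hmem.complete (ρ := ρ₂) ⟨q, hq, rfl⟩ (by rintro _ rfl; exact h₂)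
    exact ⟨ρ', ρ₂, h₁, h₃⟩

end HeadProgram

/-- The nonemptiness problem for singleton automata is in NL. -/
theorem inNL_singletonSAFANonemptiness (D : Type*) [Infinite D] :
    InNL (SingletonSAFANonemptiness D) := by
  have h01 : (1 : Fin 5) ≠ 0 := by decide
  refine ((HeadProgram.checkWord Empty (0 : Fin 5)).seq ((HeadProgram.checkValid Empty 1 0).seq
    (HeadProgram.checkProductive Empty 1 2 3 4))).inNL fun x => ?_
  rw [SAFAData.mem_singletonSAFANonemptiness_iff, exists_comm]
  change _ ↔ ∃ ρ, HeadProgram.Moves _ x _ ρ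
  simp only [HeadProgram.moves_seq]
  constructor
  · rintro ⟨S, rfl, hS, hS'⟩
    obtain ⟨ρ₁, h₁⟩ := HeadProgram.readAll_complete
      (HeadProgram.consumes_checkWord (β := Empty) S.word (0 : Fin 5)) (fun _ => 0) ⟨S, rfl⟩
    have f₁ := (HeadProgram.readAll_sound (HeadProgram.consumes_checkWord S.word _) h₁).2
    obtain ⟨ρ₂, h₂⟩ := HeadProgram.checkValid_complete (β := Empty) S h01 ρ₁ hS
    have f₂ := (HeadProgram.checkValid_sound S h01 h₂).2
    -- Head 3 holds the flag; the two checks do not move it, so it is still at the left end.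
    have hg : ρ₂ 3 = 0 := by rw [f₂ 3 (by decide) (by decide), f₁ 3 (by decide) (by simp)]
    obtain ⟨ρ₃, h₃⟩ := (HeadProgram.moves_checkProductive (β := Empty) S (i := (1 : Fin 5))
      (p := 2) (g := 3) (w := 4) (by decide) (by decide) (by decide) (by decide) (by decide)
      (by decide) hg).2 hS'
    exact ⟨ρ₃, ρ₁, h₁, ρ₂, h₂, h₃⟩
  · rintro ⟨ρ₃, ρ₁, h₁, ρ₂, h₂, h₃⟩
    obtain ⟨⟨S, rfl⟩, f₁⟩ := HeadProgram.readAll_sound (HeadProgram.consumes_checkWord x _) h₁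
    obtain ⟨hS, f₂⟩ := HeadProgram.checkValid_sound S h01 h₂
    have hg : ρ₂ 3 = 0 := by rw [f₂ 3 (by decide) (by decide), f₁ 3 (by decide) (by simp)]
    exact ⟨S, rfl, hS, (HeadProgram.moves_checkProductive (β := Empty) S (i := (1 : Fin 5))
      (p := 2) (g := 3) (w := 4) (by decide) (by decide) (by decide) (by decide) (by decide)
      (by decide) hg).1 ⟨ρ₃, h₃⟩⟩

/-! ### Deterministic programs that print words. -/

instance {α : Type} [Finite α] : Finite (InputSymbol α) :=
  .of_surjective (fun o : Option (Option α) => match o with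
    | none => .leftEnd
    | some none => .rightEnd
    | some (some a) => .letter a)
    fun a => by
      cases a with
      | leftEnd => exact ⟨none, rfl⟩
      | letter a => exact ⟨some (some a), rfl⟩
      | rightEnd => exact ⟨some none, rfl⟩

/-- Continue unless the right end is read. -/
def unlessRightEnd {α : Type} : InputSymbol α → Set Bool
  | .rightEnd => {false}
  | _ => {true}

theorem subsingleton_unlessRightEnd {α : Type} (a : InputSymbol α) :
    (unlessRightEnd a).Subsingleton := by
  cases a <;> exact Set.subsingleton_singleton

theorem true_mem_unlessRightEnd {α : Type} {x : List α} {p : ℕ} :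
    true ∈ unlessRightEnd (readInput x p) ↔ p ≤ x.length := by
  rw [← not_lt, ← readInput_eq_rightEnd_iff (x := x)]
  cases readInput x p <;> simp [unlessRightEnd]

theorem false_mem_unlessRightEnd {α : Type} {x : List α} {p : ℕ} :
    false ∈ unlessRightEnd (readInput x p) ↔ x.length < p := by
  rw [← readInput_eq_rightEnd_iff (x := x)]
  cases readInput x p <;> simp [unlessRightEnd]

/-- All assignments that differ from `ρ` only on a list, where the values are smaller than `N`. -/
def assignments {ι : Type} [DecidableEq ι] (N : ℕ) : List ι → (ι → ℕ) → List (ι → ℕ)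
  | [], ρ => [ρ]
  | v :: vs, ρ => (List.range N).flatMap fun i => assignments N vs (Function.update ρ v i)

theorem mem_assignments {ι : Type} [DecidableEq ι] {N : ℕ} {vs : List ι} {ρ ρ' : ι → ℕ} :
    ρ' ∈ assignments N vs ρ ↔ (∀ v ∈ vs, ρ' v < N) ∧ ∀ v ∉ vs, ρ' v = ρ v := by
  induction vs generalizing ρ with
  | nil =>
    simp only [assignments, List.mem_singleton, List.not_mem_nil, false_imp_iff, implies_true,
      not_false_eq_true, true_imp_iff, true_and, funext_iff]
  | cons v vs ih =>
    simp only [assignments, List.mem_flatMap, List.mem_range, ih]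
    constructor
    · rintro ⟨i, hi, h₁, h₂⟩
      constructor
      · intro u hu
        by_cases hu' : u ∈ vs
        · exact h₁ u hu'
        · obtain rfl : u = v := by simpa [hu'] using hu
          rw [h₂ u hu', Function.update_self]; exact hi
      · intro u hu
        simp only [List.mem_cons, not_or] at hu
        rw [h₂ u hu.2, Function.update_of_ne hu.1]
    · rintro ⟨h₁, h₂⟩
      refine ⟨ρ' v, h₁ v (by simp), fun u hu => h₁ u (by simp [hu]), fun u hu => ?_⟩
      by_cases huv : u = v
      · subst huv; simp
      · rw [Function.update_of_ne huv, h₂ u (by simp [hu, huv])]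

namespace HeadProgram

variable {α β ι : Type} [DecidableEq ι] {x : List α}

/-- On the input `x`, the deterministic program writes `out ρ` and does not change the head
positions `ρ`, provided that the heads in `V` are at the left end. -/
structure Prints (x : List α) (V : Set ι) (F : HeadProgram α β ι)
    (out : (ι → ℕ) → List β) : Prop where
  det : F.Det
  rel : ∀ ρ, (∀ i, ρ i ≤ x.length + 1) → (∀ i ∈ V, ρ i = 0) → F.Rel x ρ (out ρ) ρ

namespace Prints

variable {V W : Set ι} {F G : HeadProgram α β ι} {out out' : (ι → ℕ) → List β}

theorem mono (h : F.Prints x V out) (hVW : V ⊆ W) : F.Prints x W out :=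
  ⟨h.det, fun ρ hρ h0 => h.rel ρ hρ fun i hi => h0 i (hVW hi)⟩

theorem congr (h : F.Prints x V out)
    (h' : ∀ ρ : ι → ℕ, (∀ i, ρ i ≤ x.length + 1) → out ρ = out' ρ) : F.Prints x V out' :=
  ⟨h.det, fun ρ hρ h0 => h' ρ hρ ▸ h.rel ρ hρ h0⟩

theorem seq (hF : F.Prints x V out) (hG : G.Prints x V out') :
    (F.seq G).Prints x V fun ρ => out ρ ++ out' ρ :=
  ⟨hF.det.seq hG.det, fun ρ hρ h0 => (hF.rel ρ hρ h0).seq (hG.rel ρ hρ h0)⟩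

end Prints

/-- Write a word. -/
def write (j : ι) (l : List β) : HeadProgram α β ι :=
  l.foldr (fun b F => (atom j fun _ => {(.stay, some b)}).seq F) (move j .stay)

theorem prints_write (j : ι) (V : Set ι) (l : List β) :
    (write j l : HeadProgram α β ι).Prints x V fun _ => l := by
  induction l with
  | nil =>
    refine ⟨det_move _ _, fun ρ _ _ => ?_⟩
    have := rel_move (x := x) (β := β) j .stay ρ
    rwa [moveHead_stay] at this
  | cons b l ih =>
    refine Prints.seq (out := fun _ => [b])
      ⟨det_atom fun _ => Set.subsingleton_singleton, fun ρ _ _ => ?_⟩ ih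
    exact rel_atom.2 ⟨.stay, some b, rfl, rfl, (moveHead_stay _ _ _).symm⟩

/-- Run the programs in a list. -/
def seqAll (j : ι) (l : List (HeadProgram α β ι)) : HeadProgram α β ι :=
  l.foldr seq (move j .stay)

theorem prints_seqAll {A : Type} (j : ι) {V : Set ι} (l : List A) {P : A → HeadProgram α β ι}
    {out : A → (ι → ℕ) → List β} (h : ∀ a ∈ l, (P a).Prints x V (out a)) :
    (seqAll j (l.map P)).Prints x V fun ρ => l.flatMap fun a => out a ρ := by
  induction l with
  | nil => exact prints_write j V []
  | cons a l ih => exact (h a (by simp)).seq (ih fun b hb => h b (by simp [hb]))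

/-- Run the program given by the symbol under the head `j`. -/
def bySymbol [Finite α] (j : ι) (P : InputSymbol α → HeadProgram α β ι) : HeadProgram α β ι :=
  alt j (fun a => {a}) P

theorem prints_bySymbol [Finite α] {j : ι} {V : Set ι} {P : InputSymbol α → HeadProgram α β ι}
    {out : InputSymbol α → (ι → ℕ) → List β} (h : ∀ a, (P a).Prints x V (out a)) :
    (bySymbol j P).Prints x V fun ρ => out (readInput x (ρ j)) ρ :=
  ⟨det_alt (fun _ => Set.subsingleton_singleton) fun a => (h a).det,
    fun ρ hρ h0 => rel_alt.2 ⟨_, rfl, (h _).rel ρ hρ h0⟩⟩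

/-- The helper `w` must start at the left end and therefore joins `V`. Both `u` and `w` change
between the rounds, so `F` may not require either to be at the left end. -/
theorem Prints.rep {u w : ι} (huw : u ≠ w) {V : Set ι} (hu : u ∉ V) (hw : w ∉ V)
    {F : HeadProgram α β ι} {l : List β} (h : F.Prints x V fun _ => l) :
    (rep u w F).Prints x (insert w V) fun ρ => (List.replicate (ρ u) l).flatten := by
  refine ⟨h.det.rep u w, fun ρ hρ h0 => ?_⟩
  have := rel_rep (x := x) huw (P := F) l (ρ u) (hρ u) (fun _ => ρ) fun a b hab => by
    refine h.rel _ (fun i => ?_) fun i hi => ?_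
    · have := hρ u
      have := hρ i
      simp only [Function.update_apply]
      split_ifs <;> omega
    · rw [Function.update_of_ne (by rintro rfl; exact hw hi),
        Function.update_of_ne (by rintro rfl; exact hu hi)]
      exact h0 i (.inr hi)
  rwa [Function.update_eq_self, Function.update_eq_self_iff.2 (h0 w (.inl rfl)).symm] at this

/-- Run `F` for all positions of the head `v`. -/
def forAll (v : ι) (F : HeadProgram α β ι) : HeadProgram α β ι :=
  (loop v unlessRightEnd (F.seq (move v .right))).seq (F.seq (rewind v))

/-- The loop covers the positions up to `x.length`. At the right end marker the loop is left, and
this last position is served by the second copy of `F` in `forAll`. -/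
theorem iterate_forAll {v : ι} {V : Set ι} (hv : v ∉ V) {F : HeadProgram α β ι}
    {out : (ι → ℕ) → List β} (h : F.Prints x V out) {ρ : ι → ℕ} (hρ : ∀ i, ρ i ≤ x.length + 1)
    (h0 : ∀ i ∈ V, ρ i = 0) (d s : ℕ) (hs : s + d = x.length + 1) :
    Iterate x v unlessRightEnd ((F.seq (move v .right)).Rel x) (Function.update ρ v s)
      ((List.range' s d).flatMap fun i => out (Function.update ρ v i))
      (Function.update ρ v (x.length + 1)) := by
  induction d generalizing s with
  | zero =>
    obtain rfl : s = x.length + 1 := by omega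
    exact .halt (false_mem_unlessRightEnd.2 (by simp))
  | succ d ih =>
    rw [List.range'_succ, List.flatMap_cons]
    refine .more (true_mem_unlessRightEnd.2 (by simp; omega)) ?_ (ih (s + 1) (by omega))
    have r₁ := h.rel (Function.update ρ v s) (fun i => by
      have := hρ i
      simp only [Function.update_apply]
      split_ifs <;> omega) (fun i hi => by
      rw [Function.update_of_ne (by rintro rfl; exact hv hi)]; exact h0 i hi)
    have r₂ := rel_move_right (x := x) (β := β) (ρ := Function.update ρ v s) v (by simp; omega)
    have := r₁.seq r₂
    simpa using this

theorem Prints.forAll {v : ι} {V : Set ι} (hv : v ∉ V) {F : HeadProgram α β ι}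
    {out : (ι → ℕ) → List β} (h : F.Prints x V out) :
    (forAll v F).Prints x (insert v V) fun ρ =>
      (List.range (x.length + 2)).flatMap fun i => out (Function.update ρ v i) := by
  refine ⟨.seq (.loop subsingleton_unlessRightEnd (h.det.seq (det_move _ _)))
    (h.det.seq (det_rewind v)), fun ρ hρ h0 => ?_⟩
  have h0' : ∀ i ∈ V, ρ i = 0 := fun i hi => h0 i (.inr hi)
  have hv0 : Function.update ρ v 0 = ρ := by
    rw [Function.update_eq_self_iff]; exact (h0 v (.inl rfl)).symm
  have r₁ := rel_loop.2 (iterate_forAll hv h hρ h0' (x.length + 1) 0 (by omega))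
  have r₂ := h.rel (Function.update ρ v (x.length + 1)) (fun i => by
      have := hρ i
      simp only [Function.update_apply]
      split_ifs <;> omega) (fun i hi => by
      rw [Function.update_of_ne (by rintro rfl; exact hv hi)]; exact h0' i hi)
  have r₃ := rel_rewind (x := x) (β := β) v (Function.update ρ v (x.length + 1))
  rw [Function.update_idem, hv0] at r₃
  rw [hv0] at r₁
  have := r₁.seq (r₂.seq r₃)
  have e : (List.range (x.length + 2)).flatMap (fun i => out (Function.update ρ v i)) =
      (List.range' 0 (x.length + 1)).flatMap (fun i => out (Function.update ρ v i)) ++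
        (out (Function.update ρ v (x.length + 1)) ++ []) := by
    rw [show x.length + 2 = (x.length + 1) + 1 by rfl, List.range_succ, List.flatMap_append,
      List.range_eq_range']
    simp
  rw [e]
  exact this

/-- Run `F` for all positions of the heads in a list. -/
def forAlls (vs : List ι) (F : HeadProgram α β ι) : HeadProgram α β ι := vs.foldr forAll F

theorem Prints.forAlls {vs : List ι} (hvs : vs.Nodup) {V : Set ι} (hV : ∀ v ∈ vs, v ∉ V)
    {F : HeadProgram α β ι} {out : (ι → ℕ) → List β} (h : F.Prints x V out) :
    (forAlls vs F).Prints x ({v | v ∈ vs} ∪ V) fun ρ =>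
      (assignments (x.length + 2) vs ρ).flatMap out := by
  induction vs with
  | nil => exact (h.mono Set.subset_union_right).congr fun ρ _ => by simp [assignments]
  | cons v vs ih =>
    rw [List.nodup_cons] at hvs
    have ih := ih hvs.2 fun u hu => hV u (by simp [hu])
    refine ((ih.forAll (v := v) ?_).mono ?_).congr fun ρ _ => ?_
    · rintro (h | h)
      · exact hvs.1 h
      · exact hV v (by simp) h
    · rintro u (rfl | h | h)
      · exact .inl (by simp)
      · exact .inl (List.mem_cons_of_mem _ h)
      · exact .inr h
    · rw [assignments, List.flatMap_assoc]

/-- Run `F` as often as a number says whose digits, in the base given by the number of head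
positions, are the positions of the first components of `hs`. -/
def repDigits (j w : ι) : List (ι × ι) → HeadProgram α β ι → HeadProgram α β ι
  | [], _ => move j .stay
  | (u, y) :: hs, F => (rep u w F).seq (repDigits j w hs (forAll y F))

theorem flatMap_range_const (N : ℕ) (l : List β) :
    (List.range N).flatMap (fun _ => l) = (List.replicate N l).flatten := by
  rw [List.flatMap, List.map_const', List.length_range]

theorem flatten_replicate_flatten (m N : ℕ) (l : List β) :
    (List.replicate m (List.replicate N l).flatten).flatten =
      (List.replicate (m * N) l).flatten := by
  induction m with
  | zero => simp
  | succ m ih =>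
    rw [List.replicate_succ, List.flatten_cons, ih, ← List.flatten_append, ← List.replicate_add,
      Nat.succ_mul, Nat.add_comm N]

/-- Horner's scheme: the lowest digit repeats `F` itself, and the remaining digits repeat `forAll y
F`, which amounts to `x.length + 2` copies of `F`. Each level needs a loop head of its own, and the
hypotheses keep all these heads apart. -/
theorem Prints.repDigits {j w : ι} (hs : List (ι × ι)) {V : Set ι} {F : HeadProgram α β ι}
    {l : List β} (h : F.Prints x V fun _ => l) (hw : w ∉ V) (hw' : ∀ a ∈ hs, a.1 ≠ w ∧ a.2 ≠ w)
    (hV : ∀ a ∈ hs, a.1 ∉ V ∧ a.2 ∉ V) (hnd : (hs.map Prod.snd).Nodup)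
    (hdisj : ∀ a ∈ hs, ∀ a' ∈ hs, a.1 ≠ a'.2) :
    (repDigits j w hs F).Prints x (insert w ({y | y ∈ hs.map Prod.snd} ∪ V)) fun ρ =>
      (List.replicate (Nat.ofDigits (x.length + 2) (hs.map fun a => ρ a.1)) l).flatten := by
  induction hs generalizing V F l with
  | nil => exact (prints_write j _ []).congr fun ρ _ => by simp
  | cons a hs ih =>
    obtain ⟨u, y⟩ := a
    simp only [List.map_cons, List.nodup_cons] at hnd
    have hw₀ := hw' (u, y) (by simp)
    have hV₀ := hV (u, y) (by simp)
    have h₁ := h.rep hw₀.1 hV₀.1 hw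
    have h₂ := h.forAll (v := y) hV₀.2
    simp only [flatMap_range_const] at h₂
    have h₃ := ih h₂ (by rintro (h | h); exacts [hw₀.2 h.symm, hw h])
      (fun a ha => hw' a (by simp [ha])) (fun a ha => ⟨?_, ?_⟩) hnd.2
      (fun a ha a' ha' => hdisj a (by simp [ha]) a' (by simp [ha']))
    · refine ((h₁.mono ?_).seq (h₃.mono ?_)).congr fun ρ _ => ?_
      · rintro i (rfl | hi)
        · exact .inl rfl
        · exact .inr (.inr hi)
      · rintro i (rfl | hi | rfl | hi)
        · exact .inl rfl
        · exact .inr (.inl (List.mem_cons_of_mem _ hi))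
        · exact .inr (.inl (by simp))
        · exact .inr (.inr hi)
      · simp only [List.map_cons, Nat.ofDigits_cons]
        rw [flatten_replicate_flatten, ← List.flatten_append, ← List.replicate_add, mul_comm]
    · rintro (h | h)
      · exact hdisj a (by simp [ha]) (u, y) (by simp) h
      · exact (hV a (by simp [ha])).1 h
    · rintro (h | h)
      · exact hnd.1 (h ▸ List.mem_map_of_mem ha)
      · exact (hV a (by simp [ha])).2 h

/-- Write the letter `b` as often as the position of the head `p` after a move says. -/
def writeMoved [Finite α] (p w : ι) (b : β) : HeadMove → HeadProgram α β ι
  | .stay => rep p w (write p [b])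
  | .right => (rep p w (write p [b])).seq
      (bySymbol p fun a => write p (match a with | .rightEnd => [] | _ => [b]))
  | .left => alt p unlessLeftEnd fun c =>
      if c then (move p .left).seq ((rep p w (write p [b])).seq (move p .right)) else write p []

/-- A right move costs one extra letter unless the right end is read. Output cannot be retracted, so
a left move is actually made before the counting and then undone. -/
theorem prints_writeMoved [Finite α] {p w : ι} (hpw : p ≠ w) (b : β) (m : HeadMove) :
    (writeMoved p w b m : HeadProgram α β ι).Prints x {w} fun ρ =>
      List.replicate (m.moveWithin x.length (ρ p)) b := by
  have hrep : (rep p w (write p [b]) : HeadProgram α β ι).Prints x {w} fun ρ =>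
      List.replicate (ρ p) b := by
    have := (prints_write (α := α) (x := x) p ∅ [b]).rep hpw (by simp) (by simp)
    rw [insert_empty_eq] at this
    refine this.congr fun ρ _ => ?_
    simp
  cases m with
  | stay => exact hrep
  | right =>
    refine (hrep.seq (prints_bySymbol fun a => prints_write p {w} _)).congr fun ρ hρ => ?_
    simp only [HeadMove.moveWithin]
    split_ifs with h
    · have : ¬ readInput x (ρ p) = .rightEnd := by rw [readInput_eq_rightEnd_iff]; omega
      rw [List.replicate_succ']
      congr 1
      split
      · contradiction
      · rfl
    · have : readInput x (ρ p) = .rightEnd := by rw [readInput_eq_rightEnd_iff]; omega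
      rw [this]; simp
  | left =>
    refine ⟨det_alt subsingleton_unlessLeftEnd fun c => ?_, fun ρ hρ h0 => rel_alt.2 ?_⟩
    · cases c
      · exact (prints_write (x := x) p ∅ []).det
      · exact (det_move _ _).seq (hrep.det.seq (det_move _ _))
    · by_cases hp : ρ p = 0
      · refine ⟨false, false_mem_unlessLeftEnd.2 hp, ?_⟩
        have := (prints_write (α := α) (β := β) (x := x) p ∅ []).rel ρ hρ (by simp)
        simpa [HeadMove.moveWithin, hp] using this
      · refine ⟨true, true_mem_unlessLeftEnd.2 hp, ?_⟩
        have hp' := hρ p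
        have r₁ := rel_move_left (x := x) (β := β) p ρ
        have r₂ := hrep.rel (Function.update ρ p (ρ p - 1)) (fun i => by
          have := hρ i
          simp only [Function.update_apply]
          split_ifs <;> omega) (fun i hi => by
          obtain rfl : i = w := hi
          rw [Function.update_of_ne hpw.symm]; exact h0 i rfl)
        have r₃ := rel_move_right (x := x) (β := β) (ρ := Function.update ρ p (ρ p - 1)) p
          (by simp; omega)
        rw [Function.update_self, Function.update_idem, Nat.sub_add_cancel (by omega),
          Function.update_eq_self] at r₃
        have := r₁.seq (r₂.seq r₃)
        simpa [HeadMove.moveWithin] using this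

end HeadProgram

/-! ### Printing graphs whose edges are given by affine expressions -/

/-- The name that consists of the numbers of a list in unary notation. -/
def unaryName (l : List ℕ) : List Bool := l.flatMap fun m => List.replicate m true ++ [false]

theorem unaryName_injective : Function.Injective unaryName := by
  have key : ∀ (m m' : ℕ) (r r' : List Bool),
      List.replicate m true ++ false :: r = List.replicate m' true ++ false :: r' →
        m = m' ∧ r = r' := by
    intro m
    induction m with
    | zero => rintro (_ | m') r r' h <;> simp [List.replicate_succ] at h ⊢; exact h
    | succ m ih =>
      rintro (_ | m') r r' h
      · simp [List.replicate_succ] at h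
      · simp only [List.replicate_succ, List.cons_append, List.cons.injEq, true_and] at h
        obtain ⟨rfl, rfl⟩ := ih m' r r' h
        exact ⟨rfl, rfl⟩
  intro l
  induction l with
  | nil => rintro (_ | ⟨m, l'⟩) h <;> simp [unaryName] at h ⊢
  | cons m l ih =>
    rintro (_ | ⟨m', l'⟩) h
    · simp [unaryName] at h
    · simp only [unaryName, List.flatMap_cons, List.append_assoc, List.singleton_append] at h
      obtain ⟨rfl, h₁⟩ := key _ _ _ _ h
      rw [ih h₁]

section NodeName

variable {σ : Type} [Fintype σ]

/-- The name of a node that is given by an index, an input position and numbers. -/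
noncomputable def nodeName (i p : ℕ) (X : σ → ℕ) : List Bool :=
  unaryName (i :: p :: Finset.univ.toList.map X)

theorem nodeName_inj {i i' p p' : ℕ} {X X' : σ → ℕ} :
    nodeName i p X = nodeName i' p' X' ↔ i = i' ∧ p = p' ∧ X = X' := by
  rw [nodeName, nodeName, unaryName_injective.eq_iff, List.cons.injEq, List.cons.injEq]
  simp [List.map_inj_left, funext_iff]

/-- Keeps the empty name free for the target of the graph. -/
theorem nodeName_ne_nil (i p : ℕ) (X : σ → ℕ) : nodeName i p X ≠ [] := by
  simp [nodeName, unaryName]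

/-- A node as a function of an input position and numbers. -/
structure NodeExpr (σ : Type) : Type where
  index : ℕ
  move : HeadMove
  mul : σ → ℕ
  add : σ → ℕ

namespace NodeExpr

/-- The node for given values of the variables. -/
noncomputable def name (e : NodeExpr σ) (n p : ℕ) (X : σ → ℕ) : List Bool :=
  nodeName e.index (e.move.moveWithin n p) fun s => e.mul s * X s + e.add s

/-- The node given by an expression, or the empty name. -/
noncomputable def name? (e : Option (NodeExpr σ)) (n p : ℕ) (X : σ → ℕ) : List Bool :=
  e.elim [] fun e => e.name n p X

end NodeExpr

end NodeName

/-- The heads of a program that prints a graph. -/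
inductive EdgeHead (σ : Type) (E : ℕ) : Type
  | pos
  | aux
  | level (e : Fin E)
  | digit (s : σ) (e : Fin E)
  deriving DecidableEq

instance {σ : Type} [Finite σ] {E : ℕ} : Finite (EdgeHead σ E) :=
  .of_surjective (fun o : Option (Option (Fin E ⊕ σ × Fin E)) => match o with
    | none => .pos
    | some none => .aux
    | some (some (.inl e)) => .level e
    | some (some (.inr (s, e))) => .digit s e)
    fun a => by
      cases a with
      | pos => exact ⟨none, rfl⟩
      | aux => exact ⟨some none, rfl⟩
      | level e => exact ⟨some (some (.inl e)), rfl⟩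
      | digit s e => exact ⟨some (some (.inr (s, e))), rfl⟩

namespace EdgeHead

variable {σ : Type} {E : ℕ}

/-- The number represented by the digit heads of `s`. -/
def value (N : ℕ) (ρ : EdgeHead σ E → ℕ) (s : σ) : ℕ :=
  Nat.ofDigits N ((List.finRange E).map fun e => ρ (.digit s e))

/-- The heads that are needed for the evaluation of a node expression. -/
def work : Set (EdgeHead σ E) := {v | v = .aux ∨ ∃ e, v = .level e}

/-- The heads that represent the values of the variables. -/
noncomputable def vars (σ : Type) [Fintype σ] (E : ℕ) : List (EdgeHead σ E) :=
  .pos :: Finset.univ.toList.flatMap fun s => (List.finRange E).map (.digit s)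

theorem mem_vars [Fintype σ] {v : EdgeHead σ E} : v ∈ vars σ E ↔ v ∉ work := by
  cases v <;> simp [vars, work]

theorem nodup_vars [Fintype σ] : (vars σ E).Nodup := by
  rw [vars, List.nodup_cons]
  refine ⟨by simp, List.nodup_flatMap.2 ⟨fun s _ => ?_, ?_⟩⟩
  · exact (List.nodup_finRange E).map fun a b h => by simpa using h
  · refine (Finset.nodup_toList _).imp fun {a b} hab => ?_
    simp only [Function.onFun, List.disjoint_left, List.mem_map, not_exists]
    rintro _ ⟨e, -, rfl⟩ e'
    simpa using fun h => absurd h.symm hab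

theorem exists_digits (N E m : ℕ) (hm : m < N ^ E) :
    ∃ d : Fin E → ℕ, (∀ e, d e < N) ∧ Nat.ofDigits N ((List.finRange E).map d) = m := by
  induction E generalizing m with
  | zero => exact ⟨fun _ => 0, fun e => e.elim0, by simp at hm; simp [hm]⟩
  | succ E ih =>
    have hN : 0 < N := by
      by_contra h
      obtain rfl : N = 0 := by omega
      simp at hm
    obtain ⟨d, hd, hd'⟩ := ih (m / N) (Nat.div_lt_of_lt_mul (by rwa [Nat.pow_succ'] at hm))
    refine ⟨Fin.cons (m % N) d, fun e => ?_, ?_⟩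
    · cases e using Fin.cases with
      | zero => exact Nat.mod_lt _ hN
      | succ e => exact hd e
    · rw [List.finRange_succ, List.map_cons, List.map_map, Nat.ofDigits_cons]
      simp only [Fin.cons_zero, Function.comp_def, Fin.cons_succ, hd']
      exact Nat.mod_add_div m N

end EdgeHead

section EdgeList

variable {α σ : Type} [Fintype σ] [DecidableEq σ]

/-- The edges given by pairs of node expressions, which may depend on the symbol at the input
position.  The empty name is used as the target of the pairs without second component. -/
noncomputable def edgeList (E : ℕ)
    (schemas : InputSymbol α → List (NodeExpr σ × Option (NodeExpr σ))) (x : List α) :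
    List (List Bool × List Bool) :=
  (assignments (x.length + 2) (EdgeHead.vars σ E) fun _ => 0).flatMap fun ρ =>
    (schemas (readInput x (ρ .pos))).map fun e =>
      (e.1.name x.length (ρ .pos) (EdgeHead.value (x.length + 2) ρ),
        NodeExpr.name? e.2 x.length (ρ .pos) (EdgeHead.value (x.length + 2) ρ))

/-- The bound on the numbers is deliberately dropped; soundness of the configuration graph does not
need it. -/
theorem exists_of_mem_edgeList {E : ℕ}
    {schemas : InputSymbol α → List (NodeExpr σ × Option (NodeExpr σ))} {x : List α}
    {a : List Bool × List Bool} (ha : a ∈ edgeList E schemas x) :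
    ∃ p X, p ≤ x.length + 1 ∧ ∃ e ∈ schemas (readInput x p),
      a = (e.1.name x.length p X, NodeExpr.name? e.2 x.length p X) := by
  simp only [edgeList, List.mem_flatMap, List.mem_map, mem_assignments] at ha
  obtain ⟨ρ, ⟨hρ, -⟩, e, he, rfl⟩ := ha
  exact ⟨ρ .pos, _, Nat.le_of_lt_succ (hρ _ (by simp [EdgeHead.vars])), e, he, rfl⟩

/-- A number below `(x.length + 2) ^ E` is given by `E` digits, each of which is a head position. -/
theorem mem_edgeList {E : ℕ}
    {schemas : InputSymbol α → List (NodeExpr σ × Option (NodeExpr σ))} {x : List α} {p : ℕ}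
    (hp : p ≤ x.length + 1) {X : σ → ℕ} (hX : ∀ s, X s < (x.length + 2) ^ E)
    {e : NodeExpr σ × Option (NodeExpr σ)} (he : e ∈ schemas (readInput x p)) :
    (e.1.name x.length p X, NodeExpr.name? e.2 x.length p X) ∈ edgeList E schemas x := by
  choose d hd hd' using fun s => EdgeHead.exists_digits (x.length + 2) E (X s) (hX s)
  let ρ : EdgeHead σ E → ℕ := fun
    | .pos => p
    | .digit s e => d s e
    -- The working heads are not enumerated and have to keep their initial position.
    | _ => 0
  have hρ : EdgeHead.value (x.length + 2) ρ = X := funext hd'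
  simp only [edgeList, List.mem_flatMap, List.mem_map, mem_assignments]
  refine ⟨ρ, ⟨fun v _ => ?_, fun v hv => ?_⟩, e, he, by rw [hρ]⟩
  · cases v with
    | pos => exact Nat.lt_succ_of_le hp
    | digit s e => exact hd s e
    | aux => exact Nat.succ_pos _
    | level e => exact Nat.succ_pos _
  · rw [EdgeHead.mem_vars, not_not] at hv
    rcases hv with rfl | ⟨e, rfl⟩ <;> rfl

end EdgeList

namespace HeadProgram

variable {α σ : Type} [Finite α] [Fintype σ] [DecidableEq σ] {E : ℕ} {x : List α}

open EdgeHead SAFASymbol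

/-- Write the value of a linear expression in one of the numbers. -/
def writeSlot (s : σ) (m c : ℕ) : HeadProgram α SAFASymbol (EdgeHead σ E) :=
  (repDigits .pos .aux ((List.finRange E).map fun e => (.digit s e, .level e))
    (write .pos (List.replicate m (bit true)))).seq
      (write .pos (List.replicate c (bit true) ++ [bit false]))

omit [Finite α] [Fintype σ] in
theorem prints_writeSlot (s : σ) (m c : ℕ) :
    (writeSlot s m c : HeadProgram α SAFASymbol (EdgeHead σ E)).Prints x work fun ρ =>
      List.replicate (m * value (x.length + 2) ρ s + c) (bit true) ++ [bit false] := by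
  have h := (prints_write (α := α) (x := x) (EdgeHead.pos : EdgeHead σ E) ∅
    (List.replicate m (bit true))).repDigits (j := .pos) (w := .aux)
      ((List.finRange E).map fun e => (.digit s e, .level e))
      (by simp) (by simp) (by simp)
      (by
        rw [List.map_map]
        exact (List.nodup_finRange E).map fun a b h => by simpa using h)
      (by simp)
  refine ((h.mono ?_).seq (prints_write _ _ _)).congr fun ρ _ => ?_
  · rintro v (rfl | h | h)
    · exact .inl rfl
    · obtain ⟨e, -, rfl⟩ := by simpa using h
      exact .inr ⟨_, rfl⟩
    · simp at h
  · rw [List.map_map, ← List.append_assoc, value, List.replicate_add]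
    congr 2
    rw [mul_comm]
    exact (List.flatten_replicate_replicate ..)

/-- Write a node. -/
noncomputable def writeNode (e : NodeExpr σ) : HeadProgram α SAFASymbol (EdgeHead σ E) :=
  (write .pos (List.replicate e.index (bit true) ++ [bit false])).seq <|
    (writeMoved .pos .aux (bit true) e.move).seq <| (write .pos [bit false]).seq <|
      (seqAll .pos (Finset.univ.toList.map fun s => writeSlot s (e.mul s) (e.add s))).seq
        (write .pos [comma])

theorem prints_writeNode (e : NodeExpr σ) :
    (writeNode e : HeadProgram α SAFASymbol (EdgeHead σ E)).Prints x work fun ρ =>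
      encodeName (e.name x.length (ρ .pos) (value (x.length + 2) ρ)) := by
  refine ((prints_write _ _ _).seq (((prints_writeMoved (by simp) _ _).mono ?_).seq
    ((prints_write _ _ _).seq ((prints_seqAll _ _ fun s _ => prints_writeSlot s _ _).seq
      (prints_write _ _ _))))).congr fun ρ _ => ?_
  · rintro v rfl; exact .inl rfl
  · simp [encodeName, NodeExpr.name, nodeName, unaryName, List.map_flatMap, List.flatMap_map]

/-- Write a node or the empty name. -/
noncomputable def writeNode? (e : Option (NodeExpr σ)) :
    HeadProgram α SAFASymbol (EdgeHead σ E) :=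
  e.elim (write .pos [comma]) writeNode

theorem prints_writeNode? (e : Option (NodeExpr σ)) :
    (writeNode? e : HeadProgram α SAFASymbol (EdgeHead σ E)).Prints x work fun ρ =>
      encodeName (NodeExpr.name? e x.length (ρ .pos) (value (x.length + 2) ρ)) := by
  cases e with
  | none => exact prints_write _ _ _
  | some e => exact prints_writeNode e

/-- Write words for all edges, where `l` is used to separate the nodes. -/
noncomputable def writeEdges
    (schemas : InputSymbol α → List (NodeExpr σ × Option (NodeExpr σ))) (l : List SAFASymbol) :
    HeadProgram α SAFASymbol (EdgeHead σ E) :=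
  forAlls (vars σ E) (bySymbol .pos fun a => seqAll .pos ((schemas a).map fun e =>
    (writeNode e.1).seq ((write .pos l).seq (writeNode? e.2))))

theorem prints_writeEdges
    (schemas : InputSymbol α → List (NodeExpr σ × Option (NodeExpr σ))) (l : List SAFASymbol) :
    (writeEdges schemas l : HeadProgram α SAFASymbol (EdgeHead σ E)).Prints x Set.univ fun ρ =>
      (assignments (x.length + 2) (vars σ E) ρ).flatMap fun ρ =>
        (schemas (readInput x (ρ .pos))).flatMap fun e =>
          encodeName (e.1.name x.length (ρ .pos) (value (x.length + 2) ρ)) ++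
            (l ++ encodeName (NodeExpr.name? e.2 x.length (ρ .pos) (value (x.length + 2) ρ))) := by
  have h (a : InputSymbol α) := prints_seqAll (x := x) (EdgeHead.pos : EdgeHead σ E) (V := work)
    (schemas a) fun e _ => (prints_writeNode e.1).seq
      ((prints_write .pos _ l).seq (prints_writeNode? e.2))
  exact (Prints.forAlls nodup_vars (fun v hv => mem_vars.1 hv) (prints_bySymbol h)).mono
    (Set.subset_univ _)

/-- Write the automaton for a graph. -/
noncomputable def writeGraph
    (schemas : InputSymbol α → List (NodeExpr σ × Option (NodeExpr σ))) (s : List Bool) :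
    HeadProgram α SAFASymbol (EdgeHead σ E) :=
  (write .pos (encodeName s ++ encodeName [])).seq <| (writeEdges schemas []).seq <|
    (write .pos ([semicolon] ++ encodeNames [[]] ++ encodeName s ++ encodeNames [[]] ++
      encodeNames [[]])).seq <| writeEdges schemas [comma, notIn, comma, noIns]

/-- The edges are printed twice, once to list their ends as states and once as transitions. Between
the ends of a transition stand the empty letter, `!p` of the empty set name, and no insertion. -/
theorem prints_writeGraph
    (schemas : InputSymbol α → List (NodeExpr σ × Option (NodeExpr σ))) (s : List Bool) :
    ∃ out, (writeGraph schemas s : HeadProgram α SAFASymbol (EdgeHead σ E)).Prints x Set.univ out ∧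
      out (fun _ => 0) = (SAFAData.ofGraph (edgeList E schemas x) s []).word := by
  refine ⟨_, (prints_write _ _ _).seq ((prints_writeEdges schemas _).seq
    ((prints_write _ _ _).seq (prints_writeEdges schemas _))), ?_⟩
  simp [SAFAData.word, SAFAData.ofGraph, encodeNames, encodeTransition, encodeName, encodeCond,
    encodeOp, edgeList, List.flatMap_assoc, List.flatMap_map]

end HeadProgram

theorem isLogSpaceComputable_word_ofGraph {α σ : Type} [Finite α] [Fintype σ] [DecidableEq σ]
    (E : ℕ) (schemas : InputSymbol α → List (NodeExpr σ × Option (NodeExpr σ))) (s : List Bool) :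
    IsLogSpaceComputable fun x => (SAFAData.ofGraph (edgeList E schemas x) s []).word := by
  refine HeadProgram.isLogSpaceComputable
    (HeadProgram.writeGraph schemas s : HeadProgram α SAFASymbol (EdgeHead σ E)) ?_ fun x => ?_
  -- Determinism does not depend on the input, so any word serves here.
  · obtain ⟨out, h, -⟩ := HeadProgram.prints_writeGraph (x := []) (E := E) schemas s
    exact h.det
  · obtain ⟨out, h, ho⟩ := HeadProgram.prints_writeGraph (x := x) (E := E) schemas s
    exact ⟨_, ho ▸ h.rel (fun _ => 0) (by simp) (by simp)⟩

/-! ### Tapes as pairs of numbers -/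

instance : Finite HeadMove :=
  .of_surjective (fun i : Fin 3 => match i with
    | 0 => .left
    | 1 => .stay
    | 2 => .right)
    fun m => by
      cases m with
      | left => exact ⟨0, rfl⟩
      | stay => exact ⟨1, rfl⟩
      | right => exact ⟨2, rfl⟩

/-- A move of the head of a work tape, with the symbol that it finds, where `stuck` is a left move
from cell `0`. -/
inductive TapeAct (Γ : Type) : Type
  | stuck
  | stay
  | left (d : Γ)
  | right (d : Γ)

namespace TapeAct

variable {Γ : Type}

instance [Finite Γ] : Finite (TapeAct Γ) :=
  .of_surjective (fun o : Bool ⊕ Bool × Γ => match o with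
    | .inl false => .stuck
    | .inl true => .stay
    | .inr (false, d) => .left d
    | .inr (true, d) => .right d)
    fun a => by
      cases a with
      | stuck => exact ⟨.inl false, rfl⟩
      | stay => exact ⟨.inl true, rfl⟩
      | left d => exact ⟨.inr (false, d), rfl⟩
      | right d => exact ⟨.inr (true, d), rfl⟩

/-- The move of the head. -/
def move : TapeAct Γ → HeadMove
  | stuck => .left
  | stay => .stay
  | left _ => .left
  | right _ => .right

/-- The symbol under the head after `a` has been written and the head has moved. -/
def symbol (a : Γ) : TapeAct Γ → Γ
  | stuck => a
  | stay => a
  | left d => d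
  | right d => d

/-- Factors for the numbers of the left (`false`) and the right (`true`) part of the tape before
the move. -/
def srcMul (b : ℕ) : TapeAct Γ → Bool → ℕ
  | stuck, false => 0
  | left _, false => b
  | right _, true => b
  | _, _ => 1

/-- Summands for the parts of the tape before the move. -/
def srcAdd (g : Γ → ℕ) : TapeAct Γ → Bool → ℕ
  | left d, false => g d + 1
  | right d, true => g d
  | _, _ => 0

/-- Factors for the parts of the tape after the move. -/
def tgtMul (b : ℕ) : TapeAct Γ → Bool → ℕ
  | stuck, false => 0
  | left _, true => b
  | right _, false => b
  | _, _ => 1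

/-- Summands for the parts of the tape after `a` has been written and the head has moved. -/
def tgtAdd (g : Γ → ℕ) (a : Γ) : TapeAct Γ → Bool → ℕ
  | left _, true => g a
  | right _, false => g a + 1
  | _, _ => 0

end TapeAct

section Tape

variable {Γ : Type}

/-- The number for the tape to the left of the head. -/
def encodeLeft (g : Γ → ℕ) (b : ℕ) : List Γ → ℕ
  | [] => 0
  | d :: l => b * encodeLeft g b l + (g d + 1)

/-- The number for the tape to the right of the head. -/
def encodeRight (g : Γ → ℕ) (b : ℕ) : List Γ → ℕ
  | [] => 0
  | d :: r => b * encodeRight g b r + g d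

theorem encodeLeft_lt {g : Γ → ℕ} {b : ℕ} (hb : ∀ a, g a + 1 < b) (l : List Γ) :
    encodeLeft g b l < b ^ l.length := by
  induction l with
  | nil => simp [encodeLeft]
  | cons d l ih =>
    have := hb d
    rw [encodeLeft, List.length_cons, Nat.pow_succ']
    nlinarith [Nat.mul_le_mul_left b (Nat.succ_le_of_lt ih)]

theorem encodeRight_lt {g : Γ → ℕ} {b : ℕ} (hb : ∀ a, g a + 1 < b) (l : List Γ) :
    encodeRight g b l < b ^ l.length := by
  induction l with
  | nil => simp [encodeRight]
  | cons d l ih =>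
    have := hb d
    rw [encodeRight, List.length_cons, Nat.pow_succ']
    nlinarith [Nat.mul_le_mul_left b (Nat.succ_le_of_lt ih)]

theorem eq_and_eq_of_mul_add_eq {b u v c d : ℕ} (hc : c < b) (hd : d < b)
    (h : b * u + c = b * v + d) : u = v ∧ c = d := by
  have h₁ := congrArg (· % b) h
  have h₂ := congrArg (· / b) h
  have hb : 0 < b := by omega
  simp only [Nat.mul_add_mod, Nat.mod_eq_of_lt hc, Nat.mod_eq_of_lt hd] at h₁
  simp only [Nat.mul_add_div hb, Nat.div_eq_of_lt hc, Nat.div_eq_of_lt hd] at h₂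
  exact ⟨h₂, h₁⟩

/-- The tape on which `l` (from right to left), `a` and `r` are written; the head is on `a`. -/
def zipTape (blank : Γ) (l : List Γ) (a : Γ) (r : List Γ) (j : ℕ) : Γ :=
  (l.reverse ++ a :: r)[j]?.getD blank

theorem zipTape_cons (blank : Γ) (d : Γ) (l : List Γ) (a : Γ) (r : List Γ) :
    zipTape blank (d :: l) a r = zipTape blank l d (a :: r) := by
  funext j; simp [zipTape]

theorem zipTape_blank (blank : Γ) (l : List Γ) (a : Γ) :
    zipTape blank l a [blank] = zipTape blank l a [] := by
  funext j
  simp only [zipTape, List.getElem?_append, List.length_reverse]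
  split_ifs with h
  · rfl
  · rcases hj : j - l.length with _ | _ | m <;> simp

theorem zipTape_length (blank : Γ) (l : List Γ) (a : Γ) (r : List Γ) :
    zipTape blank l a r l.length = a := by
  simp [zipTape]

theorem update_zipTape (blank : Γ) (l : List Γ) (a a' : Γ) (r : List Γ) :
    Function.update (zipTape blank l a r) l.length a' = zipTape blank l a' r := by
  funext j
  rcases eq_or_ne j l.length with rfl | h
  · rw [Function.update_self, zipTape_length]
  · rw [Function.update_of_ne h]
    simp only [zipTape, List.getElem?_append, List.length_reverse]
    split_ifs with h'
    · rfl
    · obtain ⟨m, hm⟩ : ∃ m, j - l.length = m + 1 := ⟨j - l.length - 1, by omega⟩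
      simp [hm]

/-- The tape `T` with head position `P` is given by the symbol `a` under the head and by numbers
for the parts to the left and to the right of the head, where at most `S` cells are represented. -/
def TapeRep (g : Γ → ℕ) (b : ℕ) (blank : Γ) (S : ℕ) (T : ℕ → Γ) (P : ℕ) (a : Γ) (X : Bool → ℕ) :
    Prop :=
  ∃ l r, T = zipTape blank l a r ∧ P = l.length ∧ X false = encodeLeft g b l ∧
    X true = encodeRight g b r ∧ l.length + r.length < S

variable {g : Γ → ℕ} {b : ℕ} {blank : Γ} {S : ℕ} {T : ℕ → Γ} {P : ℕ} {a : Γ} {X : Bool → ℕ}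

theorem tapeRep_blank (hS : 0 < S) : TapeRep g b blank S (fun _ => blank) 0 blank fun _ => 0 := by
  refine ⟨[], [], ?_, rfl, rfl, rfl, hS⟩
  funext j
  rcases j with _ | j <;> simp [zipTape]

theorem TapeRep.symbol_eq (h : TapeRep g b blank S T P a X) : T P = a := by
  obtain ⟨l, r, rfl, rfl, -⟩ := h
  exact zipTape_length ..

theorem TapeRep.lt_pow (hb : ∀ a, g a + 1 < b) (h : TapeRep g b blank S T P a X) (z : Bool) :
    X z < b ^ S := by
  obtain ⟨l, r, -, -, h₁, h₂, hS⟩ := h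
  have hb0 : 0 < b := (Nat.succ_pos _).trans (hb a)
  cases z
  · rw [h₁]
    exact (encodeLeft_lt hb l).trans_le (Nat.pow_le_pow_right hb0 (by omega))
  · rw [h₂]
    exact (encodeRight_lt hb r).trans_le (Nat.pow_le_pow_right hb0 (by omega))

/-- Left digits are positive, so the left number is zero only in cell 0; right digits are zero for
blanks, so blanks beyond the represented part are invisible. Otherwise the remainder modulo `b`
determines the cell entered. A right move may represent one more cell, hence `S + 1`. -/
theorem TapeRep.step (hg : Function.Injective g) (hb : ∀ a, g a + 1 < b) (h0 : g blank = 0)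
    (t : TapeAct Γ)
    (h : TapeRep g b blank S T P a fun z => t.srcMul b z * X z + t.srcAdd g z) (a' : Γ) :
    TapeRep g b blank (S + 1) (Function.update T P a') (t.move.move P) (t.symbol a')
      fun z => t.tgtMul b z * X z + t.tgtAdd g a' z := by
  obtain ⟨l, r, rfl, rfl, hl, hr, hS⟩ := h
  rw [update_zipTape]
  cases t with
  | stuck =>
    simp only [TapeAct.srcMul, TapeAct.srcAdd] at hl hr
    -- The factor 0 makes the left number zero whatever the parameter is, and only an empty left
    -- part has this code.
    obtain rfl : l = [] := by
      cases l with
      | nil => rfl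
      | cons d l => simp [encodeLeft] at hl
    exact ⟨[], r, rfl, rfl, by simp [TapeAct.tgtMul, TapeAct.tgtAdd, encodeLeft], hr, by omega⟩
  | stay => exact ⟨l, r, rfl, rfl, hl, hr, by omega⟩
  | left d =>
    simp only [TapeAct.srcMul, TapeAct.srcAdd] at hl hr
    cases l with
    | nil => simp [encodeLeft] at hl
    | cons e l =>
      obtain ⟨h₁, h₂⟩ := eq_and_eq_of_mul_add_eq (hb _) (hb _) hl
      obtain rfl : d = e := hg (Nat.succ_injective h₂)
      refine ⟨l, a' :: r, zipTape_cons .., rfl, ?_, ?_, ?_⟩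
      · simpa [TapeAct.tgtMul, TapeAct.tgtAdd] using h₁
      · simp only [TapeAct.tgtMul, TapeAct.tgtAdd, encodeRight]
        rw [← hr, one_mul, add_zero]
      · simp only [List.length_cons] at hS ⊢; omega
  | right d =>
    simp only [TapeAct.srcMul, TapeAct.srcAdd] at hl hr
    have hl' : b * X false + (g a' + 1) = encodeLeft g b (a' :: l) := by
      rw [encodeLeft, ← hl, one_mul, add_zero]
    cases r with
    -- The right number is zero, so the digit `g d` is zero and the cell entered is blank.
    | nil =>
      have hb' := hb d
      have hd : g d = 0 := by simp [encodeRight] at hr; omega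
      obtain rfl : d = blank := hg (hd.trans h0.symm)
      have hX : X true = 0 := by
        simp only [encodeRight, Nat.add_eq_zero_iff, Nat.mul_eq_zero] at hr
        omega
      refine ⟨a' :: l, [], ?_, rfl, hl', by simpa [TapeAct.tgtMul, TapeAct.tgtAdd, encodeRight], ?_⟩
      · rw [zipTape_cons]; exact (zipTape_blank ..).symm
      · simp only [List.length_cons] at hS ⊢; simpa using hS
    | cons e r =>
      have hd := hb d
      have he := hb e
      obtain ⟨h₁, h₂⟩ := eq_and_eq_of_mul_add_eq (by omega) (by omega) hr
      obtain rfl : d = e := hg h₂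
      refine ⟨a' :: l, r, (zipTape_cons ..).symm, rfl, hl', ?_, ?_⟩
      · simpa [TapeAct.tgtMul, TapeAct.tgtAdd] using h₁
      · simp only [List.length_cons] at hS ⊢; omega

/-- The parameters `Y` are the old numbers or their quotients by `b`, so they stay in the range of
the enumeration. The bound `hP` pays for the new cell when the head leaves the represented part;
thus `S` need not grow. -/
theorem TapeRep.exists_step (hb : ∀ a, g a + 1 < b) (h0 : g blank = 0)
    (h : TapeRep g b blank S T P a X) (m : HeadMove) (hP : m.move P < S) (a' : Γ) :
    ∃ (t : TapeAct Γ) (Y : Bool → ℕ), t.move = m ∧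
      (∀ z, X z = t.srcMul b z * Y z + t.srcAdd g z) ∧ (∀ z, Y z ≤ X z) ∧
      TapeRep g b blank S (Function.update T P a') (m.move P) (t.symbol a')
        fun z => t.tgtMul b z * Y z + t.tgtAdd g a' z := by
  have hb0 : 0 < b := (Nat.succ_pos _).trans (hb blank)
  obtain ⟨l, r, rfl, rfl, hl, hr, hS⟩ := h
  rw [update_zipTape]
  cases m with
  | stay =>
    exact ⟨.stay, X, rfl, fun z => by cases z <;> simp [TapeAct.srcMul, TapeAct.srcAdd],
      fun z => le_rfl, l, r, rfl, rfl, by simpa [TapeAct.tgtMul, TapeAct.tgtAdd],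
      by simpa [TapeAct.tgtMul, TapeAct.tgtAdd], hS⟩
  | left =>
    cases l with
    | nil =>
      refine ⟨.stuck, X, rfl, fun z => ?_, fun z => le_rfl, [], r, rfl, rfl, ?_, ?_, hS⟩
      · cases z <;> simp [TapeAct.srcMul, TapeAct.srcAdd, hl, encodeLeft]
      · simp [TapeAct.tgtMul, TapeAct.tgtAdd, encodeLeft]
      · simpa [TapeAct.tgtMul, TapeAct.tgtAdd] using hr
    | cons d l =>
      refine ⟨.left d, fun z => cond z (X true) (encodeLeft g b l), rfl, fun z => ?_, fun z => ?_,
        l, a' :: r, zipTape_cons .., rfl, ?_, ?_, ?_⟩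
      · cases z <;> simp [TapeAct.srcMul, TapeAct.srcAdd, hl, encodeLeft]
      · cases z
        · rw [hl, encodeLeft]
          exact (Nat.le_mul_of_pos_left _ hb0).trans (Nat.le_add_right _ _)
        · exact le_rfl
      · simp [TapeAct.tgtMul, TapeAct.tgtAdd]
      · simp [TapeAct.tgtMul, TapeAct.tgtAdd, encodeRight, hr]
      · simp only [List.length_cons] at hS ⊢; omega
  | right =>
    have hP : l.length + 1 < S := hP
    cases r with
    | nil =>
      refine ⟨.right blank, X, rfl, fun z => ?_, fun z => le_rfl, a' :: l, [], ?_, rfl, ?_, ?_, ?_⟩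
      · cases z <;> simp [TapeAct.srcMul, TapeAct.srcAdd, hr, encodeRight, h0]
      · rw [zipTape_cons]; exact (zipTape_blank ..).symm
      · simp [TapeAct.tgtMul, TapeAct.tgtAdd, encodeLeft, hl]
      · simp [TapeAct.tgtMul, TapeAct.tgtAdd, hr]
      · simpa using hP
    | cons d r =>
      refine ⟨.right d, fun z => cond z (encodeRight g b r) (X false), rfl, fun z => ?_,
        fun z => ?_, a' :: l, r, (zipTape_cons ..).symm, rfl, ?_, ?_, ?_⟩
      · cases z <;> simp [TapeAct.srcMul, TapeAct.srcAdd, hr, encodeRight]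
      · cases z
        · exact le_rfl
        · rw [hr, encodeRight]
          exact (Nat.le_mul_of_pos_left _ hb0).trans (Nat.le_add_right _ _)
      · simp [TapeAct.tgtMul, TapeAct.tgtAdd, encodeLeft, hl]
      · simp [TapeAct.tgtMul, TapeAct.tgtAdd]
      · simp only [List.length_cons] at hS ⊢; omega

end Tape

/-! ### Configuration graphs of machines -/

theorem exists_numbering {Γ : Type} [Finite Γ] (blank : Γ) :
    ∃ (g : Γ → ℕ) (b : ℕ), Function.Injective g ∧ g blank = 0 ∧ ∀ a, g a + 1 < b := by
  classical
  obtain ⟨n, ⟨e⟩⟩ := Finite.exists_equiv_fin Γ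
  have : NeZero n := ⟨by rintro rfl; exact (e blank).elim0⟩
  -- The swap gives the blank the number 0; base `n + 1` leaves room for the shifted digits of the
  -- left part.
  refine ⟨fun a => e.trans (Equiv.swap (e blank) 0) a, n + 1, ?_, ?_, fun a => ?_⟩
  · exact Fin.val_injective.comp (Equiv.injective _)
  · simp
  · exact Nat.succ_lt_succ (Fin.is_lt _)

namespace OfflineTM

variable {α : Type} (M : OfflineTM α Empty) (g : M.Γ → ℕ) (b : ℕ)
  (idx : M.State × (Fin M.k → M.Γ) → ℕ)

/-- The components of an edge between configurations. -/
abbrev EdgeData : Type :=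
  (M.State × (Fin M.k → M.Γ)) × M.State × HeadMove × (Fin M.k → M.Γ) × (Fin M.k → TapeAct M.Γ)

/-- The action of the machine for an edge. -/
def EdgeData.action {M : OfflineTM α Empty} (e : M.EdgeData) : TMAction Empty M.State M.Γ M.k :=
  ⟨e.2.1, e.2.2.1, e.2.2.2.1, fun i => (e.2.2.2.2 i).move, none⟩

/-- The nodes of an edge as expressions. -/
def EdgeData.exprs (e : M.EdgeData) :
    NodeExpr (Fin M.k × Bool) × Option (NodeExpr (Fin M.k × Bool)) :=
  (⟨idx e.1, .stay, fun s => (e.2.2.2.2 s.1).srcMul b s.2, fun s => (e.2.2.2.2 s.1).srcAdd g s.2⟩,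
    some ⟨idx (e.2.1, fun i => (e.2.2.2.2 i).symbol (e.2.2.2.1 i)), e.2.2.1,
      fun s => (e.2.2.2.2 s.1).tgtMul b s.2,
      fun s => (e.2.2.2.2 s.1).tgtAdd g (e.2.2.2.1 s.1) s.2⟩)

/-- An edge from an accepting configuration to the empty name. -/
def acceptExprs (q : M.State × (Fin M.k → M.Γ)) :
    NodeExpr (Fin M.k × Bool) × Option (NodeExpr (Fin M.k × Bool)) :=
  (⟨idx q, .stay, fun _ => 1, fun _ => 0⟩, none)

/-- For each symbol under the input head there are only finitely many edge data, whatever the input;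
numbers enter only as parameters. -/
theorem exists_schemas : ∃ l : InputSymbol α → List (NodeExpr (Fin M.k × Bool) ×
    Option (NodeExpr (Fin M.k × Bool))), ∀ a e, e ∈ l a ↔
      (∃ d : M.EdgeData, d.action ∈ M.next d.1.1 a d.1.2 ∧ d.exprs M g b idx = e) ∨
      ∃ q : M.State × (Fin M.k → M.Γ), q.1 ∈ M.accept ∧ M.acceptExprs idx q = e := by
  have := M.finite_state
  have := M.finite_Γ
  have h (a) : ((EdgeData.exprs M g b idx '' {d | d.action ∈ M.next d.1.1 a d.1.2}) ∪
      M.acceptExprs idx '' {q | q.1 ∈ M.accept}).Finite :=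
    ((Set.toFinite _).image _).union ((Set.toFinite _).image _)
  exact ⟨fun a => (h a).toFinset.toList, fun a e => by simp⟩

variable {M g b idx}

/-- The configuration is described by the state, the symbols under the work heads and numbers for
the other parts of the work tapes. -/
def Rep (M : OfflineTM α Empty) (g : M.Γ → ℕ) (b : ℕ) (S : ℕ) (c : M.Config)
    (q : M.State × (Fin M.k → M.Γ)) (X : Fin M.k × Bool → ℕ) : Prop :=
  c.state = q.1 ∧
    ∀ i, TapeRep g b M.blank S (c.tape i) (c.pos i) (q.2 i) fun z => X (i, z)

theorem Rep.symbols {S : ℕ} {c : M.Config} {q : M.State × (Fin M.k → M.Γ)}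
    {X : Fin M.k × Bool → ℕ} (h : M.Rep g b S c q X) : (fun i => c.tape i (c.pos i)) = q.2 :=
  funext fun i => (h.2 i).symbol_eq

theorem Rep.step (hg : Function.Injective g) (hb : ∀ a, g a + 1 < b) (h0 : g M.blank = 0)
    {x : List α} {S : ℕ} {c : M.Config} {d : M.EdgeData} {Y : Fin M.k × Bool → ℕ}
    (h : M.Rep g b S c d.1 fun s => (d.2.2.2.2 s.1).srcMul b s.2 * Y s +
      (d.2.2.2.2 s.1).srcAdd g s.2) :
    M.Rep g b (S + 1) (M.perform x c d.action)
      (d.2.1, fun i => (d.2.2.2.2 i).symbol (d.2.2.2.1 i)) fun s =>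
        (d.2.2.2.2 s.1).tgtMul b s.2 * Y s + (d.2.2.2.2 s.1).tgtAdd g (d.2.2.2.1 s.1) s.2 :=
  ⟨rfl, fun i => (h.2 i).step hg hb h0 (d.2.2.2.2 i) (X := fun z => Y (i, z)) (d.2.2.2.1 i)⟩

theorem Rep.exists_step (hb : ∀ a, g a + 1 < b) (h0 : g M.blank = 0) {x : List α} {S : ℕ}
    {c : M.Config} {q : M.State × (Fin M.k → M.Γ)} {X : Fin M.k × Bool → ℕ}
    (h : M.Rep g b S c q X) (A : TMAction Empty M.State M.Γ M.k)
    (hS : ∀ i, (M.perform x c A).pos i < S) :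
    ∃ (d : M.EdgeData) (Y : Fin M.k × Bool → ℕ), d.action = A ∧ d.1 = q ∧
      X = (fun s => (d.2.2.2.2 s.1).srcMul b s.2 * Y s + (d.2.2.2.2 s.1).srcAdd g s.2) ∧
      (∀ s, Y s < b ^ S) ∧ M.Rep g b S (M.perform x c A)
      (d.2.1, fun i => (d.2.2.2.2 i).symbol (d.2.2.2.1 i)) fun s =>
        (d.2.2.2.2 s.1).tgtMul b s.2 * Y s + (d.2.2.2.2 s.1).tgtAdd g (d.2.2.2.1 s.1) s.2 := by
  choose t Y h₁ h₂ h₃ h₄ using fun i =>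
    (h.2 i).exists_step hb h0 (A.workMove i) (hS i) (A.write i)
  obtain ⟨q', m, w, v, o⟩ := A
  -- The output alphabet is `Empty`.
  obtain rfl : o = none := Subsingleton.elim _ _
  refine ⟨(q, q', m, w, t), fun s => Y s.1 s.2, ?_, rfl, funext fun s => h₂ s.1 s.2,
    fun s => (h₃ s.1 s.2).trans_lt ((h.2 s.1).lt_pow hb s.2), rfl, h₄⟩
  simp only [EdgeData.action, TMAction.mk.injEq, true_and, and_true]
  exact funext h₁

/-- The name of the initial configuration. -/
noncomputable def startName (M : OfflineTM α Empty) (idx : M.State × (Fin M.k → M.Γ) → ℕ) :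
    List Bool :=
  nodeName (idx (M.start, fun _ => M.blank)) 0 fun _ : Fin M.k × Bool => 0

/-- The space bound `S` keeps the numbers below `b ^ S`, so every step of the computation is among
the printed edges. -/
theorem reflTransGen_of_reachable (hb : ∀ a, g a + 1 < b) (h0 : g M.blank = 0)
    {l : InputSymbol α → List (NodeExpr (Fin M.k × Bool) × Option (NodeExpr (Fin M.k × Bool)))}
    (hl : ∀ a (d : M.EdgeData), d.action ∈ M.next d.1.1 a d.1.2 → d.exprs M g b idx ∈ l a)
    {x : List α} {S E : ℕ} (hS : ∀ c, M.Reachable x c → ∀ i, c.pos i < S)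
    (hE : b ^ S ≤ (x.length + 2) ^ E) {c : M.Config} (hc : M.Reachable x c) :
    ∃ q X, c.inPos ≤ x.length + 1 ∧ M.Rep g b S c q X ∧
      Relation.ReflTransGen (fun u v => (u, v) ∈ edgeList E l x) (M.startName idx)
        (nodeName (idx q) c.inPos X) := by
  induction hc with
  | refl =>
    exact ⟨_, _, Nat.zero_le _, ⟨rfl, fun i => tapeRep_blank (hS _ .refl i)⟩, .refl⟩
  | @tail c c' hc hstep ih =>
    have hc' : M.Reachable x c' := .tail hc hstep
    obtain ⟨A, hA, rfl⟩ := hstep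
    obtain ⟨q, X, hp, hrep, hr⟩ := ih
    obtain ⟨d, Y, rfl, rfl, rfl, hY, hrep'⟩ := hrep.exists_step hb h0 (x := x) A (hS _ hc')
    refine ⟨_, _, min_le_right _ _, hrep', hr.tail ?_⟩
    rw [actions, hrep.symbols, hrep.1] at hA
    have := mem_edgeList hp (fun s => (hY s).trans_le hE) (hl _ _ hA)
    simp only [EdgeData.exprs, NodeExpr.name?, Option.elim, NodeExpr.name,
      HeadMove.moveWithin_eq_min _ hp] at this
    rw [show min (HeadMove.stay.move c.inPos) (x.length + 1) = c.inPos from min_eq_left hp] at this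
    exact this

/-- No space bound is needed: the number `S` of represented cells may grow along the path. Codes are
injective, so an edge leaving the node of a reachable configuration is a genuine step or a witness
of acceptance. -/
theorem accepts_of_reflTransGen (hg : Function.Injective g) (hb : ∀ a, g a + 1 < b)
    (h0 : g M.blank = 0) (hidx : Function.Injective idx)
    {l : InputSymbol α → List (NodeExpr (Fin M.k × Bool) × Option (NodeExpr (Fin M.k × Bool)))}
    (hl : ∀ a e, e ∈ l a →
      (∃ d : M.EdgeData, d.action ∈ M.next d.1.1 a d.1.2 ∧ d.exprs M g b idx = e) ∨
      ∃ q : M.State × (Fin M.k → M.Γ), q.1 ∈ M.accept ∧ M.acceptExprs idx q = e)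
    {x : List α} {E : ℕ} {m : List Bool}
    (h : Relation.ReflTransGen (fun u v => (u, v) ∈ edgeList E l x) (M.startName idx) m) :
    M.Accepts x ∨ ∃ c S q X, M.Reachable x c ∧ c.inPos ≤ x.length + 1 ∧ M.Rep g b S c q X ∧
      m = nodeName (idx q) c.inPos X := by
  induction h with
  | refl =>
    exact .inr ⟨_, 1, (M.start, fun _ => M.blank), fun _ => 0, .refl, Nat.zero_le _,
      ⟨rfl, fun i => tapeRep_blank one_pos⟩, rfl⟩
  | tail _ hstep ih =>
    rcases ih with ih | ⟨c, S, q, X, hc, hp, hrep, rfl⟩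
    · exact .inl ih
    obtain ⟨p, Y, hp', e, he, heq⟩ := exists_of_mem_edgeList hstep
    simp only [Prod.mk.injEq] at heq
    obtain ⟨h₁, rfl⟩ := heq
    rcases hl _ _ he with ⟨d, hd, rfl⟩ | ⟨q', hq', rfl⟩
    · obtain ⟨h₂, h₃, rfl⟩ := nodeName_inj.1 h₁
      obtain rfl := hidx h₂
      simp only [EdgeData.exprs, HeadMove.moveWithin] at h₃
      obtain rfl := h₃
      refine .inr ⟨_, _, _, _, hc.tail ⟨_, ?_, rfl⟩, min_le_right _ _,
        hrep.step (x := x) hg hb h0, ?_⟩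
      · rw [actions, hrep.symbols, hrep.1]; exact hd
      · simp only [EdgeData.exprs, NodeExpr.name?, Option.elim, NodeExpr.name,
          HeadMove.moveWithin_eq_min _ hp]
        rfl
    · obtain ⟨h₂, -, -⟩ := nodeName_inj.1 h₁
      obtain rfl := hidx h₂
      exact .inl ⟨c, hc, hrep.1 ▸ hq'⟩

/-- With the constant `c = b ^ C`, the crude bound `c ≤ 2 ^ c` allows the exponents to be exchanged,
and `2 ^ (Nat.log 2 n + 1)` is at most `(n + 2) ^ 2`. -/
theorem pow_le_pow_of_log (b C n : ℕ) :
    b ^ (C * (Nat.log 2 n + 1)) ≤ (n + 2) ^ (2 * b ^ C) := by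
  have h : 2 ^ (Nat.log 2 n + 1) ≤ (n + 2) ^ 2 := by
    rcases Nat.eq_zero_or_pos n with rfl | hn
    · simp
    · have := Nat.pow_log_le_self 2 hn.ne'
      rw [pow_succ]
      nlinarith
  calc b ^ (C * (Nat.log 2 n + 1)) = (b ^ C) ^ (Nat.log 2 n + 1) := pow_mul ..
    _ ≤ (2 ^ b ^ C) ^ (Nat.log 2 n + 1) := Nat.pow_le_pow_left Nat.lt_two_pow_self.le _
    _ = (2 ^ (Nat.log 2 n + 1)) ^ b ^ C := by rw [← pow_mul, ← pow_mul, mul_comm]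
    _ ≤ ((n + 2) ^ 2) ^ b ^ C := Nat.pow_le_pow_left h _
    _ = (n + 2) ^ (2 * b ^ C) := (pow_mul ..).symm

end OfflineTM

theorem isNLHard_singletonSAFANonemptiness (D : Type*) [Infinite D] :
    IsNLHard (SingletonSAFANonemptiness D) := by
  rintro α _ A ⟨M, ⟨C, hC⟩, hA⟩
  have := M.finite_state
  have := M.finite_Γ
  obtain ⟨g, b, hg, h0, hb⟩ := exists_numbering M.blank
  obtain ⟨idx, hidx⟩ := Countable.exists_injective_nat (M.State × (Fin M.k → M.Γ))
  obtain ⟨l, hl⟩ := M.exists_schemas g b idx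
  refine ⟨_, isLogSpaceComputable_word_ofGraph (2 * b ^ C) l (M.startName idx), fun x => ?_⟩
  rw [hA, SAFAData.word_ofGraph_mem_iff]
  constructor
  · rintro ⟨c, hc, hq⟩
    have hE := OfflineTM.pow_le_pow_of_log b C x.length
    obtain ⟨q, X, hp, hrep, hr⟩ := OfflineTM.reflTransGen_of_reachable hb h0
      (fun a d hd => (hl a _).2 (.inl ⟨d, hd, rfl⟩)) (hC x) hE hc
    -- The last edge goes from the accepting configuration to the empty name.
    refine hr.tail ?_
    have := mem_edgeList hp (fun s => ((hrep.2 s.1).lt_pow hb s.2).trans_le hE)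
      ((hl _ _).2 (.inr ⟨q, hrep.1 ▸ hq, rfl⟩))
    simpa [OfflineTM.acceptExprs, NodeExpr.name, NodeExpr.name?, HeadMove.moveWithin] using this
  · intro h
    rcases OfflineTM.accepts_of_reflTransGen hg hb h0 hidx (fun a e => (hl a e).1) h with
      h | ⟨c, S, q, X, -, -, -, h⟩
    · exact h
    -- The path ends at the empty name, which belongs to no configuration.
    · exact absurd h.symm (nodeName_ne_nil _ _ _)

/-- The nonemptiness problem for singleton SAFA is NL-complete, whatever countably infinite set
the data values are taken from. -/
theorem mainTheorem5 (D : Type*) [Countable D] [Infinite D] :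
    IsNLComplete (SingletonSAFANonemptiness D) :=
  ⟨inNL_singletonSAFANonemptiness D, isNLHard_singletonSAFANonemptiness D⟩
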